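/- **Setting.** Consider the FnF-BFT protocol with $n=3f+1$ replicas, of which at most $f$ are byzantine, in a partially synchronous network: messages between correct replicas arrive eventually, and within $\Delta\ge 1$ time steps after an unknown global stabilization time GST. Byzantine replicas behave arbitrarily but cannot forge signatures; invalid messages are filtered out. *Epoch operation.* The protocol advances in epochs $e=1,2,\dots$. In epoch $e$ every replica $v$ is the leader of $C_v(e)$ local sequence numbers, where $C_v(1)=C_{\min}$ and, with $c_v(e)$ the agreed record of the number of requests committed under $v$ in epoch $e$, $C_v(e+1)=\max(C_{\min},\max_{0\le i\le f}c_v(e-i))$ if $c_v(e)<C_v(e)$ and $C_v(e+1)=2c_v(e)$ otherwise (nothing is assumed on the truthfulness of the record). Client requests are always pending for every leader. For each local number the leader broadcasts a signed pre-prepare, collects $2f+1$ partial prepare signatures into a prepared-certificate, and then $2f+1$ partial commit signatures into a commit-certificate (threshold signatures). Every $k$ local numbers ($k\ge1$ constant) the leader collects a checkpoint-certificate in the same way; replicas only process local numbers up to $2k$ above the last stable checkpoint. *Epoch-change.* A replica calls an epoch-change if all requests of the epoch are committed, if the epoch timer $T$ expires, if the no-progress timers $T_p$ of $2f+1$ leaders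 have expired, if $f+1$ other replicas have called for higher epochs, or if the epoch-change timer $T_e$ expires without a new epoch ($T_e$ is doubled with each unsuccessful epoch-change after $f$ consecutive ones). Its signed epoch-change message contains the last checkpoint-certificate of every leader and the at most $2k$ prepared- and commit-certificates above it. The primary of the new epoch collects $2f+1$ such messages, performs a 3-phase reliable broadcast, and sends a signed new-epoch message with these messages and signed pre-prepares for the hanging requests. *Primaries.* The first $n$ epochs explore all replicas as primaries; then the schedule cycles through the $2f+1$ primaries with the best recorded performance in their last turn (redetermined after each cycle), interrupted by a replica whenever its last turn as primary was $g$ epochs ago, where $g\ge 3f+1$. *Cost.* The authenticator complexity is the number of computations and verifications of (partial or combined) signatures done by correct replicas. A request counts as committed when a correct replica holds a commit-certificate for it; committed requests are counted by sequence number, without null requests. **Theorem.** There is an absolute constant $K$ such that for every $k\ge1$ and $c>0$ there are $N$ and $a,b>0$ such that the following holds for every $n=3f+1\ge N$, whenever $C_{\min}\ge c\,n^2$, $T_p,T_e\ge K\Delta$ and $T\ge K\Delta C_{\min}$, in every execution: 1. The authenticator complexity spent on any one local sequence number of a leader in an epoch is at most $bn$, and at least $an$ if a request is committed there. 2. The authenticator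 complexity of the epoch-change to any epoch is at most $bn^3$, and it is at least $an^3$ for all sufficiently large epoch numbers. 3. Every epoch with a correct primary and a sufficiently large number is entered by all correct replicas, and at least $an^3$ requests first proposed in it are committed in it. 4. (Amortized complexity.) For all sufficiently large $t\ge\mathrm{GST}$, let $A(t)$ be the authenticator complexity between GST and $t$, and $R(t)$ the number of requests committed between GST and $t$. Then $R(t)>0$ and $a\,n\le A(t)/R(t)\le b\,n$; that is, after GST the amortized authenticator complexity of committing a request is $\Theta(n)$. "Sufficiently large" in 2.–4. may depend on the execution (after GST the correct replicas need some time to become synchronized); $K,N,a,b$ do not. -/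

import Mathlib

open scoped Classical

noncomputable section

namespace FnF

/-! ## Parameters, messages -/

/-- Configuration of the protocol: resilience `f` (so `n = 3f+1` replicas), checkpoint period `k`,
sliding window `g` of the primary rotation, minimum load `Cmin` of a leader, message delay `Δ`
(which holds after GST), epoch timer `T`, no-progress timer `Tp`, default epoch-change timer `Te`.
Time is discrete. -/
structure Params where
  f : ℕ
  k : ℕ
  g : ℕ
  Cmin : ℕ
  Δ : ℕ
  T : ℕ
  Tp : ℕ
  Te : ℕ

/-- The number of replicas. -/
abbrev Params.n (P : Params) : ℕ := 3 * P.f + 1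

/-- The replicas. -/
abbrev Rep (P : Params) := Fin P.n

/-- A sequence number: `(e, v, i)` is the sequence number that is first assigned as the `i`-th local
number of leader `v` in epoch `e`. -/
abbrev SeqNo (P : Params) := ℕ × Rep P × ℕ

/-- A sequence number together with the request proposed for it (client requests are numbered,
`none` is the null request). -/
abbrev Item (P : Params) := SeqNo P × Option ℕ

/-- Content of an epoch-change message: the last epoch its sender has entered and, for every leader
`v` of that epoch, the local number `ck v` of the last stable checkpoint (with its certificate), and
the prepared- and the commit-certificates for the local numbers `ck v + 1, …, ck v + 2k`. -/
structure ECData (P : Params) where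
  last : ℕ
  ck : Rep P → ℕ
  prep : Rep P → Fin (2 * P.k) → Option (Item P)
  comm : Rep P → Fin (2 * P.k) → Option (Item P)

/-- Messages. `e` is the epoch, `v` the leader, `i` a local number of `v` in epoch `e`. The messages
`prepare`, `commit`, `checkpoint` carry a partial signature of their sender, `prepared`, `committed`,
`ckptCert` carry a combined threshold signature, all the others a signature of their sender. -/
inductive Msg (P : Params) where
  | prePrepare (e : ℕ) (v : Rep P) (i : ℕ) (x : Item P)
  | prepare (e : ℕ) (v : Rep P) (i : ℕ) (x : Item P)
  | prepared (e : ℕ) (v : Rep P) (i : ℕ) (x : Item P)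
  | commit (e : ℕ) (v : Rep P) (i : ℕ) (x : Item P)
  | committed (e : ℕ) (v : Rep P) (i : ℕ) (x : Item P)
  | checkpoint (e : ℕ) (v : Rep P) (i : ℕ)
  | ckptCert (e : ℕ) (v : Rep P) (i : ℕ)
  | epochChange (e : ℕ) (d : ECData P)
  | rbInit (e : ℕ) (J : Finset (Rep P))
  | rbEcho (e : ℕ) (J : Finset (Rep P))
  | rbReady (e : ℕ) (J : Finset (Rep P))
  | newEpoch (e : ℕ) (V : Rep P → Option (ECData P))

variable {P : Params}

/-! ## Leader loads and primary rotation -/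

/-- The load `C_v(e)`, given the record `c e v` of the number of requests committed under leader `v`
in epoch `e`. The first epoch is epoch `1`. -/
def loadOf (P : Params) (c : ℕ → Rep P → ℕ) : ℕ → Rep P → ℕ
  | 0, _ => P.Cmin
  | 1, _ => P.Cmin
  | e + 2, v =>
    if c (e + 1) v < loadOf P c (e + 1) v then
      max P.Cmin (((Finset.range (P.f + 1)).filter (· ≤ e)).sup fun i => c (e + 1 - i) v)
    else 2 * c (e + 1) v

/-- The last epoch before `e` in which `u` was primary (`0` if there is none). -/
def lastTurn (prim : ℕ → Rep P) (e : ℕ) (u : Rep P) : ℕ :=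
  Nat.findGreatest (fun e' => 1 ≤ e' ∧ prim e' = u) (e - 1)

/-- `l` lists `2f+1` best primaries with respect to the performance in their last turn before epoch
`e`, the one not seen for the longest time first. -/
def IsBest (perf : ℕ → ℕ) (prim : ℕ → Rep P) (e : ℕ) (l : List (Rep P)) : Prop :=
  l.Nodup ∧ l.length = 2 * P.f + 1 ∧
  (∀ u ∈ l, ∀ w, w ∉ l → perf (lastTurn prim e w) ≤ perf (lastTurn prim e u)) ∧
  l.Pairwise fun u w => lastTurn prim e u ≤ lastTurn prim e w

/-- `prim` is a primary schedule produced by the rotation: all replicas are explored first, in the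
order of their identifiers; then the schedule cycles through the `2f+1` best primaries, which are
redetermined after every cycle, interrupted by the replica whose last turn lies `g` epochs back.
`queue e` is the rest of the current cycle at the start of epoch `e`. -/
def IsRotation (perf : ℕ → ℕ) (prim : ℕ → Rep P) : Prop :=
  (∀ e, 1 ≤ e → e ≤ P.n → (prim e : ℕ) + 1 = e) ∧
  ∃ queue : ℕ → List (Rep P), queue (P.n + 1) = [] ∧ ∀ e, P.n < e →
    (lastTurn prim e (prim e) + P.g = e ∧ queue (e + 1) = queue e) ∨
    ((∀ u, lastTurn prim e u + P.g ≠ e) ∧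
      ((queue e ≠ [] ∧ queue e = prim e :: queue (e + 1)) ∨
       (queue e = [] ∧ IsBest perf prim e (prim e :: queue (e + 1)))))

/-- The static data of a run. -/
structure System (P : Params) where
  /-- the byzantine replicas -/
  byz : Finset (Rep P)
  byz_card : byz.card ≤ P.f
  /-- the record, agreed upon in the epoch-changes, of the number of requests committed under each
  leader in each epoch; nothing is assumed on how truthful it is -/
  record : ℕ → Rep P → ℕ
  /-- the primary of each epoch; the performance of a primary is the number of requests committed in
  its epoch -/
  prim : ℕ → Rep P
  rotation : IsRotation (fun e => ∑ v, record e v) prim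
  /-- the leader to whose buckets a client request is assigned in an epoch -/
  owner : ℕ → ℕ → Rep P
  /-- the request that a leader picks for a new local number: requests are always pending in the
  buckets of every leader -/
  pend : ℕ → Rep P → ℕ → ℕ
  pend_owner : ∀ e v i, owner e (pend e v i) = v

variable (S : System P)

/-- The load of leader `v` in epoch `e`. -/
def System.load (e : ℕ) (v : Rep P) : ℕ := loadOf P S.record e v

/-! ## Hanging requests, computed from the set `V` of epoch-change messages -/

/-- The latest epoch entered by a sender in `V`. -/
def topEpoch (V : Rep P → Option (ECData P)) : ℕ :=
  Finset.univ.sup fun w => ((V w).map ECData.last).getD 0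

/-- The latest stable checkpoint of leader `v` in `V`. -/
def sMin (V : Rep P → Option (ECData P)) (v : Rep P) : ℕ :=
  Finset.univ.sup fun w =>
    ((V w).map fun d => if d.last = topEpoch V then d.ck v else 0).getD 0

/-- Some message in `V` holds a prepared-certificate for `x` at local number `i` of leader `v`. -/
def PrepIn (V : Rep P → Option (ECData P)) (v : Rep P) (i : ℕ) (x : Item P) : Prop :=
  ∃ w d, ∃ j : Fin (2 * P.k), V w = some d ∧ d.last = topEpoch V ∧ i = d.ck v + j + 1 ∧
    d.prep v j = some x

/-- Some message in `V` holds a commit-certificate for `x` at local number `i` of leader `v`. -/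
def CommIn (V : Rep P → Option (ECData P)) (v : Rep P) (i : ℕ) (x : Item P) : Prop :=
  ∃ w d, ∃ j : Fin (2 * P.k), V w = some d ∧ d.last = topEpoch V ∧ i = d.ck v + j + 1 ∧
    d.comm v j = some x

/-- The new pre-prepare for local number `i` of leader `v` of the previous epoch: none if there is a
commit-certificate, the prepared request if there is a prepared-certificate, the null request for a
gap below a certified number. -/
def reItem (V : Rep P → Option (ECData P)) (v : Rep P) (i : ℕ) : Option (Item P) :=
  if ∃ x, CommIn V v i x then none
  else if h : ∃ x, PrepIn V v i x then some h.choose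
  else if ∃ i' x, i < i' ∧ (PrepIn V v i' x ∨ CommIn V v i' x) then
    some ((topEpoch V, v, i), none)
  else none

/-- All hanging items. -/
def openItems (V : Rep P → Option (ECData P)) : List (Item P) :=
  (List.finRange P.n).flatMap fun v =>
    (List.range (2 * P.k)).filterMap fun j => reItem V v (sMin V v + j + 1)

/-- The leader responsible in epoch `e` for a hanging item. -/
def System.leaderOf (e : ℕ) (x : Item P) : Rep P :=
  match x.2 with
  | some r => S.owner e r
  | none => x.1.2.1

/-- The hanging items assigned to leader `v` in epoch `e`; they get the first local numbers. -/
def System.hungOf (e : ℕ) (V : Rep P → Option (ECData P)) (v : Rep P) : List (Item P) :=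
  (openItems V).filter fun x => S.leaderOf e x = v

/-! ## Local state of a correct replica -/

structure LState (P : Params) where
  /-- messages received so far, with their senders -/
  inbox : Finset (Rep P × Msg P)
  /-- messages whose authenticators have been verified and which have been processed -/
  acc : Finset (Rep P × Msg P)
  /-- messages sent so far -/
  sent : Finset (Msg P)
  /-- the last epoch entered -/
  cur : ℕ
  /-- the epoch that the replica is in (`ep = cur`) or changing to (`ep > cur`) -/
  ep : ℕ
  /-- the hanging items assigned to each leader in epoch `cur` -/
  hung : Rep P → List (Item P)
  /-- the time of entering epoch `cur` -/
  entered : ℕ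
  /-- the time at which the no-progress timer of each leader was last set -/
  prog : Rep P → ℕ
  /-- the time at which the epoch-change timer was started, if it is running -/
  ecTimer : Option ℕ
  /-- the number of consecutive unsuccessful epoch-changes -/
  fails : ℕ

/-- Initially every replica is in epoch `1`. -/
def LState.initial (P : Params) : LState P where
  inbox := ∅
  acc := ∅
  sent := ∅
  cur := 1
  ep := 1
  hung := fun _ => []
  entered := 0
  prog := fun _ => 5 * P.Δ
  ecTimer := none
  fails := 0

section Rules

variable (u : Rep P) (s : LState P)

/-- Replica `u` holds message `m` of `w`: it has processed it, or sent it itself. -/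
def Has (w : Rep P) (m : Msg P) : Prop := (w, m) ∈ s.acc ∨ (w = u ∧ m ∈ s.sent)

/-- Replica `u` holds message `m` of at least `q` replicas. -/
def HasFrom (q : ℕ) (m : Msg P) : Prop := q ≤ (Finset.univ.filter fun w => Has u s w m).card

/-- The number of local numbers of leader `v` in epoch `cur`. -/
def slots (v : Rep P) : ℕ := max (S.load s.cur v) (s.hung v).length

/-- The low watermark of leader `v`: its last stable checkpoint in epoch `cur`. -/
def low (v : Rep P) : ℕ :=
  Nat.findGreatest (fun i => Has u s v (.ckptCert s.cur v i)) (slots S s v)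

/-- The local number `i` of leader `v` lies between the watermarks. -/
def InWindow (v : Rep P) (i : ℕ) : Prop :=
  low S u s v < i ∧ i ≤ low S u s v + 2 * P.k ∧ i ≤ slots S s v

/-- The local number `i` of leader `v` is committed at `u`: by a commit-certificate, or below a
stable checkpoint. -/
def Done (v : Rep P) (i : ℕ) : Prop :=
  i ≤ low S u s v ∨ ∃ x, Has u s v (.committed s.cur v i x)

/-- `x` may be proposed by leader `v` itself for its local number `i`. -/
def FreshItem (v : Rep P) (i : ℕ) (x : Item P) : Prop :=
  (s.hung v).length < i ∧ i ≤ S.load s.cur v ∧ x.1 = (s.cur, v, i) ∧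
    ∃ r, x.2 = some r ∧ S.owner s.cur r = v

/-- `x` has been proposed for local number `i` of leader `v`: by the new-epoch message if it is a
hanging item, by a pre-prepare message of `v` otherwise. -/
def Proposed (v : Rep P) (i : ℕ) (x : Item P) : Prop :=
  (1 ≤ i ∧ (s.hung v)[i - 1]? = some x) ∨
    (FreshItem S s v i x ∧ Has u s v (.prePrepare s.cur v i x))

/-- The reliable broadcast of the current epoch-change has delivered `J` at `u`. -/
def RBDelivered (J : Finset (Rep P)) : Prop :=
  .rbReady s.ep J ∈ s.sent ∧ HasFrom u s (2 * P.f + 1) (.rbReady s.ep J)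

/-- The messages of another replica `w` that `u` verifies and processes in its present state. -/
def Relevant (w : Rep P) (m : Msg P) : Prop :=
  w ≠ u ∧
  match m with
  | .prePrepare e v i x => s.ep = s.cur ∧ e = s.cur ∧ w = v ∧ InWindow S u s v i ∧ FreshItem S s v i x
  | .prepare e v i x =>
      s.ep = s.cur ∧ e = s.cur ∧ u = v ∧ .prepare e v i x ∈ s.sent ∧ .prepared e v i x ∉ s.sent
  | .prepared e v i _ => s.ep = s.cur ∧ e = s.cur ∧ w = v ∧ InWindow S u s v i
  | .commit e v i x =>
      s.ep = s.cur ∧ e = s.cur ∧ u = v ∧ .commit e v i x ∈ s.sent ∧ .committed e v i x ∉ s.sent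
  | .committed e v i _ =>
      s.ep = s.cur ∧ e = s.cur ∧ w = v ∧ 1 ≤ i ∧ i ≤ low S u s v + 2 * P.k ∧ i ≤ slots S s v
  | .checkpoint e v i =>
      s.ep = s.cur ∧ e = s.cur ∧ u = v ∧ .checkpoint e v i ∈ s.sent ∧ .ckptCert e v i ∉ s.sent
  | .ckptCert e v i =>
      s.ep = s.cur ∧ e = s.cur ∧ w = v ∧ low S u s v < i ∧ i ≤ slots S s v ∧ P.k ∣ i
  | .epochChange e d => d.last < e ∧ (s.ep < e ∨ (e = s.ep ∧ s.cur ≠ s.ep))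
  | .rbInit e J => s.cur ≠ s.ep ∧ e = s.ep ∧ w = S.prim e ∧ 2 * P.f + 1 ≤ J.card
  | .rbEcho e _ => s.cur ≠ s.ep ∧ e = s.ep
  | .rbReady e _ => s.cur ≠ s.ep ∧ e = s.ep
  | .newEpoch e V => s.cur ≠ s.ep ∧ e = s.ep ∧ w = S.prim e ∧
      (∀ w' d, V w' = some d → d.last < e) ∧
      ∃ J, 2 * P.f + 1 ≤ J.card ∧ RBDelivered u s J ∧ ∀ w', w' ∈ J ↔ V w' ≠ none

/-- Two messages compete for the same place: of all messages competing with `a`, at most `cap a` are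
ever processed, the excess is ignored. -/
def Competes (a b : Rep P × Msg P) : Prop :=
  match a.2, b.2 with
  | .prePrepare e v i _, .prePrepare e' v' i' _ => e = e' ∧ v = v' ∧ i = i'
  | .prepare e v i _, .prepare e' v' i' _ => e = e' ∧ v = v' ∧ i = i'
  | .prepared e v i _, .prepared e' v' i' _ => e = e' ∧ v = v' ∧ i = i'
  | .commit e v i _, .commit e' v' i' _ => e = e' ∧ v = v' ∧ i = i'
  | .committed e v i _, .committed e' v' i' _ => e = e' ∧ v = v' ∧ i = i'
  | .checkpoint e v i, .checkpoint e' v' i' => e = e' ∧ v = v' ∧ i = i'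
  | .ckptCert e v i, .ckptCert e' v' i' => e = e' ∧ v = v' ∧ i = i'
  | .epochChange e _, .epochChange e' _ => a.1 = b.1 ∧ (e = e' ∨ (s.ep < e ∧ s.ep < e'))
  | .rbInit e _, .rbInit e' _ => e = e'
  | .rbEcho e _, .rbEcho e' _ => a.1 = b.1 ∧ e = e'
  | .rbReady e _, .rbReady e' _ => a.1 = b.1 ∧ e = e'
  | .newEpoch e _, .newEpoch e' _ => e = e'
  | _, _ => False

/-- A leader verifies `2f` partial signatures for each certificate. -/
def cap (m : Msg P) : ℕ :=
  match m with
  | .prepare .. => 2 * P.f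
  | .commit .. => 2 * P.f
  | .checkpoint .. => 2 * P.f
  | _ => 1

/-- `A` is a set of received messages that `u` processes next: relevant messages within the limits
given by `cap`, and as many of them as these limits admit. -/
def Accepts (A : Finset (Rep P × Msg P)) : Prop :=
  (∀ a ∈ A, a ∈ s.inbox ∧ a ∉ s.acc ∧ Relevant S u s a.1 a.2) ∧
  (∀ a ∈ A, ((s.acc ∪ A).filter (Competes s a)).card ≤ cap a.2) ∧
  (∀ a ∈ s.inbox, a ∉ s.acc ∪ A → Relevant S u s a.1 a.2 →
    cap a.2 ≤ ((s.acc ∪ A).filter (Competes s a)).card)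

/-- The messages that `u` has to send in its present state (each of them once); epoch-change and
new-epoch messages are sent on a change of the epoch, see below. -/
def Enabled (m : Msg P) : Prop :=
  match m with
  | .prePrepare e v i x => s.ep = s.cur ∧ e = s.cur ∧ u = v ∧ InWindow S u s v i ∧
      (s.hung v).length < i ∧ i ≤ S.load e v ∧ x = ((e, v, i), some (S.pend e v i))
  | .prepare e v i x => s.ep = s.cur ∧ e = s.cur ∧ InWindow S u s v i ∧ Proposed S u s v i x ∧
      ∀ x', .prepare e v i x' ∉ s.sent
  | .prepared e v i x => s.ep = s.cur ∧ e = s.cur ∧ u = v ∧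
      HasFrom u s (2 * P.f + 1) (.prepare e v i x)
  | .commit e v i x => s.ep = s.cur ∧ e = s.cur ∧ Has u s v (.prepared e v i x) ∧
      ∀ x', .commit e v i x' ∉ s.sent
  | .committed e v i x => s.ep = s.cur ∧ e = s.cur ∧ u = v ∧
      HasFrom u s (2 * P.f + 1) (.commit e v i x)
  | .checkpoint e v i => s.ep = s.cur ∧ e = s.cur ∧ 1 ≤ i ∧ i ≤ slots S s v ∧ P.k ∣ i ∧
      ∀ j, 1 ≤ j → j ≤ i → Done S u s v j
  | .ckptCert e v i => s.ep = s.cur ∧ e = s.cur ∧ u = v ∧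
      HasFrom u s (2 * P.f + 1) (.checkpoint e v i)
  | .epochChange _ _ => False
  | .rbInit e J => s.cur ≠ s.ep ∧ e = s.ep ∧ u = S.prim e ∧
      J = (Finset.univ.filter fun w => ∃ d, Has u s w (.epochChange e d)) ∧
      2 * P.f + 1 ≤ J.card ∧ ∀ J', .rbInit e J' ∉ s.sent
  | .rbEcho e J => s.cur ≠ s.ep ∧ e = s.ep ∧ Has u s (S.prim e) (.rbInit e J) ∧
      ∀ J', .rbEcho e J' ∉ s.sent
  | .rbReady e J => s.cur ≠ s.ep ∧ e = s.ep ∧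
      (HasFrom u s (2 * P.f + 1) (.rbEcho e J) ∨ HasFrom u s (P.f + 1) (.rbReady e J)) ∧
      ∀ J', .rbReady e J' ∉ s.sent
  | .newEpoch _ _ => False

/-! ### Entering and leaving epochs -/

/-- `u` enters the epoch `ep` on the basis of the epoch-change messages `V`: as the primary, when it
has completed the reliable broadcast, otherwise on accepting the new-epoch message. -/
def Enters (V : Rep P → Option (ECData P)) : Prop :=
  s.cur ≠ s.ep ∧
  ((u ≠ S.prim s.ep ∧ (S.prim s.ep, .newEpoch s.ep V) ∈ s.acc) ∨
   (u = S.prim s.ep ∧ ∃ J, .rbInit s.ep J ∈ s.sent ∧ RBDelivered u s J ∧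
      (∀ w, w ∈ J ↔ V w ≠ none) ∧
      ∀ w d, V w = some d → Has u s w (.epochChange s.ep d)))

/-- At time `t`, `u` calls for the next epoch on its own account: in an epoch, if all requests are
committed, or the epoch timer has expired, or the no-progress timers of `2f+1` leaders have; in an
epoch-change, if the epoch-change timer has expired, whose value is doubled with every unsuccessful
epoch-change after `f` of them. -/
def Calls (t : ℕ) : Prop :=
  (s.cur = s.ep ∧
    ((∀ v i, 1 ≤ i → i ≤ slots S s v → Done S u s v i) ∨
     s.entered + P.T ≤ t ∨
     2 * P.f + 1 ≤ (Finset.univ.filter fun v => s.prog v + P.Tp ≤ t).card)) ∨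
  (s.cur ≠ s.ep ∧ ∃ τ, s.ecTimer = some τ ∧ τ + P.Te * 2 ^ (s.fails + 1 - P.f) ≤ t)

/-- `w` is known to `u` to have called for the epoch `e`. -/
def Called (w : Rep P) (e : ℕ) : Prop := w ≠ u ∧ ∃ d, (w, Msg.epochChange e d) ∈ s.acc

/-- At time `t`, `u` calls an epoch-change to epoch `e'`: on its own account, or because `f+1` others
have called for epochs higher than `ep`, of which it then picks the smallest. -/
def ChangesTo (t : ℕ) (e' : ℕ) : Prop :=
  (Calls S u s t ∧ e' = s.ep + 1) ∨
  (¬ Calls S u s t ∧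
    P.f + 1 ≤ (Finset.univ.filter fun w => ∃ e, s.ep < e ∧ Called u s w e).card ∧
    IsLeast {e | s.ep < e ∧ ∃ w, Called u s w e} e')

/-- The content of an epoch-change message of `u`. A hanging item comes with the
prepared-certificate it had in the new-epoch message. -/
def ecData : ECData P where
  last := s.cur
  ck := low S u s
  prep := fun v j =>
    if h : (¬ ∃ x, Has u s v (.committed s.cur v (low S u s v + j + 1) x)) ∧
        ∃ x, Has u s v (.prepared s.cur v (low S u s v + j + 1) x) ∨
          ((s.hung v)[low S u s v + j]? = some x ∧ x.2 ≠ none)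
    then some h.2.choose else none
  comm := fun v j =>
    if h : ∃ x, Has u s v (.committed s.cur v (low S u s v + j + 1) x)
    then some h.choose else none

/-- The actions of `u` at time `t`, in the state `s` in which it has just processed the messages `A`:
the set of messages it sends to all replicas, and its next state. -/
inductive Acts (t : ℕ) (A : Finset (Rep P × Msg P)) : Finset (Msg P) → LState P → Prop
  | enter (V : Rep P → Option (ECData P)) (out : Finset (Msg P)) (h : Enters S u s V)
      (hout : out = if u = S.prim s.ep then {.newEpoch s.ep V} else ∅) :
      Acts t A out
        { s with
          sent := s.sent ∪ out
          cur := s.ep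
          hung := S.hungOf s.ep V
          entered := t
          prog := fun _ => t + 5 * P.Δ
          ecTimer := none
          fails := 0 }
  | change (e' : ℕ) (out : Finset (Msg P)) (h : ∀ V, ¬ Enters S u s V) (h' : ChangesTo S u s t e')
      (hout : out = {.epochChange e' (ecData S u s)}) :
      Acts t A out
        { s with
          sent := s.sent ∪ out
          ep := e'
          ecTimer := none
          fails := if s.cur = s.ep then 0 else s.fails + 1 }
  | stay (out : Finset (Msg P)) (h : ∀ V, ¬ Enters S u s V) (h' : ∀ e', ¬ ChangesTo S u s t e')
      (hout : ∀ m, m ∈ out ↔ m ∉ s.sent ∧ Enabled S u s m) :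
      Acts t A out
        { s with
          sent := s.sent ∪ out
          prog := fun v =>
            if ∃ i x, (v, Msg.committed s.cur v i x) ∈ A ∨
                (u = v ∧ Msg.committed s.cur v i x ∈ out)
            then max (s.prog v) t else s.prog v
          ecTimer :=
            if s.ecTimer = none ∧ s.cur ≠ s.ep ∧
                2 * P.f ≤ (Finset.univ.filter fun w => ∃ e, s.ep ≤ e ∧ Called u s w e).card
            then some t else s.ecTimer }

end Rules

/-! ## Executions -/

/-- The partial signature in message `m` is available from `2f+1` replicas before time `t`, so that a
combined signature exists: every one of them is byzantine, or has sent `m`. -/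
def Combinable (out : Rep P → ℕ → Finset (Msg P)) (t : ℕ) (m : Msg P) : Prop :=
  2 * P.f + 1 ≤
    (Finset.univ.filter fun w => w ∈ S.byz ∨ ∃ t' < t, m ∈ out w t').card

/-- The certificates in the content of an epoch-change message exist at time `t`. -/
def ECValid (out : Rep P → ℕ → Finset (Msg P)) (t : ℕ) (d : ECData P) : Prop :=
  (d.last = 1 ∨ ∃ J, Combinable S out t (.rbReady d.last J)) ∧
  (∀ v, d.ck v = 0 ∨ Combinable S out t (.checkpoint d.last v (d.ck v))) ∧
  (∀ v j x, d.prep v j = some x → ∃ e v' i, Combinable S out t (.prepare e v' i x)) ∧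
  (∀ v j x, d.comm v j = some x → Combinable S out t (.commit d.last v (d.ck v + j + 1) x))

/-- Unforgeability: what a byzantine replica can send (invalid messages are filtered out). -/
def Unforged (out : Rep P → ℕ → Finset (Msg P)) (t : ℕ) (m : Msg P) : Prop :=
  match m with
  | .prepared e v i x => Combinable S out t (.prepare e v i x)
  | .committed e v i x => Combinable S out t (.commit e v i x)
  | .ckptCert e v i => Combinable S out t (.checkpoint e v i)
  | .epochChange _ d => ECValid S out t d
  | .newEpoch e V => ∀ w d, V w = some d →
      (w ∉ S.byz → ∃ t' < t, Msg.epochChange e d ∈ out w t') ∧ (w ∈ S.byz → ECValid S out t d)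
  | _ => True

/-- An execution with at most `f` byzantine replicas in a partially synchronous network. At every
time `t` each correct replica receives the messages `deliv u t`, processes `proc u t`, sends `out u t`
to all replicas. -/
structure Execution (S : System P) where
  /-- the global stabilization time -/
  gst : ℕ
  deliv : Rep P → ℕ → Finset (Rep P × Msg P)
  proc : Rep P → ℕ → Finset (Rep P × Msg P)
  out : Rep P → ℕ → Finset (Msg P)
  /-- the state of a correct replica at the beginning of time step `t` -/
  st : Rep P → ℕ → LState P
  st_zero : ∀ u, u ∉ S.byz → st u 0 = LState.initial P
  accepts : ∀ u, u ∉ S.byz → ∀ t,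
    Accepts S u { st u t with inbox := (st u t).inbox ∪ deliv u t } (proc u t)
  acts : ∀ u, u ∉ S.byz → ∀ t,
    Acts S u
      { st u t with
        inbox := (st u t).inbox ∪ deliv u t
        acc := (st u t).acc ∪ proc u t }
      t (proc u t) (out u t) (st u (t + 1))
  /-- messages of correct replicas are authentic -/
  deliv_correct : ∀ u, u ∉ S.byz → ∀ w, w ∉ S.byz → ∀ t m, (w, m) ∈ deliv u t →
    ∃ t' < t, m ∈ out w t'
  /-- messages between correct replicas arrive eventually, and within `Δ` after GST -/
  deliv_timely : ∀ u, u ∉ S.byz → ∀ w, w ∉ S.byz → w ≠ u → ∀ t, ∀ m ∈ out w t,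
    ∃ t', t < t' ∧ t' ≤ max t gst + P.Δ ∧ (w, m) ∈ deliv u t'
  /-- byzantine replicas send arbitrary messages, but cannot forge signatures -/
  deliv_byz : ∀ u, u ∉ S.byz → ∀ w ∈ S.byz, ∀ t m, (w, m) ∈ deliv u t → Unforged S out t m

/-! ## Authenticator complexity -/

/-- The number of authenticators in an epoch-change message: one for the checkpoint-certificate of
each leader, one for each prepared- and commit-certificate, and the signature. -/
def ECData.auths (d : ECData P) : ℕ :=
  1 + P.n + ∑ v, ((Finset.univ.filter fun j => d.prep v j ≠ none).card +
    (Finset.univ.filter fun j => d.comm v j ≠ none).card)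

/-- The number of authenticators that `u` verifies on processing `m`. A new-epoch message contains
the signature of the primary, its signed pre-prepare messages for the hanging requests, and the
epoch-change messages, of which only those not in `acc` still have to be verified. -/
def verifyCost (u : Rep P) (acc : Finset (Rep P × Msg P)) (m : Msg P) : ℕ :=
  match m with
  | .epochChange _ d => d.auths
  | .newEpoch e V => 1 + (openItems V).length +
      ∑ w, (if w ≠ u then
        ((V w).map fun d => if (w, Msg.epochChange e d) ∈ acc then 0 else d.auths).getD 0 else 0)
  | _ => 1

/-- The number of authenticators computed for sending `m`. -/
def computeCost (m : Msg P) : ℕ :=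
  match m with
  | .newEpoch _ V => 1 + (openItems V).length
  | _ => 1

namespace Execution

variable {S} (X : Execution S)

/-- The number of authenticators computed or verified by correct replicas during the time
`t₀ ≤ t < t₁` for messages satisfying `φ`. -/
def cost (φ : Msg P → Prop) (t₀ t₁ : ℕ) : ℕ :=
  ∑ t ∈ Finset.Ico t₀ t₁, ∑ u ∈ Finset.univ.filter (fun u => u ∉ S.byz),
    (∑ a ∈ (X.proc u t).filter (fun a => φ a.2), verifyCost u ((X.st u t).acc ∪ X.proc u t) a.2 +
     ∑ m ∈ (X.out u t).filter φ, computeCost m)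

/-- Some correct replica holds a commit-certificate for `x` at local number `i` of leader `v` in epoch
`e` at time `t`. -/
def CommittedAt (e : ℕ) (v : Rep P) (i : ℕ) (x : Item P) (t : ℕ) : Prop :=
  ∃ u, u ∉ S.byz ∧ Has u (X.st u t) v (.committed e v i x)

/-- The client requests, by their sequence numbers, committed by a correct replica until time `t`:
with a commit-certificate from the leader or from a new-epoch message. -/
def committed (t : ℕ) : Set (SeqNo P) :=
  {sn | ∃ r : ℕ, (∃ e v i, X.CommittedAt e v i (sn, some r) t) ∨
    ∃ u, u ∉ S.byz ∧ ∃ e V, Has u (X.st u t) (S.prim e) (.newEpoch e V) ∧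
      ∃ w d v j, V w = some d ∧ d.comm v j = some (sn, some r)}

/-- The client requests that are both first proposed and committed in epoch `e`, until time `t`. -/
def committedIn (e t : ℕ) : Set (SeqNo P) :=
  {sn | sn.1 = e ∧ ∃ v i, ∃ r : ℕ, X.CommittedAt e v i (sn, some r) t}

/-- The replica `u` has entered epoch `e` by time `t`. -/
def EntersBy (u : Rep P) (e t : ℕ) : Prop := ∃ t' ≤ t, (X.st u t').cur = e

end Execution

/-- The messages for committing the request at local number `i` of leader `v` in epoch `e`. -/
def ForRequest (e : ℕ) (v : Rep P) (i : ℕ) (m : Msg P) : Prop :=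
  ∃ x, m = .prePrepare e v i x ∨ m = .prepare e v i x ∨ m = .prepared e v i x ∨
    m = .commit e v i x ∨ m = .committed e v i x

/-- The messages of the epoch-change to epoch `e`. -/
def ForEpochChange (e : ℕ) (m : Msg P) : Prop :=
  (∃ d, m = .epochChange e d) ∨ (∃ J, m = .rbInit e J ∨ m = .rbEcho e J ∨ m = .rbReady e J) ∨
    ∃ V, m = .newEpoch e V

end FnF

end

namespace FnF

variable {P : Params} {S : System P}

/-! ## Quorums -/

/-! Counting bounds that hold at all times are combined with a liveness analysis after GST.

Upper bounds: a correct replica processes a capped number of competing messages and sends one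
message per place. A local number therefore costs O(1) at a follower and O(f) at its leader
(`cost_forRequest_le`). In an epoch-change each replica checks at most n epoch-change messages with
O(kn) authenticators, once directly and once inside the new-epoch message
(`cost_forEpochChange_le`). Lower bounds: a commit-certificate contains f+1 partial signatures of
correct replicas, and an epoch-change, completed or not, makes every correct replica verify 2f
epoch-change messages of others with more than n authenticators each (`le_cost_forEpochChange`).

Synchronization: `last e` is the last moment at which no correct replica has left epoch e. Some
correct replica then leaves on its own account. Either everything is committed, and all correct
replicas are in e, or a timer has expired, and f+1 correct replicas had reached e a full timeout
before. After GST a straggler thus gains two epochs while the front gains one, and the lag vanishes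
(`eventually_sync`).

Throughput: in a synchronized epoch with a correct primary the reliable broadcast ends within O(Δ),
and all correct replicas enter with the same hanging items. A correct leader then commits a further
number every `7 * Δ + 10` steps (`Settled.commit_next`). Whatever ends the epoch, f+1 correct
leaders have committed `Cmin` numbers: all is done, or the epoch timer was long enough, or 2f+1
no-progress timers have expired, f+1 of them for correct leaders that have nothing left to do
(`SyncAt.exists_committed`). Hanging items take at most 2kn numbers of a leader, so about cn³/6 new
requests are committed.

Amortization: any n consecutive late epochs contain one with a correct primary
(`IsRotation.exists_notMem`). A block of n epochs thus yields Ω(n³) requests, while its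
epoch-changes cost O(n⁴), which is O(n) per request. The remaining cost is O(n) per local number in
use, and these numbers exceed the committed requests by O(kn²) per epoch (`cost_le`). The
contribution before GST is a constant that is eventually outweighed (`amortized`). -/

theorem correct_card_of_quorum (S : System P) (Q : Rep P → Prop) [DecidablePred Q] {q : ℕ}
    (h : P.f + q ≤ (Finset.univ.filter Q).card) :
    q ≤ (Finset.univ.filter fun w => w ∉ S.byz ∧ Q w).card := by
  have h1 : (Finset.univ.filter Q).card ≤
      (Finset.univ.filter fun w => w ∉ S.byz ∧ Q w).card + S.byz.card := by
    refine le_trans (Finset.card_le_card ?_) (Finset.card_union_le _ _)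
    intro w hw
    simp only [Finset.mem_filter, Finset.mem_univ, true_and, Finset.mem_union] at hw ⊢
    tauto
  have := S.byz_card
  omega

theorem exists_correct_of_quorum (S : System P) (Q : Rep P → Prop) [DecidablePred Q]
    (h : P.f + 1 ≤ (Finset.univ.filter Q).card) : ∃ w, w ∉ S.byz ∧ Q w := by
  have := correct_card_of_quorum S Q h
  obtain ⟨w, hw⟩ := Finset.card_pos.1 this
  exact ⟨w, by simpa using hw⟩

theorem correct_card (S : System P) :
    2 * P.f + 1 ≤ (Finset.univ.filter fun w => w ∉ S.byz).card := by
  have h := correct_card_of_quorum S (fun _ => True) (q := 2 * P.f + 1)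
    (by simp only [Finset.filter_true, Finset.card_univ, Fintype.card_fin]; show _ ≤ 3 * P.f + 1; omega)
  simpa using h

theorem quorum_of_correct (S : System P) (Q : Rep P → Prop) [DecidablePred Q] (h : ∀ w, w ∉ S.byz → Q w) :
    2 * P.f + 1 ≤ (Finset.univ.filter Q).card := by
  refine (correct_card S).trans (Finset.card_le_card fun w hw => ?_)
  simp only [Finset.mem_filter, Finset.mem_univ, true_and] at hw ⊢
  exact h w hw

/-- Two sets of 2f+1 among 3f+1 replicas share f+1, one of which is correct. -/
theorem quorum_inter (S : System P) (Q Q' : Rep P → Prop) [DecidablePred Q] [DecidablePred Q']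
    (h : 2 * P.f + 1 ≤ (Finset.univ.filter Q).card)
    (h' : 2 * P.f + 1 ≤ (Finset.univ.filter Q').card) : ∃ w, w ∉ S.byz ∧ Q w ∧ Q' w := by
  apply exists_correct_of_quorum S (fun w => Q w ∧ Q' w)
  have h1 := Finset.card_union_add_card_inter (Finset.univ.filter Q) (Finset.univ.filter Q')
  have h2 : (Finset.univ.filter Q ∪ Finset.univ.filter Q').card ≤ P.n := by
    simpa using Finset.card_le_univ (Finset.univ.filter Q ∪ Finset.univ.filter Q')
  have h3 : Finset.univ.filter Q ∩ Finset.univ.filter Q' =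
      Finset.univ.filter fun w => Q w ∧ Q' w := by ext; simp
  rw [h3] at h1
  have : P.n = 3 * P.f + 1 := rfl
  omega

theorem exists_ne_of_two_le_card {Q : Rep P → Prop} [DecidablePred Q] (u : Rep P)
    (h : 2 ≤ (Finset.univ.filter Q).card) : ∃ w, w ≠ u ∧ Q w := by
  obtain ⟨w, hw, hne⟩ := Finset.exists_mem_ne (s := Finset.univ.filter Q) (by omega) u
  exact ⟨w, hne, by simpa using hw⟩

/-! ## One step of a correct replica -/

/-- A message of an epoch-change that is sent on a change of the epoch. -/
def IsEpochMsg (m : Msg P) : Prop := (∃ e d, m = .epochChange e d) ∨ ∃ e V, m = .newEpoch e V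

theorem Acts.cases {u : Rep P} {s : LState P} {t A out s'} (h : Acts S u s t A out s') :
    (∃ V, Enters S u s V ∧ out = (if u = S.prim s.ep then {.newEpoch s.ep V} else ∅) ∧
      s' = { s with
          sent := s.sent ∪ out
          cur := s.ep
          hung := S.hungOf s.ep V
          entered := t
          prog := fun _ => t + 5 * P.Δ
          ecTimer := none
          fails := 0 }) ∨
    (∃ e', (∀ V, ¬ Enters S u s V) ∧ ChangesTo S u s t e' ∧
      out = {.epochChange e' (ecData S u s)} ∧
      s' = { s with
          sent := s.sent ∪ out
          ep := e'
          ecTimer := none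
          fails := if s.cur = s.ep then 0 else s.fails + 1 }) ∨
    ((∀ V, ¬ Enters S u s V) ∧ (∀ e', ¬ ChangesTo S u s t e') ∧
      (∀ m, m ∈ out ↔ m ∉ s.sent ∧ Enabled S u s m) ∧
      s' = { s with
          sent := s.sent ∪ out
          prog := fun v =>
            if ∃ i x, (v, Msg.committed s.cur v i x) ∈ A ∨
                (u = v ∧ Msg.committed s.cur v i x ∈ out)
            then max (s.prog v) t else s.prog v
          ecTimer :=
            if s.ecTimer = none ∧ s.cur ≠ s.ep ∧
                2 * P.f ≤ (Finset.univ.filter fun w => ∃ e, s.ep ≤ e ∧ Called u s w e).card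
            then some t else s.ecTimer }) := by
  cases h with
  | enter V _ h hout => exact Or.inl ⟨V, h, hout, rfl⟩
  | change e' _ h h' hout => exact Or.inr (Or.inl ⟨e', h, h', hout, rfl⟩)
  | stay _ h h' hout => exact Or.inr (Or.inr ⟨h, h', hout, rfl⟩)

namespace Execution

variable (X : Execution S) {u v w : Rep P} {t t' : ℕ}

/-- The state of `u` at time `t` in which it acts: after having processed the new messages. -/
noncomputable def pre (u : Rep P) (t : ℕ) : LState P :=
  { X.st u t with
    inbox := (X.st u t).inbox ∪ X.deliv u t
    acc := (X.st u t).acc ∪ X.proc u t }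

theorem acts_pre (hu : u ∉ S.byz) (t : ℕ) :
    Acts S u (X.pre u t) t (X.proc u t) (X.out u t) (X.st u (t + 1)) := X.acts u hu t

@[simp] theorem pre_cur : (X.pre u t).cur = (X.st u t).cur := rfl
@[simp] theorem pre_ep : (X.pre u t).ep = (X.st u t).ep := rfl
@[simp] theorem pre_hung : (X.pre u t).hung = (X.st u t).hung := rfl
@[simp] theorem pre_entered : (X.pre u t).entered = (X.st u t).entered := rfl
@[simp] theorem pre_ecTimer : (X.pre u t).ecTimer = (X.st u t).ecTimer := rfl
@[simp] theorem pre_fails : (X.pre u t).fails = (X.st u t).fails := rfl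
theorem pre_acc : (X.pre u t).acc = (X.st u t).acc ∪ X.proc u t := rfl

theorem acc_succ (hu : u ∉ S.byz) (t : ℕ) :
    (X.st u (t + 1)).acc = (X.st u t).acc ∪ X.proc u t := by
  rcases (X.acts_pre hu t).cases with ⟨V, _, _, h⟩ | ⟨e', _, _, _, h⟩ | ⟨_, _, _, h⟩ <;>
    rw [h] <;> rfl

theorem sent_succ (hu : u ∉ S.byz) (t : ℕ) :
    (X.st u (t + 1)).sent = (X.st u t).sent ∪ X.out u t := by
  rcases (X.acts_pre hu t).cases with ⟨V, _, _, h⟩ | ⟨e', _, _, _, h⟩ | ⟨_, _, _, h⟩ <;>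
    rw [h] <;> rfl

theorem inbox_succ (hu : u ∉ S.byz) (t : ℕ) :
    (X.st u (t + 1)).inbox = (X.st u t).inbox ∪ X.deliv u t := by
  rcases (X.acts_pre hu t).cases with ⟨V, _, _, h⟩ | ⟨e', _, _, _, h⟩ | ⟨_, _, _, h⟩ <;>
    rw [h] <;> rfl

theorem mem_acc (hu : u ∉ S.byz) {a} :
    a ∈ (X.st u t).acc ↔ ∃ t' < t, a ∈ X.proc u t' := by
  induction t with
  | zero => simp [X.st_zero u hu, LState.initial]
  | succ t ih =>
    rw [X.acc_succ hu, Finset.mem_union, ih]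
    constructor
    · rintro (⟨t', h, h'⟩ | h)
      · exact ⟨t', by omega, h'⟩
      · exact ⟨t, by omega, h⟩
    · rintro ⟨t', h, h'⟩
      rcases Nat.lt_succ_iff_lt_or_eq.1 h with h | rfl
      · exact Or.inl ⟨t', h, h'⟩
      · exact Or.inr h'

theorem mem_sent (hu : u ∉ S.byz) {m} :
    m ∈ (X.st u t).sent ↔ ∃ t' < t, m ∈ X.out u t' := by
  induction t with
  | zero => simp [X.st_zero u hu, LState.initial]
  | succ t ih =>
    rw [X.sent_succ hu, Finset.mem_union, ih]
    constructor
    · rintro (⟨t', h, h'⟩ | h)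
      · exact ⟨t', by omega, h'⟩
      · exact ⟨t, by omega, h⟩
    · rintro ⟨t', h, h'⟩
      rcases Nat.lt_succ_iff_lt_or_eq.1 h with h | rfl
      · exact Or.inl ⟨t', h, h'⟩
      · exact Or.inr h'

theorem mem_inbox (hu : u ∉ S.byz) {a} :
    a ∈ (X.st u t).inbox ↔ ∃ t' < t, a ∈ X.deliv u t' := by
  induction t with
  | zero => simp [X.st_zero u hu, LState.initial]
  | succ t ih =>
    rw [X.inbox_succ hu, Finset.mem_union, ih]
    constructor
    · rintro (⟨t', h, h'⟩ | h)
      · exact ⟨t', by omega, h'⟩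
      · exact ⟨t, by omega, h⟩
    · rintro ⟨t', h, h'⟩
      rcases Nat.lt_succ_iff_lt_or_eq.1 h with h | rfl
      · exact Or.inl ⟨t', h, h'⟩
      · exact Or.inr h'

theorem acc_mono (hu : u ∉ S.byz) (h : t ≤ t') : (X.st u t).acc ⊆ (X.st u t').acc := by
  intro a ha
  rw [X.mem_acc hu] at ha ⊢
  obtain ⟨s, hs, h'⟩ := ha
  exact ⟨s, by omega, h'⟩

theorem sent_mono (hu : u ∉ S.byz) (h : t ≤ t') : (X.st u t).sent ⊆ (X.st u t').sent := by
  intro a ha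
  rw [X.mem_sent hu] at ha ⊢
  obtain ⟨s, hs, h'⟩ := ha
  exact ⟨s, by omega, h'⟩

theorem acc_subset_pre : (X.st u t).acc ⊆ (X.pre u t).acc := Finset.subset_union_left

theorem pre_acc_eq (hu : u ∉ S.byz) : (X.pre u t).acc = (X.st u (t + 1)).acc :=
  (X.acc_succ hu t).symm

theorem has_mono (hu : u ∉ S.byz) (h : t ≤ t') {m} (hm : Has u (X.st u t) w m) :
    Has u (X.st u t') w m :=
  hm.imp (fun a => X.acc_mono hu h a) (fun a => ⟨a.1, X.sent_mono hu h a.2⟩)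

theorem has_pre {m} (hm : Has u (X.st u t) w m) : Has u (X.pre u t) w m :=
  hm.imp (fun a => X.acc_subset_pre a) id

theorem has_succ_of_pre (hu : u ∉ S.byz) {m} (hm : Has u (X.pre u t) w m) :
    Has u (X.st u (t + 1)) w m :=
  hm.imp (fun a => X.pre_acc_eq hu ▸ a) (fun a => ⟨a.1, X.sent_mono hu (Nat.le_succ t) a.2⟩)

theorem hasFrom_mono {s s' : LState P} {q : ℕ} {m : Msg P}
    (H : ∀ w, Has u s w m → Has u s' w m) (h : HasFrom u s q m) : HasFrom u s' q m := by
  refine le_trans h (Finset.card_le_card fun w hw => ?_)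
  simp only [Finset.mem_filter, Finset.mem_univ, true_and] at hw ⊢
  exact H w hw

theorem relevant_of_proc (hu : u ∉ S.byz) {a} (ha : a ∈ X.proc u t) :
    Relevant S u (X.st u t) a.1 a.2 := ((X.accepts u hu t).1 a ha).2.2

theorem not_mem_acc_of_proc (hu : u ∉ S.byz) {a} (ha : a ∈ X.proc u t) :
    a ∉ (X.st u t).acc := ((X.accepts u hu t).1 a ha).2.1

theorem relevant_of_acc (hu : u ∉ S.byz) {a} (ha : a ∈ (X.st u t).acc) :
    ∃ t' < t, a ∈ X.proc u t' ∧ Relevant S u (X.st u t') a.1 a.2 := by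
  obtain ⟨t', h, h'⟩ := (X.mem_acc hu).1 ha
  exact ⟨t', h, h', X.relevant_of_proc hu h'⟩

theorem relevant_of_pre_acc (hu : u ∉ S.byz) {a} (ha : a ∈ (X.pre u t).acc) :
    ∃ t' ≤ t, a ∈ X.proc u t' ∧ Relevant S u (X.st u t') a.1 a.2 := by
  rw [X.pre_acc_eq hu] at ha
  obtain ⟨t', h, h'⟩ := X.relevant_of_acc hu ha
  exact ⟨t', by omega, h'⟩

theorem deliv_of_proc (hu : u ∉ S.byz) {a} (ha : a ∈ X.proc u t) :
    ∃ t' ≤ t, a ∈ X.deliv u t' := by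
  have h : a ∈ (X.st u t).inbox ∪ X.deliv u t := ((X.accepts u hu t).1 a ha).1
  rw [← X.inbox_succ hu, X.mem_inbox hu] at h
  obtain ⟨t', h, h'⟩ := h
  exact ⟨t', by omega, h'⟩

theorem ne_of_pre_acc (hu : u ∉ S.byz) {a} (ha : a ∈ (X.pre u t).acc) : a.1 ≠ u := by
  obtain ⟨t', _, _, h⟩ := X.relevant_of_pre_acc hu ha
  exact h.1

theorem has_self_pre (hu : u ∉ S.byz) {m} : Has u (X.pre u t) u m ↔ m ∈ (X.st u t).sent :=
  ⟨fun h => h.elim (fun h => absurd rfl (X.ne_of_pre_acc hu h)) (fun h => h.2),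
    fun h => Or.inr ⟨rfl, h⟩⟩

theorem has_other {s : LState P} (hw : w ≠ u) {m} : Has u s w m ↔ (w, m) ∈ s.acc :=
  ⟨fun h => h.elim id (fun h => absurd h.1 hw), Or.inl⟩

/-- A message held by a correct replica is from a byzantine one or has been sent before. -/
theorem source_of_has_pre (hu : u ∉ S.byz) {m} (h : Has u (X.pre u t) w m) (hw : w ∉ S.byz) :
    m ∈ (X.st w t).sent := by
  rcases h with h | ⟨rfl, h⟩
  · obtain ⟨t', h1, h2, _⟩ := X.relevant_of_pre_acc hu h
    obtain ⟨t'', h3, h4⟩ := X.deliv_of_proc hu h2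
    obtain ⟨t₀, h5, h6⟩ := X.deliv_correct u hu w hw _ _ h4
    exact (X.mem_sent hw).2 ⟨t₀, by omega, h6⟩
  · exact h

theorem source_of_has (hu : u ∉ S.byz) {m} (h : Has u (X.st u t) w m) (hw : w ∉ S.byz) :
    m ∈ (X.st w t).sent := X.source_of_has_pre hu (X.has_pre h) hw

theorem combinable_iff {m} : Combinable S X.out t m ↔
    2 * P.f + 1 ≤ (Finset.univ.filter fun w => w ∈ S.byz ∨ m ∈ (X.st w t).sent).card := by
  unfold Combinable
  have : (Finset.univ.filter fun w => w ∈ S.byz ∨ ∃ t' < t, m ∈ X.out w t') =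
      (Finset.univ.filter fun w => w ∈ S.byz ∨ m ∈ (X.st w t).sent) := by
    ext w
    simp only [Finset.mem_filter, Finset.mem_univ, true_and]
    by_cases hw : w ∈ S.byz
    · simp [hw]
    · rw [X.mem_sent hw]
  rw [this]

theorem combinable_mono (h : t ≤ t') {m} (hm : Combinable S X.out t m) :
    Combinable S X.out t' m := by
  refine le_trans hm (Finset.card_le_card fun w hw => ?_)
  simp only [Finset.mem_filter, Finset.mem_univ, true_and] at hw ⊢
  rcases hw with hw | ⟨s, hs, hw⟩
  · exact Or.inl hw
  · exact Or.inr ⟨s, by omega, hw⟩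

theorem combinable_of_hasFrom (hu : u ∉ S.byz) {m}
    (h : HasFrom u (X.pre u t) (2 * P.f + 1) m) : Combinable S X.out t m := by
  rw [combinable_iff]
  refine le_trans h (Finset.card_le_card fun w hw => ?_)
  simp only [Finset.mem_filter, Finset.mem_univ, true_and] at hw ⊢
  by_cases hb : w ∈ S.byz
  · exact Or.inl hb
  · exact Or.inr (X.source_of_has_pre hu hw hb)

/-- At most f of the 2f+1 signatures are byzantine. Certificates held by correct replicas are traced
back to correct signers in this way. -/
theorem correct_card_of_combinable {m} (h : Combinable S X.out t m) :
    P.f + 1 ≤ (Finset.univ.filter fun w => w ∉ S.byz ∧ m ∈ (X.st w t).sent).card := by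
  rw [combinable_iff] at h
  have := correct_card_of_quorum S (fun w => w ∈ S.byz ∨ m ∈ (X.st w t).sent) (q := P.f + 1)
    (by omega)
  refine this.trans (Finset.card_le_card fun w hw => ?_)
  simp only [Finset.mem_filter, Finset.mem_univ, true_and] at hw ⊢
  tauto

theorem exists_correct_of_combinable {m} (h : Combinable S X.out t m) :
    ∃ w, w ∉ S.byz ∧ m ∈ (X.st w t).sent := by
  have := X.correct_card_of_combinable h
  obtain ⟨w, hw⟩ := Finset.card_pos.1 (lt_of_lt_of_le (Nat.succ_pos _) this)
  exact ⟨w, by simpa using hw⟩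

/-! ## Epochs -/

theorem ep_lt_of_changesTo {s : LState P} {e'} (h : ChangesTo S u s t e') : s.ep < e' := by
  rcases h with h | h
  · omega
  · exact h.2.2.1.1

theorem cur_pos_le (hu : u ∉ S.byz) (t : ℕ) :
    1 ≤ (X.st u t).cur ∧ (X.st u t).cur ≤ (X.st u t).ep := by
  induction t with
  | zero => simp [X.st_zero u hu, LState.initial]
  | succ t ih =>
    rcases (X.acts_pre hu t).cases with ⟨V, _, _, h⟩ | ⟨e', _, h', _, h⟩ | ⟨_, _, _, h⟩ <;> rw [h]
    · exact ⟨ih.1.trans ih.2, le_rfl⟩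
    · have := ep_lt_of_changesTo h'
      simp only [pre_cur, pre_ep] at this ⊢
      omega
    · exact ih

theorem ep_succ_le (hu : u ∉ S.byz) (t : ℕ) : (X.st u t).ep ≤ (X.st u (t + 1)).ep := by
  rcases (X.acts_pre hu t).cases with ⟨V, _, _, h⟩ | ⟨e', _, h', _, h⟩ | ⟨_, _, _, h⟩ <;> rw [h]
  · exact le_rfl
  · exact (ep_lt_of_changesTo h').le
  · exact le_rfl

theorem cur_succ_le (hu : u ∉ S.byz) (t : ℕ) : (X.st u t).cur ≤ (X.st u (t + 1)).cur := by
  rcases (X.acts_pre hu t).cases with ⟨V, _, _, h⟩ | ⟨e', _, h', _, h⟩ | ⟨_, _, _, h⟩ <;> rw [h]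
  · exact (X.cur_pos_le hu t).2
  · exact le_rfl
  · exact le_rfl

theorem ep_mono (hu : u ∉ S.byz) : Monotone fun t => (X.st u t).ep :=
  monotone_nat_of_le_succ (X.ep_succ_le hu)

theorem cur_mono (hu : u ∉ S.byz) : Monotone fun t => (X.st u t).cur :=
  monotone_nat_of_le_succ (X.cur_succ_le hu)

/-- At a fixed place of the protocol, `u` does nothing but send enabled messages unless it enters or
leaves an epoch. -/
theorem out_of_stay (hu : u ∉ S.byz) (hc : (X.st u (t + 1)).cur = (X.st u t).cur)
    (he : (X.st u (t + 1)).ep = (X.st u t).ep) :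
    (∀ V, ¬ Enters S u (X.pre u t) V) ∧ (∀ e', ¬ ChangesTo S u (X.pre u t) t e') ∧
      (∀ m, m ∈ X.out u t ↔ m ∉ (X.st u t).sent ∧ Enabled S u (X.pre u t) m) := by
  rcases (X.acts_pre hu t).cases with ⟨V, h', _, h⟩ | ⟨e', _, h', _, h⟩ | ⟨h1, h2, h3, h⟩
  · exfalso
    have h1 : (X.st u (t + 1)).cur = (X.st u t).ep := by rw [h]; rfl
    exact h'.1 (by simp; omega)
  · exfalso
    have h1 : (X.st u (t + 1)).ep = e' := by rw [h]
    have := ep_lt_of_changesTo h'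
    simp at this
    omega
  · exact ⟨h1, h2, h3⟩

/-- Apart from the messages of `IsEpochMsg`, everything is sent in a `stay` step. The guard
therefore held at the moment of sending, and epoch and hanging items do not change in that step.
Facts about messages already sent are read off this guard. -/
theorem enabled_of_out (hu : u ∉ S.byz) {m} (hm : m ∈ X.out u t) (hn : ¬ IsEpochMsg m) :
    m ∉ (X.st u t).sent ∧ Enabled S u (X.pre u t) m ∧ (X.st u (t + 1)).cur = (X.st u t).cur ∧
      (X.st u (t + 1)).ep = (X.st u t).ep ∧ (X.st u (t + 1)).hung = (X.st u t).hung := by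
  rcases (X.acts_pre hu t).cases with ⟨V, h', h1, h⟩ | ⟨e', _, h', h1, h⟩ | ⟨h1, h2, h3, h⟩
  · rw [h1] at hm
    split_ifs at hm
    · exact absurd (Or.inr ⟨_, _, Finset.mem_singleton.1 hm⟩) hn
    · simp at hm
  · rw [h1] at hm
    exact absurd (Or.inl ⟨_, _, Finset.mem_singleton.1 hm⟩) hn
  · refine ⟨((h3 m).1 hm).1, ((h3 m).1 hm).2, ?_, ?_, ?_⟩ <;> rw [h] <;> rfl

theorem enabled_of_sent (hu : u ∉ S.byz) {m} (hm : m ∈ (X.st u t).sent) (hn : ¬ IsEpochMsg m) :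
    ∃ t' < t, m ∈ X.out u t' ∧ m ∉ (X.st u t').sent ∧ Enabled S u (X.pre u t') m ∧
      (X.st u (t' + 1)).cur = (X.st u t').cur ∧ (X.st u (t' + 1)).ep = (X.st u t').ep ∧
      (X.st u (t' + 1)).hung = (X.st u t').hung := by
  obtain ⟨t', h, h'⟩ := (X.mem_sent hu).1 hm
  exact ⟨t', h, h', X.enabled_of_out hu h' hn⟩

/-- An epoch-change message is sent when `u` changes to the epoch. -/
theorem epochChange_of_out (hu : u ∉ S.byz) {e d} (hm : Msg.epochChange e d ∈ X.out u t) :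
    (X.st u t).ep < e ∧ (X.st u (t + 1)).ep = e ∧ d = ecData S u (X.pre u t) ∧
      X.out u t = {.epochChange e d} ∧ ChangesTo S u (X.pre u t) t e := by
  rcases (X.acts_pre hu t).cases with ⟨V, h', h1, h⟩ | ⟨e', _, h', h1, h⟩ | ⟨h1, h2, h3, h⟩
  · rw [h1] at hm
    split_ifs at hm <;> simp at hm
  · rw [h1, Finset.mem_singleton] at hm
    injection hm with h2 h3
    subst h2
    exact ⟨by simpa using ep_lt_of_changesTo h', by rw [h], h3, by rw [h1, h3], h'⟩
  · exact absurd ((h3 _).1 hm).2 id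

/-- A new-epoch message is sent when the primary enters the epoch. -/
theorem newEpoch_of_out (hu : u ∉ S.byz) {e V} (hm : Msg.newEpoch e V ∈ X.out u t) :
    (X.st u t).ep = e ∧ (X.st u t).cur < e ∧ (X.st u (t + 1)).cur = e ∧ u = S.prim e ∧
      Enters S u (X.pre u t) V ∧ X.out u t = {.newEpoch e V} ∧
      (X.st u (t + 1)).hung = S.hungOf e V := by
  rcases (X.acts_pre hu t).cases with ⟨V', h', h1, h⟩ | ⟨e', _, h', h1, h⟩ | ⟨h1, h2, h3, h⟩
  · rw [h1] at hm
    split_ifs at hm with hp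
    · rw [Finset.mem_singleton] at hm
      injection hm with h2 h3
      subst h2 h3
      refine ⟨rfl, ?_, by rw [h], hp, h', by rw [h1, if_pos hp], by rw [h]⟩
      have := h'.1
      have := (X.cur_pos_le hu t).2
      simp at *
      omega
    · simp at hm
  · rw [h1] at hm
    simp at hm
  · exact absurd ((h3 _).1 hm).2 id

theorem epochChange_of_sent (hu : u ∉ S.byz) {e d} (hm : Msg.epochChange e d ∈ (X.st u t).sent) :
    ∃ t' < t, (X.st u t').ep < e ∧ (X.st u (t' + 1)).ep = e ∧ d = ecData S u (X.pre u t') ∧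
      e ≤ (X.st u t).ep ∧ d.last < e ∧ X.out u t' = {.epochChange e d} := by
  obtain ⟨t', h, h'⟩ := (X.mem_sent hu).1 hm
  obtain ⟨h1, h2, h3, h4, _⟩ := X.epochChange_of_out hu h'
  refine ⟨t', h, h1, h2, h3, ?_, ?_, h4⟩
  · rw [← h2]
    exact X.ep_mono hu h
  · rw [h3]
    exact lt_of_le_of_lt (X.cur_pos_le hu t').2 h1

theorem newEpoch_of_sent (hu : u ∉ S.byz) {e V} (hm : Msg.newEpoch e V ∈ (X.st u t).sent) :
    ∃ t' < t, (X.st u t').ep = e ∧ (X.st u t').cur < e ∧ (X.st u (t' + 1)).cur = e ∧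
      u = S.prim e ∧ Enters S u (X.pre u t') V ∧ e ≤ (X.st u t).cur ∧
      X.out u t' = {.newEpoch e V} ∧ (X.st u (t' + 1)).hung = S.hungOf e V := by
  obtain ⟨t', h, h'⟩ := (X.mem_sent hu).1 hm
  obtain ⟨h1, h2, h3, h4, h5, h6, h7⟩ := X.newEpoch_of_out hu h'
  refine ⟨t', h, h1, h2, h3, h4, h5, ?_, h6, h7⟩
  rw [← h3]
  exact X.cur_mono hu h

theorem out_disjoint_sent (hu : u ∉ S.byz) {m} (hm : m ∈ X.out u t) : m ∉ (X.st u t).sent := by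
  by_cases hn : IsEpochMsg m
  · rcases hn with ⟨e, d, rfl⟩ | ⟨e, V, rfl⟩
    · intro h
      obtain ⟨_, _, _, _, _, h1, _⟩ := X.epochChange_of_sent hu h
      have := (X.epochChange_of_out hu hm).1
      omega
    · intro h
      obtain ⟨_, _, _, _, _, _, _, h1, _⟩ := X.newEpoch_of_sent hu h
      have := (X.newEpoch_of_out hu hm).2.1
      omega
  · exact (X.enabled_of_out hu hm hn).1

/-- A replica that has left the first epoch has sent an epoch-change message for its epoch. -/
theorem exists_epochChange_sent (hu : u ∉ S.byz) (h : 2 ≤ (X.st u t).ep) :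
    ∃ d, Msg.epochChange (X.st u t).ep d ∈ (X.st u t).sent := by
  induction t with
  | zero => simp [X.st_zero u hu, LState.initial] at h
  | succ t ih =>
    have hs := X.sent_succ hu t
    rcases (X.acts_pre hu t).cases with ⟨V, h', h1, h0⟩ | ⟨e', _, h', h1, h0⟩ | ⟨h1, h2, h3, h0⟩
    · have h2 : (X.st u (t + 1)).ep = (X.st u t).ep := by rw [h0]; rfl
      rw [h2] at h ⊢
      obtain ⟨d, hd⟩ := ih h
      exact ⟨d, by rw [hs]; exact Finset.mem_union_left _ hd⟩
    · have h2 : (X.st u (t + 1)).ep = e' := by rw [h0]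
      rw [h2, hs, h1]
      exact ⟨_, Finset.mem_union_right _ (Finset.mem_singleton_self _)⟩
    · have h2 : (X.st u (t + 1)).ep = (X.st u t).ep := by rw [h0]; rfl
      rw [h2] at h ⊢
      obtain ⟨d, hd⟩ := ih h
      exact ⟨d, by rw [hs]; exact Finset.mem_union_left _ hd⟩

end Execution
end FnF

/-! ### Consistency: certificates, caps, uniqueness, sizes. -/

namespace FnF

variable {P : Params} {S : System P}

namespace Execution

variable (X : Execution S) {u v w : Rep P} {t t' e i : ℕ} {x x' : Item P}

/-! ## Certificates -/

theorem combinable_of_prepared (hu : u ∉ S.byz) (h : Has u (X.pre u t) v (.prepared e v i x)) :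
    Combinable S X.out t (.prepare e v i x) := by
  by_cases hv : v ∈ S.byz
  · rcases h with h | ⟨rfl, -⟩
    · obtain ⟨t', h1, h2, -⟩ := X.relevant_of_pre_acc hu h
      obtain ⟨t'', h3, h4⟩ := X.deliv_of_proc hu h2
      exact X.combinable_mono (by omega) (X.deliv_byz u hu v hv _ _ h4)
    · exact absurd hv hu
  · obtain ⟨t', h1, -, -, h2, -⟩ := X.enabled_of_sent hv (X.source_of_has_pre hu h hv)
      (by simp [IsEpochMsg])
    exact X.combinable_mono h1.le (X.combinable_of_hasFrom hv h2.2.2.2)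

theorem combinable_of_committed (hu : u ∉ S.byz)
    (h : Has u (X.pre u t) v (.committed e v i x)) :
    Combinable S X.out t (.commit e v i x) := by
  by_cases hv : v ∈ S.byz
  · rcases h with h | ⟨rfl, -⟩
    · obtain ⟨t', h1, h2, -⟩ := X.relevant_of_pre_acc hu h
      obtain ⟨t'', h3, h4⟩ := X.deliv_of_proc hu h2
      exact X.combinable_mono (by omega) (X.deliv_byz u hu v hv _ _ h4)
    · exact absurd hv hu
  · obtain ⟨t', h1, -, -, h2, -⟩ := X.enabled_of_sent hv (X.source_of_has_pre hu h hv)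
      (by simp [IsEpochMsg])
    exact X.combinable_mono h1.le (X.combinable_of_hasFrom hv h2.2.2.2)

theorem combinable_of_ckptCert (hu : u ∉ S.byz) (h : Has u (X.pre u t) v (.ckptCert e v i)) :
    Combinable S X.out t (.checkpoint e v i) := by
  by_cases hv : v ∈ S.byz
  · rcases h with h | ⟨rfl, -⟩
    · obtain ⟨t', h1, h2, -⟩ := X.relevant_of_pre_acc hu h
      obtain ⟨t'', h3, h4⟩ := X.deliv_of_proc hu h2
      exact X.combinable_mono (by omega) (X.deliv_byz u hu v hv _ _ h4)
    · exact absurd hv hu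
  · obtain ⟨t', h1, -, -, h2, -⟩ := X.enabled_of_sent hv (X.source_of_has_pre hu h hv)
      (by simp [IsEpochMsg])
    exact X.combinable_mono h1.le (X.combinable_of_hasFrom hv h2.2.2.2)

/-! ## Limits on processed messages -/

/-- A class of mutually competing messages never outgrows its cap: a step that processes a member
respects the cap at that member, and any other step adds nothing. The class may shrink with time;
this is needed for epoch-change messages above the present epoch, whose competition depends on the
state. -/
theorem card_acc_filter_le (hu : u ∉ S.byz) (C : ℕ → Rep P × Msg P → Prop) (c : ℕ)
    (hanti : ∀ t a, C (t + 1) a → C t a)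
    (hcomp : ∀ t a b, C t a → C t b → Competes (X.st u t) a b)
    (hcap : ∀ t a, C t a → cap a.2 ≤ c) (t : ℕ) :
    ((X.st u t).acc.filter (C t)).card ≤ c := by
  induction t with
  | zero => simp [X.st_zero u hu, LState.initial]
  | succ t ih =>
    have h1 : (X.st u (t + 1)).acc.filter (C (t + 1)) ⊆ (X.st u (t + 1)).acc.filter (C t) :=
      Finset.monotone_filter_right _ fun a ha => hanti t a
    refine (Finset.card_le_card h1).trans ?_
    by_cases hA : ∃ a ∈ X.proc u t, C t a
    · obtain ⟨a, ha, hCa⟩ := hA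
      refine le_trans ?_ (hcap t a hCa)
      refine le_trans (Finset.card_le_card ?_) ((X.accepts u hu t).2.1 a ha)
      rw [X.acc_succ hu]
      exact Finset.monotone_filter_right _ fun b hb hCb => hcomp t a b hCa hCb
    · refine (Finset.card_le_card ?_).trans ih
      intro a ha
      rw [X.acc_succ hu, Finset.mem_filter, Finset.mem_union] at ha
      rw [Finset.mem_filter]
      rcases ha with ⟨h | h, h'⟩
      · exact ⟨h, h'⟩
      · exact absurd ⟨a, h, h'⟩ hA

theorem card_acc_class_le (hu : u ∉ S.byz) (C : Rep P × Msg P → Prop) [DecidablePred C] (c : ℕ)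
    (hcomp : ∀ s a b, C a → C b → Competes s a b) (hcap : ∀ a, C a → cap a.2 ≤ c) (t : ℕ) :
    ((X.st u t).acc.filter C).card ≤ c := by
  have := X.card_acc_filter_le hu (fun _ => C) c (fun _ _ h => h) (fun t => hcomp _)
    (fun _ => hcap) t
  convert this

theorem acc_unique (hu : u ∉ S.byz) {a b} (ha : a ∈ (X.st u t).acc) (hb : b ∈ (X.st u t).acc)
    (hab : ∀ s, Competes s a a ∧ Competes s a b ∧ Competes s b a ∧ Competes s b b)
    (ca : cap a.2 = 1) (cb : cap b.2 = 1) : a = b := by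
  have h := X.card_acc_class_le hu (fun c => c = a ∨ c = b) 1
    (by rintro s c d (rfl | rfl) (rfl | rfl) <;> simp [hab s])
    (by rintro c (rfl | rfl) <;> simp [ca, cb]) t
  rw [Finset.card_le_one] at h
  exact h a (by simp [ha]) b (by simp [hb])

/-! ## Uniqueness of the messages of correct replicas -/

/-- If each guard forbids having sent the other message, neither message can precede the other.
Uniqueness of what is sent thereby reduces to uniqueness of what is held in one state. -/
theorem enabled_same_time (hu : u ∉ S.byz) {m m' : Msg P} (hm : m ∈ (X.st u t).sent)
    (hm' : m' ∈ (X.st u t).sent) (hn : ¬ IsEpochMsg m) (hn' : ¬ IsEpochMsg m')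
    (h : ∀ s, Enabled S u s m → m' ∉ s.sent) (h' : ∀ s, Enabled S u s m' → m ∉ s.sent) :
    ∃ t' < t, Enabled S u (X.pre u t') m ∧ Enabled S u (X.pre u t') m' := by
  obtain ⟨t₁, h1, ho, -, h2, -⟩ := X.enabled_of_sent hu hm hn
  obtain ⟨t₂, h1', ho', -, h2', -⟩ := X.enabled_of_sent hu hm' hn'
  have e1 : ¬ t₂ < t₁ := fun hlt => h _ h2 ((X.mem_sent hu).2 ⟨t₂, hlt, ho'⟩)
  have e2 : ¬ t₁ < t₂ := fun hlt => h' _ h2' ((X.mem_sent hu).2 ⟨t₁, hlt, ho⟩)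
  obtain rfl : t₁ = t₂ := by omega
  exact ⟨t₁, h1, h2, h2'⟩

theorem prePrepare_of_sent (hu : u ∉ S.byz) (h : Msg.prePrepare e v i x ∈ (X.st u t).sent) :
    v = u ∧ x = ((e, v, i), some (S.pend e v i)) := by
  obtain ⟨t', -, -, -, h, -⟩ := X.enabled_of_sent hu h (by simp [IsEpochMsg])
  exact ⟨h.2.2.1.symm, h.2.2.2.2.2.2⟩

theorem prePrepare_unique (hu : u ∉ S.byz) (h : Has u (X.pre u t) v (.prePrepare e v i x))
    (h' : Has u (X.pre u t) v (.prePrepare e v i x')) : x = x' := by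
  by_cases huv : v = u
  · subst huv
    rw [X.has_self_pre hu] at h h'
    rw [(X.prePrepare_of_sent hu h).2, (X.prePrepare_of_sent hu h').2]
  · rw [has_other huv, X.pre_acc_eq hu] at h h'
    have := X.acc_unique hu h h' (fun s => by simp [Competes]) rfl rfl
    simpa using this

theorem proposed_unique (hu : u ∉ S.byz) (h : Proposed S u (X.pre u t) v i x)
    (h' : Proposed S u (X.pre u t) v i x') : x = x' := by
  rcases h with ⟨hi, h⟩ | ⟨hF, h⟩ <;> rcases h' with ⟨hi', h'⟩ | ⟨hF', h'⟩
  · rw [h] at h'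
    exact Option.some.inj h'
  -- A hanging item sits at a position up to the length of the list, a fresh item beyond it, so the
  -- mixed cases are void.
  · have := (List.getElem?_eq_some_iff.1 h).1
    have := hF'.1
    omega
  · have := (List.getElem?_eq_some_iff.1 h').1
    have := hF.1
    omega
  · exact X.prePrepare_unique hu h h'

theorem prepare_unique (hu : u ∉ S.byz) (h : Msg.prepare e v i x ∈ (X.st u t).sent)
    (h' : Msg.prepare e v i x' ∈ (X.st u t).sent) : x = x' := by
  obtain ⟨t', -, h1, h2⟩ := X.enabled_same_time hu h h' (by simp [IsEpochMsg])
    (by simp [IsEpochMsg]) (fun s hs => hs.2.2.2.2 _) (fun s hs => hs.2.2.2.2 _)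
  exact X.proposed_unique hu h1.2.2.2.1 h2.2.2.2.1

/-- With f > 0 a quorum has a member other than `u`. Its partial signature was relevant only because
the leader had already sent the same message; hence a leader certifies only what it has signed
itself. -/
theorem exists_other_acc (hf : 0 < P.f) {s : LState P} {m : Msg P}
    (h : HasFrom u s (2 * P.f + 1) m) : ∃ w, w ≠ u ∧ (w, m) ∈ s.acc := by
  obtain ⟨w, hw, h⟩ := exists_ne_of_two_le_card u (h.trans' (by omega : 2 ≤ 2 * P.f + 1))
  exact ⟨w, hw, (has_other hw).1 h⟩

theorem prepare_of_hasFrom (hf : 0 < P.f) (hu : u ∉ S.byz)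
    (h : HasFrom u (X.pre u t) (2 * P.f + 1) (.prepare e v i x)) :
    Msg.prepare e v i x ∈ (X.st u t).sent := by
  obtain ⟨w, -, h⟩ := exists_other_acc hf h
  obtain ⟨t', h1, -, h2⟩ := X.relevant_of_pre_acc hu h
  exact X.sent_mono hu h1 h2.2.2.2.2.1

theorem commit_of_hasFrom (hf : 0 < P.f) (hu : u ∉ S.byz)
    (h : HasFrom u (X.pre u t) (2 * P.f + 1) (.commit e v i x)) :
    Msg.commit e v i x ∈ (X.st u t).sent := by
  obtain ⟨w, -, h⟩ := exists_other_acc hf h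
  obtain ⟨t', h1, -, h2⟩ := X.relevant_of_pre_acc hu h
  exact X.sent_mono hu h1 h2.2.2.2.2.1

theorem checkpoint_of_hasFrom (hf : 0 < P.f) (hu : u ∉ S.byz)
    (h : HasFrom u (X.pre u t) (2 * P.f + 1) (.checkpoint e v i)) :
    Msg.checkpoint e v i ∈ (X.st u t).sent := by
  obtain ⟨w, -, h⟩ := exists_other_acc hf h
  obtain ⟨t', h1, -, h2⟩ := X.relevant_of_pre_acc hu h
  exact X.sent_mono hu h1 h2.2.2.2.2.1

theorem prepare_of_prepared (hf : 0 < P.f) (hu : u ∉ S.byz)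
    (h : Msg.prepared e v i x ∈ (X.st u t).sent) :
    u = v ∧ Msg.prepare e v i x ∈ (X.st u t).sent := by
  obtain ⟨t', h1, -, -, h, -⟩ := X.enabled_of_sent hu h (by simp [IsEpochMsg])
  exact ⟨h.2.2.1, X.sent_mono hu h1.le (X.prepare_of_hasFrom hf hu h.2.2.2)⟩

theorem commit_of_committed (hf : 0 < P.f) (hu : u ∉ S.byz)
    (h : Msg.committed e v i x ∈ (X.st u t).sent) :
    u = v ∧ Msg.commit e v i x ∈ (X.st u t).sent := by
  obtain ⟨t', h1, -, -, h, -⟩ := X.enabled_of_sent hu h (by simp [IsEpochMsg])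
  exact ⟨h.2.2.1, X.sent_mono hu h1.le (X.commit_of_hasFrom hf hu h.2.2.2)⟩

/-- As leader, `u` has signed only one item; as follower, it processes a single certificate per
place. -/
theorem prepared_unique (hf : 0 < P.f) (hu : u ∉ S.byz)
    (h : Has u (X.pre u t) v (.prepared e v i x))
    (h' : Has u (X.pre u t) v (.prepared e v i x')) : x = x' := by
  by_cases huv : v = u
  · subst huv
    rw [X.has_self_pre hu] at h h'
    exact X.prepare_unique hu (X.prepare_of_prepared hf hu h).2 (X.prepare_of_prepared hf hu h').2
  · rw [has_other huv, X.pre_acc_eq hu] at h h'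
    have := X.acc_unique hu h h' (fun s => by simp [Competes]) rfl rfl
    simpa using this

theorem commit_unique (hf : 0 < P.f) (hu : u ∉ S.byz) (h : Msg.commit e v i x ∈ (X.st u t).sent)
    (h' : Msg.commit e v i x' ∈ (X.st u t).sent) : x = x' := by
  obtain ⟨t', -, h1, h2⟩ := X.enabled_same_time hu h h' (by simp [IsEpochMsg])
    (by simp [IsEpochMsg]) (fun s hs => hs.2.2.2 _) (fun s hs => hs.2.2.2 _)
  exact X.prepared_unique hf hu h1.2.2.1 h2.2.2.1

theorem prepared_of_commit (hu : u ∉ S.byz) (h : Msg.commit e v i x ∈ (X.st u t).sent) :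
    ∃ t' < t, Has u (X.pre u t') v (.prepared e v i x) := by
  obtain ⟨t', h1, -, -, h, -⟩ := X.enabled_of_sent hu h (by simp [IsEpochMsg])
  exact ⟨t', h1, h.2.2.1⟩

theorem leader_chain (hf : 0 < P.f) (hv : v ∉ S.byz)
    (h : Msg.committed e v i x ∈ (X.st v t).sent) :
    Msg.commit e v i x ∈ (X.st v t).sent ∧ Msg.prepared e v i x ∈ (X.st v t).sent ∧
      Msg.prepare e v i x ∈ (X.st v t).sent := by
  have h1 := (X.commit_of_committed hf hv h).2
  obtain ⟨t', h2, h3⟩ := X.prepared_of_commit hv h1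
  have h4 := X.sent_mono hv h2.le ((X.has_self_pre hv).1 h3)
  exact ⟨h1, h4, (X.prepare_of_prepared hf hv h4).2⟩

theorem rbInit_unique (hu : u ∉ S.byz) {J J'} (h : Has u (X.pre u t) (S.prim e) (.rbInit e J))
    (h' : Has u (X.pre u t) (S.prim e) (.rbInit e J')) : J = J' := by
  by_cases huv : S.prim e = u
  · rw [huv, X.has_self_pre hu] at h h'
    obtain ⟨t', -, h1, h2⟩ := X.enabled_same_time hu h h' (by simp [IsEpochMsg])
      (by simp [IsEpochMsg]) (fun s hs => hs.2.2.2.2.2 _) (fun s hs => hs.2.2.2.2.2 _)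
    rw [h1.2.2.2.1, h2.2.2.2.1]
  · rw [has_other huv, X.pre_acc_eq hu] at h h'
    have := X.acc_unique hu h h' (fun s => by simp [Competes]) rfl rfl
    simpa using this

theorem rbEcho_unique (hu : u ∉ S.byz) {J J'} (h : Msg.rbEcho e J ∈ (X.st u t).sent)
    (h' : Msg.rbEcho e J' ∈ (X.st u t).sent) : J = J' := by
  obtain ⟨t', -, h1, h2⟩ := X.enabled_same_time hu h h' (by simp [IsEpochMsg])
    (by simp [IsEpochMsg]) (fun s hs => hs.2.2.2 _) (fun s hs => hs.2.2.2 _)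
  exact X.rbInit_unique hu h1.2.2.1 h2.2.2.1

/-- Amplification from f+1 readies leads back to an earlier ready of a correct replica, and the
earliest one rests on a quorum of echoes; hence the induction on time. -/
theorem combinable_rbEcho (hu : u ∉ S.byz) {J} (h : Msg.rbReady e J ∈ (X.st u t).sent) :
    Combinable S X.out t (.rbEcho e J) := by
  induction t using Nat.strong_induction_on generalizing u with
  | _ t ih =>
    obtain ⟨t', h1, -, -, h, -⟩ := X.enabled_of_sent hu h (by simp [IsEpochMsg])
    refine X.combinable_mono h1.le ?_
    rcases h.2.2.1 with h | h
    · exact X.combinable_of_hasFrom hu h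
    · obtain ⟨w, hw, h⟩ := exists_correct_of_quorum S _ h
      exact ih t' h1 hw (X.source_of_has_pre hu h hw)

/-- Two echo quorums meet in a correct replica, which echoes once. So the broadcast has a single
outcome, also under a byzantine primary. -/
theorem rbReady_unique (hu : u ∉ S.byz) (hw : w ∉ S.byz) {J J'}
    (h : Msg.rbReady e J ∈ (X.st u t).sent) (h' : Msg.rbReady e J' ∈ (X.st w t').sent) :
    J = J' := by
  have h1 := X.combinable_mono (le_max_left t t') (X.combinable_rbEcho hu h)
  have h2 := X.combinable_mono (le_max_right t t') (X.combinable_rbEcho hw h')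
  rw [combinable_iff] at h1 h2
  obtain ⟨z, hz, h3, h4⟩ := quorum_inter S _ _ h1 h2
  exact X.rbEcho_unique hz (h3.resolve_left hz) (h4.resolve_left hz)

theorem epochChange_unique (hu : u ∉ S.byz) {d d'} (h : Msg.epochChange e d ∈ (X.st u t).sent)
    (h' : Msg.epochChange e d' ∈ (X.st u t).sent) : d = d' := by
  obtain ⟨t₁, -, h1, h2, h3, -⟩ := X.epochChange_of_sent hu h
  obtain ⟨t₂, -, h1', h2', h3', -⟩ := X.epochChange_of_sent hu h'
  have e1 : ¬ t₂ < t₁ := fun hlt => by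
    have := X.ep_mono hu (show t₂ + 1 ≤ t₁ from hlt); simp only at this; omega
  have e2 : ¬ t₁ < t₂ := fun hlt => by
    have := X.ep_mono hu (show t₁ + 1 ≤ t₂ from hlt); simp only at this; omega
  obtain rfl : t₁ = t₂ := by omega
  rw [h3, h3']

theorem newEpoch_unique (hu : u ∉ S.byz) {V V'} (h : Msg.newEpoch e V ∈ (X.st u t).sent)
    (h' : Msg.newEpoch e V' ∈ (X.st u t).sent) : V = V' := by
  obtain ⟨t₁, -, -, h1, h2, -, -, -, h3, -⟩ := X.newEpoch_of_sent hu h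
  obtain ⟨t₂, -, -, h1', h2', -, -, -, h3', -⟩ := X.newEpoch_of_sent hu h'
  have e1 : ¬ t₂ < t₁ := fun hlt => by
    have := X.cur_mono hu (show t₂ + 1 ≤ t₁ from hlt); simp only at this; omega
  have e2 : ¬ t₁ < t₂ := fun hlt => by
    have := X.cur_mono hu (show t₁ + 1 ≤ t₂ from hlt); simp only at this; omega
  obtain rfl : t₁ = t₂ := by omega
  rw [h3, Finset.singleton_inj] at h3'
  simpa using h3'

end Execution

/-! ## Sizes -/

theorem openItems_length_le (V : Rep P → Option (ECData P)) :
    (openItems V).length ≤ P.n * (2 * P.k) := by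
  unfold openItems
  rw [List.length_flatMap]
  refine (List.sum_le_card_nsmul _ (2 * P.k) ?_).trans ?_
  · intro l hl
    obtain ⟨v, -, rfl⟩ := List.mem_map.1 hl
    exact (List.length_filterMap_le _ _).trans (by simp)
  · simp

theorem hungOf_length_le (e : ℕ) (V : Rep P → Option (ECData P)) (v : Rep P) :
    (S.hungOf e V v).length ≤ P.n * (2 * P.k) :=
  (List.length_filter_le _ _).trans (openItems_length_le V)

theorem Execution.hung_length_le (X : Execution S) {u : Rep P} (hu : u ∉ S.byz) (t : ℕ)
    (v : Rep P) : ((X.st u t).hung v).length ≤ P.n * (2 * P.k) := by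
  induction t with
  | zero => simp [X.st_zero u hu, LState.initial]
  | succ t ih =>
    rcases (X.acts_pre hu t).cases with ⟨V, _, _, h⟩ | ⟨e', _, h', _, h⟩ | ⟨_, _, _, h⟩ <;> rw [h]
    · exact hungOf_length_le _ _ _
    · exact ih
    · exact ih

theorem le_auths (d : ECData P) : P.n + 1 ≤ d.auths := by
  unfold ECData.auths
  omega

theorem auths_le (d : ECData P) : d.auths ≤ 1 + P.n + P.n * (4 * P.k) := by
  unfold ECData.auths
  have : ∑ v, ((Finset.univ.filter fun j => d.prep v j ≠ none).card +
      (Finset.univ.filter fun j => d.comm v j ≠ none).card) ≤ ∑ _v : Rep P, 4 * P.k := by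
    refine Finset.sum_le_sum fun v _ => ?_
    have h1 := Finset.card_le_univ (Finset.univ.filter fun j => d.prep v j ≠ none)
    have h2 := Finset.card_le_univ (Finset.univ.filter fun j => d.comm v j ≠ none)
    rw [Fintype.card_fin] at h1 h2
    omega
  rw [Finset.sum_const, Finset.card_univ, Fintype.card_fin, smul_eq_mul] at this
  omega

/-- No record can push a load below the minimum: one branch is a maximum with `Cmin`, the other is
twice a number not below the previous load. -/
theorem load_ge (e : ℕ) (v : Rep P) : P.Cmin ≤ S.load e v := by
  unfold System.load
  induction e with
  | zero => simp [loadOf]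
  | succ e ih =>
    cases e with
    | zero => simp [loadOf]
    | succ e =>
      rw [loadOf]
      split_ifs with h
      · exact le_max_left _ _
      · omega

end FnF

/-! ### Costs per local number and per epoch-change. -/

namespace FnF

variable {P : Params} {S : System P}

/-! ## Authenticator complexity of one replica -/

/-- A bound on the cost of processing a message that does not depend on the state. -/
noncomputable def costBound (m : Msg P) : ℕ :=
  match m with
  | .epochChange _ d => d.auths
  | .newEpoch _ V => 1 + (openItems V).length + ∑ w, ((V w).map ECData.auths).getD 0
  | _ => 1

theorem verifyCost_le (u : Rep P) (acc : Finset (Rep P × Msg P)) (m : Msg P) :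
    verifyCost u acc m ≤ costBound m := by
  cases m <;> simp only [verifyCost, costBound, le_refl]
  rename_i e V
  refine Nat.add_le_add_left (Finset.sum_le_sum fun w _ => ?_) _
  split_ifs
  · cases V w with
    | none => simp
    | some d => simp only [Option.map_some, Option.getD_some]; split_ifs <;> simp
  · exact Nat.zero_le _

theorem one_le_computeCost (m : Msg P) : 1 ≤ computeCost m := by
  cases m <;> simp [computeCost]

theorem computeCost_of_not_epochMsg {m : Msg P} (h : ¬ IsEpochMsg m) : computeCost m = 1 := by
  cases m <;> first | rfl | exact absurd (Or.inr ⟨_, _, rfl⟩) h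

theorem costBound_of_not_epochMsg {m : Msg P} (h : ¬ IsEpochMsg m) : costBound m = 1 := by
  cases m <;> first | rfl | exact absurd (Or.inr ⟨_, _, rfl⟩) h | exact absurd (Or.inl ⟨_, _, rfl⟩) h

theorem costBound_newEpoch_le (e : ℕ) (V : Rep P → Option (ECData P)) :
    costBound (.newEpoch e V) ≤
      1 + P.n * (2 * P.k) + P.n * (1 + P.n + P.n * (4 * P.k)) := by
  simp only [costBound]
  have h1 := openItems_length_le V
  have h2 : ∑ w, ((V w).map ECData.auths).getD 0 ≤
      ∑ _w : Rep P, (1 + P.n + P.n * (4 * P.k)) := by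
    refine Finset.sum_le_sum fun w _ => ?_
    cases V w with
    | none => simp
    | some d => simpa using auths_le d
  rw [Finset.sum_const, Finset.card_univ, Fintype.card_fin, smul_eq_mul] at h2
  omega

namespace Execution

variable (X : Execution S) {u v w : Rep P} {t t' e i : ℕ} {x x' : Item P} {φ ψ : Msg P → Prop}

/-- The cost of the messages satisfying `φ` for the replica `u` before time `t`. -/
noncomputable def ucost (φ : Msg P → Prop) (u : Rep P) (t : ℕ) : ℕ :=
  ∑ t' ∈ Finset.range t, ∑ a ∈ (X.proc u t').filter (fun a => φ a.2),
      verifyCost u ((X.st u t').acc ∪ X.proc u t') a.2 +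
    ∑ m ∈ (X.st u t).sent.filter φ, computeCost m

/-- A message is processed at most once, so a sum over time is a sum over the final `acc`. -/
theorem sum_acc (hu : u ∉ S.byz) (C : Rep P × Msg P → Prop) (g : Rep P × Msg P → ℕ) (t : ℕ) :
    ∑ t' ∈ Finset.range t, ∑ a ∈ (X.proc u t').filter C, g a =
      ∑ a ∈ (X.st u t).acc.filter C, g a := by
  induction t with
  | zero => simp [X.st_zero u hu, LState.initial]
  | succ t ih =>
    rw [Finset.sum_range_succ, ih, X.acc_succ hu, Finset.filter_union, Finset.sum_union]
    refine Finset.disjoint_left.2 fun a ha hb => ?_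
    exact X.not_mem_acc_of_proc hu (Finset.mem_filter.1 hb).1 (Finset.mem_filter.1 ha).1

theorem sum_sent (hu : u ∉ S.byz) (φ : Msg P → Prop) (g : Msg P → ℕ) (t : ℕ) :
    ∑ t' ∈ Finset.range t, ∑ m ∈ (X.out u t').filter φ, g m =
      ∑ m ∈ (X.st u t).sent.filter φ, g m := by
  induction t with
  | zero => simp [X.st_zero u hu, LState.initial]
  | succ t ih =>
    rw [Finset.sum_range_succ, ih, X.sent_succ hu, Finset.filter_union, Finset.sum_union]
    refine Finset.disjoint_left.2 fun a ha hb => ?_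
    exact X.out_disjoint_sent hu (Finset.mem_filter.1 hb).1 (Finset.mem_filter.1 ha).1

theorem cost_zero (φ : Msg P → Prop) (t : ℕ) :
    X.cost φ 0 t = ∑ u ∈ Finset.univ.filter (fun u => u ∉ S.byz), X.ucost φ u t := by
  unfold cost ucost
  rw [Finset.sum_comm]
  refine Finset.sum_congr rfl fun u hu => ?_
  rw [Finset.sum_add_distrib, Nat.Ico_zero_eq_range, X.sum_sent (Finset.mem_filter.1 hu).2]

theorem ucost_le (hu : u ∉ S.byz) (φ : Msg P → Prop) (t : ℕ) :
    X.ucost φ u t ≤ ∑ a ∈ (X.st u t).acc.filter (fun a => φ a.2), costBound a.2 +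
      ∑ m ∈ (X.st u t).sent.filter φ, computeCost m := by
  unfold ucost
  rw [← X.sum_acc hu (fun a => φ a.2) (fun a => costBound a.2)]
  gcongr
  exact verifyCost_le _ _ _

theorem sum_filter_le_sum_sum {α ι : Type*} (s : Finset α) (p : α → Prop) (I : Finset ι)
    (q : ι → α → Prop) (g : α → ℕ) (h : ∀ a ∈ s, p a → ∃ j ∈ I, q j a) :
    ∑ a ∈ s.filter p, g a ≤ ∑ j ∈ I, ∑ a ∈ s.filter (q j), g a := by
  simp_rw [Finset.sum_filter]
  rw [Finset.sum_comm]
  refine Finset.sum_le_sum fun a ha => ?_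
  split_ifs with hp
  · obtain ⟨j, hj, hq⟩ := h a ha hp
    have := Finset.single_le_sum (f := fun j => if q j a then g a else 0)
      (fun _ _ => Nat.zero_le _) hj
    simpa [hq] using this
  · exact Nat.zero_le _

theorem sum_filter_or_le {α : Type*} (s : Finset α) (p q r : α → Prop) (g : α → ℕ)
    (h : ∀ a ∈ s, p a → q a ∨ r a) :
    ∑ a ∈ s.filter p, g a ≤ ∑ a ∈ s.filter q, g a + ∑ a ∈ s.filter r, g a := by
  have := sum_filter_le_sum_sum s p (Finset.univ : Finset Bool) (fun b => if b then q else r) g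
    (fun a ha hp => by
      rcases h a ha hp with h | h
      · exact ⟨true, by simp, by simpa using h⟩
      · exact ⟨false, by simp, by simpa using h⟩)
  simpa using this

theorem cost_le_sum {ι : Type*} (I : Finset ι) (φ : Msg P → Prop) (ψ : ι → Msg P → Prop)
    (hacc : ∀ u, u ∉ S.byz → ∀ a ∈ (X.st u t).acc, φ a.2 → ∃ j ∈ I, ψ j a.2)
    (hsent : ∀ u, u ∉ S.byz → ∀ m ∈ (X.st u t).sent, φ m → ∃ j ∈ I, ψ j m) :
    X.cost φ 0 t ≤ ∑ j ∈ I, X.cost (ψ j) 0 t := by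
  simp_rw [X.cost_zero]
  rw [Finset.sum_comm]
  refine Finset.sum_le_sum fun u hu => ?_
  have hu := (Finset.mem_filter.1 hu).2
  unfold ucost
  rw [Finset.sum_add_distrib, Finset.sum_comm]
  gcongr with t' ht'
  · refine sum_filter_le_sum_sum _ _ _ _ _ fun a ha => hacc u hu a ?_
    exact (X.mem_acc hu).2 ⟨t', Finset.mem_range.1 ht', ha⟩
  · exact sum_filter_le_sum_sum _ _ _ _ _ fun a ha => hsent u hu a ha

theorem cost_le_add (φ ψ χ : Msg P → Prop) (h : ∀ m, φ m → ψ m ∨ χ m) :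
    X.cost φ 0 t ≤ X.cost ψ 0 t + X.cost χ 0 t := by
  have := X.cost_le_sum (t := t) (Finset.univ : Finset Bool) φ (fun b => if b then ψ else χ)
    (fun u _ a _ hp => by
      rcases h _ hp with h | h
      · exact ⟨true, by simp, by simpa using h⟩
      · exact ⟨false, by simp, by simpa using h⟩)
    (fun u _ a _ hp => by
      rcases h _ hp with h | h
      · exact ⟨true, by simp, by simpa using h⟩
      · exact ⟨false, by simp, by simpa using h⟩)
  simpa using this

theorem cost_split (φ : Msg P → Prop) (h : t ≤ t') :
    X.cost φ 0 t' = X.cost φ 0 t + X.cost φ t t' := by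
  unfold cost
  rw [Finset.sum_Ico_consecutive _ (Nat.zero_le _) h]

theorem sum_filter_le_of_card {α : Type*} (s : Finset α) (p : α → Prop) (g : α → ℕ) {c b : ℕ}
    (hc : (s.filter p).card ≤ c) (hb : ∀ a ∈ s, p a → g a ≤ b) :
    ∑ a ∈ s.filter p, g a ≤ c * b := by
  refine (Finset.sum_le_card_nsmul _ _ b fun a ha => ?_).trans ?_
  · exact hb a (Finset.mem_filter.1 ha).1 (Finset.mem_filter.1 ha).2
  · rw [smul_eq_mul]
    exact Nat.mul_le_mul_right _ hc

/-! ## The cost of a local number -/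

/-- Five messages sent and at most three processed (the pre-prepare and the two certificates) make
8. Partial signatures are relevant to the leader alone, which accepts 2f of them for each of two
certificates. -/
theorem ucost_forRequest_le (hf : 0 < P.f) (hu : u ∉ S.byz) (e : ℕ) (v : Rep P) (i t : ℕ) :
    X.ucost (ForRequest e v i) u t ≤ 8 + if u = v then 4 * P.f else 0 := by
  have hN : ∀ m : Msg P, ForRequest e v i m → ¬ IsEpochMsg m := by
    rintro m ⟨x, rfl | rfl | rfl | rfl | rfl⟩ <;> simp [IsEpochMsg]
  have hacc : ∑ a ∈ (X.st u t).acc.filter (fun a => ForRequest e v i a.2), costBound a.2 ≤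
      3 + if u = v then 4 * P.f else 0 := by
    have h0 : ∀ C : Rep P × Msg P → Prop, (∀ a, C a → ForRequest e v i a.2) → ∀ c,
        ((X.st u t).acc.filter C).card ≤ c →
        ∑ a ∈ (X.st u t).acc.filter C, costBound a.2 ≤ c := by
      intro C hC c hc
      have := sum_filter_le_of_card (X.st u t).acc C (fun a => costBound a.2) (b := 1) hc
        (fun a _ ha => (costBound_of_not_epochMsg (hN _ (hC a ha))).le)
      simpa using this
    have h1 := h0 (fun a => ∃ x, a.2 = .prePrepare e v i x) (fun a ⟨x, h⟩ => ⟨x, by simp [h]⟩) 1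
      (X.card_acc_class_le hu _ 1
        (by rintro s ⟨a, _⟩ ⟨b, _⟩ ⟨x, rfl⟩ ⟨y, rfl⟩; simp [Competes])
        (by rintro ⟨a, _⟩ ⟨x, rfl⟩; simp [cap]) t)
    have h2 := h0 (fun a => ∃ x, a.2 = .prepared e v i x) (fun a ⟨x, h⟩ => ⟨x, by simp [h]⟩) 1
      (X.card_acc_class_le hu _ 1
        (by rintro s ⟨a, _⟩ ⟨b, _⟩ ⟨x, rfl⟩ ⟨y, rfl⟩; simp [Competes])
        (by rintro ⟨a, _⟩ ⟨x, rfl⟩; simp [cap]) t)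
    have h3 := h0 (fun a => ∃ x, a.2 = .committed e v i x) (fun a ⟨x, h⟩ => ⟨x, by simp [h]⟩) 1
      (X.card_acc_class_le hu _ 1
        (by rintro s ⟨a, _⟩ ⟨b, _⟩ ⟨x, rfl⟩ ⟨y, rfl⟩; simp [Competes])
        (by rintro ⟨a, _⟩ ⟨x, rfl⟩; simp [cap]) t)
    have h4 := h0 (fun a => ∃ x, a.2 = .prepare e v i x) (fun a ⟨x, h⟩ => ⟨x, by simp [h]⟩)
      (if u = v then 2 * P.f else 0) (by
        split_ifs with huv
        · exact X.card_acc_class_le hu _ _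
            (by rintro s ⟨a, _⟩ ⟨b, _⟩ ⟨x, rfl⟩ ⟨y, rfl⟩; simp [Competes])
            (by rintro ⟨a, _⟩ ⟨x, rfl⟩; simp [cap]) t
        · rw [Nat.le_zero, Finset.card_eq_zero, Finset.filter_eq_empty_iff]
          rintro ⟨a, _⟩ ha ⟨x, rfl⟩
          obtain ⟨t', -, -, h⟩ := X.relevant_of_acc hu ha
          exact huv h.2.2.2.1)
    have h5 := h0 (fun a => ∃ x, a.2 = .commit e v i x) (fun a ⟨x, h⟩ => ⟨x, by simp [h]⟩)
      (if u = v then 2 * P.f else 0) (by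
        split_ifs with huv
        · exact X.card_acc_class_le hu _ _
            (by rintro s ⟨a, _⟩ ⟨b, _⟩ ⟨x, rfl⟩ ⟨y, rfl⟩; simp [Competes])
            (by rintro ⟨a, _⟩ ⟨x, rfl⟩; simp [cap]) t
        · rw [Nat.le_zero, Finset.card_eq_zero, Finset.filter_eq_empty_iff]
          rintro ⟨a, _⟩ ha ⟨x, rfl⟩
          obtain ⟨t', -, -, h⟩ := X.relevant_of_acc hu ha
          exact huv h.2.2.2.1)
    refine (sum_filter_or_le _ _ (fun a => ∃ x, a.2 = .prePrepare e v i x) (fun a => ∃ x,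
      a.2 = .prepare e v i x ∨ a.2 = .prepared e v i x ∨ a.2 = .commit e v i x ∨
      a.2 = .committed e v i x) _ fun a _ ⟨x, hx⟩ => hx.imp (⟨x, ·⟩) (⟨x, ·⟩)).trans ?_
    have g1 := sum_filter_or_le (X.st u t).acc (fun a => ∃ x,
      a.2 = .prepare e v i x ∨ a.2 = .prepared e v i x ∨ a.2 = .commit e v i x ∨
      a.2 = .committed e v i x) (fun a => ∃ x, a.2 = .prepare e v i x) (fun a => ∃ x,
      a.2 = .prepared e v i x ∨ a.2 = .commit e v i x ∨
      a.2 = .committed e v i x) (fun a => costBound a.2)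
      fun a _ ⟨x, hx⟩ => hx.imp (⟨x, ·⟩) (⟨x, ·⟩)
    have g2 := sum_filter_or_le (X.st u t).acc (fun a => ∃ x,
      a.2 = .prepared e v i x ∨ a.2 = .commit e v i x ∨
      a.2 = .committed e v i x) (fun a => ∃ x, a.2 = .prepared e v i x) (fun a => ∃ x,
      a.2 = .commit e v i x ∨ a.2 = .committed e v i x) (fun a => costBound a.2)
      fun a _ ⟨x, hx⟩ => hx.imp (⟨x, ·⟩) (⟨x, ·⟩)
    have g3 := sum_filter_or_le (X.st u t).acc (fun a => ∃ x,
      a.2 = .commit e v i x ∨ a.2 = .committed e v i x) (fun a => ∃ x, a.2 = .commit e v i x)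
      (fun a => ∃ x, a.2 = .committed e v i x) (fun a => costBound a.2)
      fun a _ ⟨x, hx⟩ => hx.imp (⟨x, ·⟩) (⟨x, ·⟩)
    split_ifs at h4 h5 ⊢ <;> omega
  have hsent : ∑ m ∈ (X.st u t).sent.filter (ForRequest e v i), computeCost m ≤ 5 := by
    have h0 : ∀ c : Item P → Msg P, (∀ x, ForRequest e v i (c x)) →
        (∀ x x', c x ∈ (X.st u t).sent → c x' ∈ (X.st u t).sent → x = x') →
        ∑ m ∈ (X.st u t).sent.filter (fun m => ∃ x, m = c x), computeCost m ≤ 1 := by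
      intro c hc hinj
      have := sum_filter_le_of_card (X.st u t).sent (fun m => ∃ x, m = c x) computeCost
        (c := 1) (b := 1) (by
          rw [Finset.card_le_one]
          intro a ha b hb
          rw [Finset.mem_filter] at ha hb
          obtain ⟨ha, x, rfl⟩ := ha
          obtain ⟨hb, y, rfl⟩ := hb
          rw [hinj x y ha hb])
        (by
          rintro m - ⟨x, rfl⟩
          exact (computeCost_of_not_epochMsg (hN _ (hc x))).le)
      simpa using this
    have h1 := h0 (.prePrepare e v i) (fun x => ⟨x, by simp⟩) fun x y hx hy => by
      rw [(X.prePrepare_of_sent hu hx).2, (X.prePrepare_of_sent hu hy).2]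
    have h2 := h0 (.prepare e v i) (fun x => ⟨x, by simp⟩) fun x y hx hy => X.prepare_unique hu hx hy
    have h3 := h0 (.prepared e v i) (fun x => ⟨x, by simp⟩) fun x y hx hy =>
      X.prepare_unique hu (X.prepare_of_prepared hf hu hx).2 (X.prepare_of_prepared hf hu hy).2
    have h4 := h0 (.commit e v i) (fun x => ⟨x, by simp⟩) fun x y hx hy => X.commit_unique hf hu hx hy
    have h5 := h0 (.committed e v i) (fun x => ⟨x, by simp⟩) fun x y hx hy =>
      X.commit_unique hf hu (X.commit_of_committed hf hu hx).2 (X.commit_of_committed hf hu hy).2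
    refine (sum_filter_or_le _ _ (fun a => ∃ x, a = .prePrepare e v i x) (fun a => ∃ x,
      a = .prepare e v i x ∨ a = .prepared e v i x ∨ a = .commit e v i x ∨
      a = .committed e v i x) _ fun a _ ⟨x, hx⟩ => hx.imp (⟨x, ·⟩) (⟨x, ·⟩)).trans ?_
    have g1 := sum_filter_or_le (X.st u t).sent (fun a => ∃ x,
      a = .prepare e v i x ∨ a = .prepared e v i x ∨ a = .commit e v i x ∨
      a = .committed e v i x) (fun a => ∃ x, a = .prepare e v i x) (fun a => ∃ x,
      a = .prepared e v i x ∨ a = .commit e v i x ∨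
      a = .committed e v i x) computeCost
      fun a _ ⟨x, hx⟩ => hx.imp (⟨x, ·⟩) (⟨x, ·⟩)
    have g2 := sum_filter_or_le (X.st u t).sent (fun a => ∃ x,
      a = .prepared e v i x ∨ a = .commit e v i x ∨
      a = .committed e v i x) (fun a => ∃ x, a = .prepared e v i x) (fun a => ∃ x,
      a = .commit e v i x ∨ a = .committed e v i x) computeCost
      fun a _ ⟨x, hx⟩ => hx.imp (⟨x, ·⟩) (⟨x, ·⟩)
    have g3 := sum_filter_or_le (X.st u t).sent (fun a => ∃ x,
      a = .commit e v i x ∨ a = .committed e v i x) (fun a => ∃ x, a = .commit e v i x)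
      (fun a => ∃ x, a = .committed e v i x) computeCost
      fun a _ ⟨x, hx⟩ => hx.imp (⟨x, ·⟩) (⟨x, ·⟩)
    omega
  have := X.ucost_le hu (ForRequest e v i) t
  omega

theorem cost_le_of_ucost_le (c : Rep P → ℕ) (h : ∀ u, u ∉ S.byz → X.ucost φ u t ≤ c u) :
    X.cost φ 0 t ≤ ∑ u, c u := by
  rw [X.cost_zero]
  refine (Finset.sum_le_sum fun u hu => h u (Finset.mem_filter.1 hu).2).trans ?_
  exact Finset.sum_le_sum_of_subset (Finset.filter_subset _ _)

theorem cost_forRequest_le (hf : 0 < P.f) (e : ℕ) (v : Rep P) (i t : ℕ) :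
    X.cost (ForRequest e v i) 0 t ≤ 10 * P.n := by
  refine (X.cost_le_of_ucost_le _ fun u hu => X.ucost_forRequest_le hf hu e v i t).trans ?_
  rw [Finset.sum_add_distrib, Finset.sum_const, Finset.card_univ, Fintype.card_fin,
    Finset.sum_ite_eq' Finset.univ v, if_pos (Finset.mem_univ _), smul_eq_mul]
  have : P.n = 3 * P.f + 1 := rfl
  omega

/-! ## Lower bounds from messages sent by many -/

/-- Each pair of a message in `D` and a correct sender is a separate computation of cost at least
one. -/
theorem card_mul_le_cost (D : Finset (Msg P)) (q : ℕ) (hφ : ∀ m ∈ D, φ m)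
    (h : ∀ m ∈ D, q ≤ (Finset.univ.filter fun w => w ∉ S.byz ∧ m ∈ (X.st w t).sent).card) :
    D.card * q ≤ X.cost φ 0 t := by
  rw [X.cost_zero]
  have h1 : ∑ m ∈ D, (Finset.univ.filter fun w => w ∉ S.byz ∧ m ∈ (X.st w t).sent).card ≤
      ∑ u ∈ Finset.univ.filter (fun u => u ∉ S.byz), X.ucost φ u t := by
    simp_rw [Finset.card_filter]
    rw [Finset.sum_comm, Finset.sum_filter]
    refine Finset.sum_le_sum fun u _ => ?_
    by_cases hu : u ∉ S.byz
    · rw [if_pos hu]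
      calc ∑ m ∈ D, (if u ∉ S.byz ∧ m ∈ (X.st u t).sent then 1 else 0)
          = ∑ m ∈ D.filter (fun m => m ∈ (X.st u t).sent), 1 := by
            rw [Finset.sum_filter]; simp [hu]
        _ ≤ ∑ m ∈ (X.st u t).sent.filter φ, 1 := by
            refine Finset.sum_le_sum_of_subset fun m hm => ?_
            rw [Finset.mem_filter] at hm ⊢
            exact ⟨hm.2, hφ m hm.1⟩
        _ ≤ ∑ m ∈ (X.st u t).sent.filter φ, computeCost m :=
            Finset.sum_le_sum fun m _ => one_le_computeCost m
        _ ≤ _ := Nat.le_add_left _ _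
    · simp [hu]
  refine le_trans ?_ h1
  rw [← smul_eq_mul]
  exact Finset.card_nsmul_le_sum _ _ _ h

theorem commit_card_of_committedAt (h : X.CommittedAt e v i x t) :
    P.f + 1 ≤
      (Finset.univ.filter fun w => w ∉ S.byz ∧ Msg.commit e v i x ∈ (X.st w t).sent).card := by
  obtain ⟨u, hu, h⟩ := h
  exact X.correct_card_of_combinable (X.combinable_of_committed hu (X.has_pre h))

theorem le_cost_forRequest (h : X.CommittedAt e v i x t) :
    P.f + 1 ≤ X.cost (ForRequest e v i) 0 t := by
  have := X.card_mul_le_cost (φ := ForRequest e v i) (t := t) {Msg.commit e v i x} (P.f + 1)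
    (by rintro m hm; exact ⟨x, by simp [Finset.mem_singleton.1 hm]⟩) (by simpa using X.commit_card_of_committedAt h)
  simpa using this

/-! ## The cost of an epoch-change -/

theorem card_acc_sender_le (hu : u ∉ S.byz) (C : ℕ → Rep P × Msg P → Prop)
    (hanti : ∀ t a, C (t + 1) a → C t a)
    (hcomp : ∀ t a b, C t a → C t b → a.1 = b.1 → Competes (X.st u t) a b)
    (hcap : ∀ t a, C t a → cap a.2 ≤ 1) (t : ℕ) :
    ((X.st u t).acc.filter (C t)).card ≤ P.n := by
  rw [Finset.card_eq_sum_card_fiberwise (f := Prod.fst) (t := Finset.univ)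
    (fun _ _ => Finset.mem_coe.2 (Finset.mem_univ _))]
  have : ∀ w ∈ (Finset.univ : Finset (Rep P)),
      (((X.st u t).acc.filter (C t)).filter fun a => a.1 = w).card ≤ 1 := by
    intro w _
    rw [Finset.filter_filter]
    have := X.card_acc_filter_le hu (fun t a => C t a ∧ a.1 = w) 1
      (fun t a h => ⟨hanti t a h.1, h.2⟩)
      (fun t a b h h' => hcomp t a b h.1 h'.1 (h.2.trans h'.2.symm))
      (fun t a h => hcap t a h.1) t
    convert this
  refine (Finset.sum_le_card_nsmul _ _ 1 this).trans ?_
  simp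

/-- Byzantine replicas may call for epochs arbitrarily far ahead. Messages of one sender for epochs
above the receiver's `ep` all compete, so among those still ahead at most one per sender has been
processed, however many epochs they name. -/
theorem cost_highEpochChange_le (t : ℕ) :
    X.cost (fun m => ∃ e d, m = .epochChange e d ∧ ∀ u, u ∉ S.byz → (X.st u t).ep < e) 0 t ≤
      P.n * (P.n * (1 + P.n + P.n * (4 * P.k))) := by
  have := X.cost_le_of_ucost_le (t := t)
    (φ := fun m => ∃ e d, m = .epochChange e d ∧ ∀ u, u ∉ S.byz → (X.st u t).ep < e)
    (fun _ => P.n * (1 + P.n + P.n * (4 * P.k))) (fun u hu => by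
      refine (X.ucost_le hu _ t).trans ?_
      rw [Finset.sum_eq_zero (s := Finset.filter _ (X.st u t).sent), add_zero]
      · have h1 := X.card_acc_sender_le hu
          (fun t a => ∃ e d, a.2 = .epochChange e d ∧ (X.st u t).ep < e)
          (by
            rintro t a ⟨e, d, h, h'⟩
            exact ⟨e, d, h, (X.ep_succ_le hu t).trans_lt h'⟩)
          (by
            rintro t ⟨a, _⟩ ⟨b, _⟩ ⟨e, d, rfl, h⟩ ⟨e', d', rfl, h'⟩ h2
            exact ⟨h2, Or.inr ⟨h, h'⟩⟩)
          (by rintro t ⟨a, _⟩ ⟨e, d, rfl, h⟩; simp [cap]) t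
        refine sum_filter_le_of_card _ _ _ (le_trans (Finset.card_le_card ?_) h1) ?_
        · refine Finset.monotone_filter_right _ ?_
          rintro a ha ⟨e, d, h, h'⟩
          exact ⟨e, d, h, h' u hu⟩
        · rintro ⟨a, _⟩ - ⟨e, d, rfl, -⟩
          exact auths_le d
      · rintro m hm
        rw [Finset.mem_filter] at hm
        obtain ⟨hm, e, d, rfl, h⟩ := hm
        obtain ⟨_, _, _, _, _, h1, _⟩ := X.epochChange_of_sent hu hm
        exact absurd (h u hu) (by omega))
  simpa using this

/-- The messages of the reliable broadcast of an epoch-change, as predicates on single messages. -/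
def IsRb (c : ℕ → Finset (Rep P) → Msg P) (e : ℕ) (m : Msg P) : Prop := ∃ J, m = c e J

theorem ucost_forEpochChange_le (hu : u ∉ S.byz) (e t : ℕ) :
    X.ucost (ForEpochChange e) u t ≤ P.n ^ 2 * (13 + 12 * P.k) := by
  -- `A` bounds an epoch-change message, `B` the part of a new-epoch message that does not consist
  -- of such messages.
  set A := 1 + P.n + P.n * (4 * P.k) with hA
  set B := 1 + P.n * (2 * P.k) with hB
  set acc := (X.st u t).acc
  set sent := (X.st u t).sent
  have h1 : ∑ a ∈ acc.filter (fun a => ∃ d, a.2 = .epochChange e d), costBound a.2 ≤ P.n * A := by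
    refine sum_filter_le_of_card _ _ _ (c := P.n) (X.card_acc_sender_le hu
      (fun _ a => ∃ d, a.2 = .epochChange e d) (fun _ _ h => h) ?_ ?_ t) ?_
    · rintro t ⟨a, _⟩ ⟨b, _⟩ ⟨d, rfl⟩ ⟨d', rfl⟩ h2
      exact ⟨h2, Or.inl rfl⟩
    · rintro t ⟨a, _⟩ ⟨d, rfl⟩; simp [cap]
    · rintro ⟨a, _⟩ - ⟨d, rfl⟩
      exact auths_le d
  have h2 : ∑ a ∈ acc.filter (fun a => IsRb .rbInit e a.2), costBound a.2 ≤ 1 * 1 := by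
    refine sum_filter_le_of_card _ _ _ (c := 1) (b := 1) (X.card_acc_filter_le hu
      (fun _ a => IsRb .rbInit e a.2) 1 (fun _ _ h => h) ?_ ?_ t) ?_
    · rintro t ⟨a, _⟩ ⟨b, _⟩ ⟨d, rfl⟩ ⟨d', rfl⟩
      exact rfl
    · rintro t ⟨a, _⟩ ⟨d, rfl⟩; simp [cap]
    · rintro ⟨a, _⟩ - ⟨d, rfl⟩
      exact le_rfl
  have h3 : ∑ a ∈ acc.filter (fun a => IsRb .rbEcho e a.2), costBound a.2 ≤ P.n * 1 := by
    refine sum_filter_le_of_card _ _ _ (c := P.n) (X.card_acc_sender_le hu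
      (fun _ a => IsRb .rbEcho e a.2) (fun _ _ h => h) ?_ ?_ t) ?_
    · rintro t ⟨a, _⟩ ⟨b, _⟩ ⟨d, rfl⟩ ⟨d', rfl⟩ h2
      exact ⟨h2, rfl⟩
    · rintro t ⟨a, _⟩ ⟨d, rfl⟩; simp [cap]
    · rintro ⟨a, _⟩ - ⟨d, rfl⟩
      exact le_rfl
  have h4 : ∑ a ∈ acc.filter (fun a => IsRb .rbReady e a.2), costBound a.2 ≤ P.n * 1 := by
    refine sum_filter_le_of_card _ _ _ (c := P.n) (X.card_acc_sender_le hu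
      (fun _ a => IsRb .rbReady e a.2) (fun _ _ h => h) ?_ ?_ t) ?_
    · rintro t ⟨a, _⟩ ⟨b, _⟩ ⟨d, rfl⟩ ⟨d', rfl⟩ h2
      exact ⟨h2, rfl⟩
    · rintro t ⟨a, _⟩ ⟨d, rfl⟩; simp [cap]
    · rintro ⟨a, _⟩ - ⟨d, rfl⟩
      exact le_rfl
  have h5 : ∑ a ∈ acc.filter (fun a => ∃ V, a.2 = .newEpoch e V), costBound a.2 ≤
      1 * (B + P.n * A) := by
    refine sum_filter_le_of_card _ _ _ (c := 1) (b := B + P.n * A) (X.card_acc_filter_le hu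
      (fun _ a => ∃ J, a.2 = .newEpoch e J) 1 (fun _ _ h => h) ?_ ?_ t) ?_
    · rintro t ⟨a, _⟩ ⟨b, _⟩ ⟨d, rfl⟩ ⟨d', rfl⟩
      exact rfl
    · rintro t ⟨a, _⟩ ⟨d, rfl⟩; simp [cap]
    · rintro ⟨a, _⟩ - ⟨d, rfl⟩
      exact costBound_newEpoch_le e d
  have k0 : ∀ {α : Type} (c : α → Msg P) (b : ℕ), (∀ x, computeCost (c x) ≤ b) →
      (∀ x x', c x ∈ sent → c x' ∈ sent → x = x') →
      ∀ p : Msg P → Prop, (∀ m, p m → ∃ x, m = c x) →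
      ∑ m ∈ sent.filter p, computeCost m ≤ 1 * b := by
    intro α c b hb hinj p hp
    refine sum_filter_le_of_card _ _ _ (c := 1) (b := b) ?_ ?_
    · rw [Finset.card_le_one]
      intro a ha b hb
      rw [Finset.mem_filter] at ha hb
      obtain ⟨x, rfl⟩ := hp _ ha.2
      obtain ⟨y, rfl⟩ := hp _ hb.2
      rw [hinj x y ha.1 hb.1]
    · intro m _ hm
      obtain ⟨x, rfl⟩ := hp m hm
      exact hb x
  have k1 := k0 (.epochChange e) 1 (fun _ => le_rfl) (fun x y hx hy => X.epochChange_unique hu hx hy) (fun m => ∃ d, m = .epochChange e d) fun _ h => h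
  have k2 := k0 (.rbInit e) 1 (fun _ => le_rfl) (fun x y hx hy => by
    have hp : u = S.prim e := by
      obtain ⟨_, -, -, -, h, -⟩ := X.enabled_of_sent hu hx (by simp [IsEpochMsg])
      exact h.2.2.1
    subst hp
    exact X.rbInit_unique hu ((X.has_self_pre hu).2 hx) ((X.has_self_pre hu).2 hy))
    (fun m => IsRb .rbInit e m) fun _ h => h
  have k3 := k0 (.rbEcho e) 1 (fun _ => le_rfl) (fun x y hx hy => X.rbEcho_unique hu hx hy)
    (fun m => IsRb .rbEcho e m) fun _ h => h
  have k4 := k0 (.rbReady e) 1 (fun _ => le_rfl) (fun x y hx hy => X.rbReady_unique hu hu hx hy)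
    (fun m => IsRb .rbReady e m) fun _ h => h
  have k5 := k0 (.newEpoch e) B (fun V => by
    have := openItems_length_le V
    simp only [computeCost]
    omega) (fun x y hx hy => X.newEpoch_unique hu hx hy)
    (fun m => ∃ V, m = .newEpoch e V) fun _ h => h
  have g : ∀ {α : Type} (s : Finset α) (r : α → Msg P) (c : α → ℕ),
      ∑ a ∈ s.filter (fun a => ForEpochChange e (r a)), c a ≤
        ∑ a ∈ s.filter (fun a => ∃ d, r a = .epochChange e d), c a +
        ∑ a ∈ s.filter (fun a => IsRb .rbInit e (r a)), c a +
        ∑ a ∈ s.filter (fun a => IsRb .rbEcho e (r a)), c a +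
        ∑ a ∈ s.filter (fun a => IsRb .rbReady e (r a)), c a +
        ∑ a ∈ s.filter (fun a => ∃ d, r a = .newEpoch e d), c a := by
    intro α s r c
    have := sum_filter_le_sum_sum s (fun a => ForEpochChange e (r a)) (Finset.univ : Finset (Fin 5))
      (fun j a => match j with
        | 0 => ∃ d, r a = .epochChange e d
        | 1 => IsRb .rbInit e (r a)
        | 2 => IsRb .rbEcho e (r a)
        | 3 => IsRb .rbReady e (r a)
        | 4 => ∃ d, r a = .newEpoch e d) c (by
        rintro a - (h | ⟨d, h | h | h⟩ | h)
        · exact ⟨0, Finset.mem_univ _, h⟩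
        · exact ⟨1, Finset.mem_univ _, d, h⟩
        · exact ⟨2, Finset.mem_univ _, d, h⟩
        · exact ⟨3, Finset.mem_univ _, d, h⟩
        · exact ⟨4, Finset.mem_univ _, h⟩)
    simpa [Fin.sum_univ_five] using this
  have g1 := g acc (fun a => a.2) (fun a => costBound a.2)
  have g2 := g sent (fun a => a) computeCost
  have := X.ucost_le hu (ForEpochChange e) t
  have hn : 1 ≤ P.n := Nat.succ_pos _
  -- Processed: nA + 1 + n + n + (B + nA). Sent: four messages of cost one and a new-epoch message
  -- of cost at most B.
  have : X.ucost (ForEpochChange e) u t ≤ 2 * (P.n * A) + 2 * P.n + 2 * B + 5 := by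
    change _ ≤ ∑ a ∈ acc.filter (fun a => ForEpochChange e a.2), costBound a.2 +
      ∑ m ∈ sent.filter (fun m => ForEpochChange e m), computeCost m at this
    omega
  refine this.trans ?_
  rw [hA, hB]
  nlinarith [Nat.zero_le P.k, Nat.mul_le_mul_right P.k (Nat.mul_le_mul hn hn),
    Nat.mul_le_mul_left (P.n * P.k) hn, Nat.mul_le_mul hn hn, Nat.mul_le_mul_left P.n hn]

theorem cost_forEpochChange_le (e t : ℕ) :
    X.cost (ForEpochChange e) 0 t ≤ P.n ^ 3 * (13 + 12 * P.k) := by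
  have := X.cost_le_of_ucost_le (t := t) _ fun u hu => X.ucost_forEpochChange_le hu e t
  refine this.trans (le_of_eq ?_)
  rw [Finset.sum_const, Finset.card_univ, Fintype.card_fin, smul_eq_mul]
  ring

end Execution
end FnF

/-! ### Liveness: delivery, advance through the epochs, synchronization. -/

namespace FnF

variable {P : Params} {S : System P}

theorem correct_others_card (S : System P) (u : Rep P) :
    2 * P.f ≤ (Finset.univ.filter fun w => w ∉ S.byz ∧ w ≠ u).card := by
  have h := correct_card S
  have h1 : (Finset.univ.filter fun w => w ∉ S.byz) ⊆
      insert u (Finset.univ.filter fun w => w ∉ S.byz ∧ w ≠ u) := by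
    intro w hw
    by_cases hwu : w = u <;> simp_all
  have := (Finset.card_le_card h1).trans (Finset.card_insert_le _ _)
  omega

theorem exists_correct (S : System P) : ∃ u, u ∉ S.byz := by
  have h := correct_card S
  obtain ⟨u, hu⟩ := Finset.card_pos.1 (by omega : 0 < (Finset.univ.filter fun w => w ∉ S.byz).card)
  exact ⟨u, by simpa using hu⟩

namespace Execution

variable (X : Execution S) {u v w : Rep P} {t t' s e i : ℕ} {x x' : Item P}

/-! ## Delivery and processing -/

theorem inbox_mono (hu : u ∉ S.byz) (h : t ≤ t') : (X.st u t).inbox ⊆ (X.st u t').inbox := by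
  intro a ha
  rw [X.mem_inbox hu] at ha ⊢
  obtain ⟨s, hs, h'⟩ := ha
  exact ⟨s, by omega, h'⟩

theorem exists_inbox (hu : u ∉ S.byz) (hw : w ∉ S.byz) (hne : w ≠ u) {m}
    (hm : m ∈ (X.st w t).sent) : ∃ s, (w, m) ∈ (X.st u s).inbox := by
  obtain ⟨t', h, h'⟩ := (X.mem_sent hw).1 hm
  obtain ⟨s, -, -, hs⟩ := X.deliv_timely u hu w hw hne t' m h'
  exact ⟨s + 1, (X.mem_inbox hu).2 ⟨s, by omega, hs⟩⟩

theorem inbox_timely (hu : u ∉ S.byz) (hw : w ∉ S.byz) (hne : w ≠ u) {m}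
    (hm : m ∈ (X.st w t).sent) (hs : max t X.gst + P.Δ ≤ s) :
    (w, m) ∈ (X.st u (s + 1)).inbox := by
  obtain ⟨t', h, h'⟩ := (X.mem_sent hw).1 hm
  obtain ⟨s', -, h1, h2⟩ := X.deliv_timely u hu w hw hne t' m h'
  exact (X.mem_inbox hu).2 ⟨s', by omega, h2⟩

/-- Maximality of the accepted set: a relevant message that has arrived is passed over only if its
limit is exhausted. -/
theorem accepted_or_full (hu : u ∉ S.byz) {a} (ha : a ∈ (X.st u (t + 1)).inbox)
    (hR : Relevant S u (X.st u t) a.1 a.2) :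
    a ∈ (X.pre u t).acc ∨
      cap a.2 ≤ ((X.pre u t).acc.filter (Competes (X.st u t) a)).card := by
  by_cases h : a ∈ (X.pre u t).acc
  · exact Or.inl h
  · rw [X.inbox_succ hu] at ha
    exact Or.inr ((X.accepts u hu t).2.2 a ha h hR)

/-- The message may be displaced by another epoch-change message of `w`. That one is for the same
epoch or also lies beyond `ep`, so `w` still counts as a caller. -/
theorem called_of_inbox (hu : u ∉ S.byz) (hne : w ≠ u) {d}
    (hi : (w, Msg.epochChange e d) ∈ (X.st u (t + 1)).inbox) (hd : d.last < e)
    (h : (X.st u t).ep < e ∨ (e = (X.st u t).ep ∧ (X.st u t).cur ≠ (X.st u t).ep)) :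
    ∃ e', (X.st u t).ep ≤ e' ∧ ((X.st u t).ep < e → (X.st u t).ep < e') ∧
      ((X.st u t).ep = e → e' = e) ∧ Called u (X.pre u t) w e' := by
  rcases X.accepted_or_full hu hi ⟨hne, hd, h⟩ with h1 | h1
  · exact ⟨e, by omega, id, fun _ => rfl, hne, d, h1⟩
  · obtain ⟨⟨w', m⟩, hb⟩ := Finset.card_pos.1 (lt_of_lt_of_le Nat.one_pos h1)
    rw [Finset.mem_filter] at hb
    obtain ⟨hb, hc⟩ := hb
    cases m <;> try exact hc.elim
    rename_i e' d'
    obtain ⟨rfl, hc⟩ := hc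
    refine ⟨e', by omega, by omega, by omega, hne, d', hb⟩

theorem called_mono (hu : u ∉ S.byz) (h : t ≤ t') (hc : Called u (X.pre u t) w e) :
    Called u (X.pre u t') w e := by
  obtain ⟨h1, d, h2⟩ := hc
  refine ⟨h1, d, ?_⟩
  rw [X.pre_acc_eq hu] at h2 ⊢
  exact X.acc_mono hu (by omega) h2

theorem ep_ge_of_called (hu : u ∉ S.byz) (hw : w ∉ S.byz) (hc : Called u (X.pre u t) w e) :
    e ≤ (X.st w t).ep := by
  obtain ⟨h1, d, h2⟩ := hc
  obtain ⟨_, _, _, _, _, h, _⟩ := X.epochChange_of_sent hw (X.source_of_has_pre hu (Or.inl h2) hw)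
  exact h

theorem exists_changesTo {s : LState P} (h : P.f + 1 ≤
    (Finset.univ.filter fun w => ∃ e, s.ep < e ∧ Called u s w e).card) :
    ∃ e', ChangesTo S u s t e' := by
  by_cases hc : Calls S u s t
  · exact ⟨_, Or.inl ⟨hc, rfl⟩⟩
  · obtain ⟨w, hw⟩ := Finset.card_pos.1 (lt_of_lt_of_le (Nat.succ_pos _) h)
    simp only [Finset.mem_filter, Finset.mem_univ, true_and] at hw
    obtain ⟨e, he, hw⟩ := hw
    have hne : {e | s.ep < e ∧ ∃ w, Called u s w e}.Nonempty := ⟨e, he, w, hw⟩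
    exact ⟨_, Or.inr ⟨hc, h, Nat.sInf_mem hne, fun b hb => Nat.sInf_le hb⟩⟩

theorem ep_lt_of_exists_changesTo (hu : u ∉ S.byz) (h : ∃ e', ChangesTo S u (X.pre u t) t e')
    (hE : ∀ V, ¬ Enters S u (X.pre u t) V) : (X.st u t).ep < (X.st u (t + 1)).ep := by
  rcases (X.acts_pre hu t).cases with ⟨V, h', _, _⟩ | ⟨e', _, h', _, h0⟩ | ⟨_, h2, _, _⟩
  · exact absurd h' (hE V)
  · rw [h0]
    simpa using ep_lt_of_changesTo h'
  · exact absurd h.choose_spec (h2 _)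

theorem cur_succ_of_enters (hu : u ∉ S.byz) {V} (h : Enters S u (X.pre u t) V) :
    (X.st u (t + 1)).cur = (X.st u t).ep ∧ (X.st u (t + 1)).ep = (X.st u t).ep := by
  rcases (X.acts_pre hu t).cases with ⟨V, h', _, h0⟩ | ⟨e', h1, h', _, h0⟩ | ⟨h1, h2, _, _⟩
  · rw [h0]
    exact ⟨rfl, rfl⟩
  · exact absurd h (h1 V)
  · exact absurd h (h1 V)

theorem stay_state (hu : u ∉ S.byz) (hc : (X.st u (t + 1)).cur = (X.st u t).cur)
    (he : (X.st u (t + 1)).ep = (X.st u t).ep) :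
    (X.st u (t + 1)).hung = (X.st u t).hung ∧ (X.st u (t + 1)).entered = (X.st u t).entered ∧
    (X.st u (t + 1)).fails = (X.st u t).fails ∧
    (X.st u (t + 1)).prog = (fun v =>
      if ∃ i x, (v, Msg.committed (X.st u t).cur v i x) ∈ X.proc u t ∨
          (u = v ∧ Msg.committed (X.st u t).cur v i x ∈ X.out u t)
      then max ((X.st u t).prog v) t else (X.st u t).prog v) ∧
    (X.st u (t + 1)).ecTimer =
      if (X.st u t).ecTimer = none ∧ (X.st u t).cur ≠ (X.st u t).ep ∧
        2 * P.f ≤ (Finset.univ.filter fun w => ∃ e, (X.st u t).ep ≤ e ∧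
          Called u (X.pre u t) w e).card
      then some t else (X.st u t).ecTimer := by
  have h0 := X.out_of_stay hu hc he
  rcases (X.acts_pre hu t).cases with ⟨V, h', _, h⟩ | ⟨e', _, h', _, h⟩ | ⟨h1, h2, h3, h⟩
  · exact absurd h' (h0.1 V)
  · exact absurd h' (h0.2.1 e')
  · refine ⟨?_, ?_, ?_, ?_, ?_⟩ <;> rw [h] <;> rfl

/-! ## Every epoch is reached -/

/-- Only eventual delivery is needed. Inside epoch `m` the epoch timer expires. During the change to
`m` the epoch-change messages of 2f other correct replicas finally arrive and start the epoch-change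
timer, which expires however often it has been doubled. -/
theorem exists_ep_gt (hu : u ∉ S.byz) (m t₀ : ℕ) (h0 : ∀ w, w ∉ S.byz → m ≤ (X.st w t₀).ep) :
    ∃ t, m < (X.st u t).ep := by
  by_contra! hcon
  have hep : ∀ t, t₀ ≤ t → (X.st u t).ep = m := fun t ht =>
    le_antisymm (hcon t) ((h0 u hu).trans (X.ep_mono hu ht))
  by_cases hA : ∃ t₁ ≥ t₀, (X.st u t₁).cur = m
  · obtain ⟨t₁, ht₁, hcur⟩ := hA
    have hc : ∀ t, t₁ ≤ t → (X.st u t).cur = m := fun t ht =>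
      le_antisymm ((X.cur_pos_le hu t).2.trans (hcon t)) (hcur ▸ X.cur_mono hu ht)
    have hent : ∀ j, (X.st u (t₁ + j)).entered = (X.st u t₁).entered := by
      intro j
      induction j with
      | zero => rfl
      | succ j ih =>
        rw [← ih]
        exact (X.stay_state hu (t := t₁ + j)
          ((hc (t₁ + j + 1) (by omega)).trans (hc (t₁ + j) (by omega)).symm)
          ((hep (t₁ + j + 1) (by omega)).trans (hep (t₁ + j) (by omega)).symm)).2.1
    set T := (X.st u t₁).entered + P.T
    have h1 : Calls S u (X.pre u (t₁ + T)) (t₁ + T) := by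
      refine Or.inl ⟨?_, Or.inr (Or.inl ?_)⟩
      · rw [pre_cur, pre_ep, hc _ (by omega), hep _ (by omega)]
      · rw [pre_entered, hent]
        omega
    have h2 := X.ep_lt_of_exists_changesTo hu ⟨_, Or.inl ⟨h1, rfl⟩⟩ (fun V hV => hV.1 (by
      rw [pre_cur, pre_ep, hc _ (by omega), hep _ (by omega)]))
    rw [hep _ (by omega), hep _ (by omega)] at h2
    omega
  · push Not at hA
    have hne : ∀ t, t₀ ≤ t → (X.st u t).cur ≠ (X.st u t).ep := fun t ht => by
      rw [hep t ht]; exact hA t ht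
    have hE : ∀ t, t₀ ≤ t → ∀ V, ¬ Enters S u (X.pre u t) V := fun t ht V hV => by
      have := X.cur_succ_of_enters hu hV
      exact hne (t + 1) (by omega) (this.1.trans this.2.symm)
    have hcurs : ∀ t, t₀ ≤ t → (X.st u (t + 1)).cur = (X.st u t).cur := fun t ht => by
      rcases (X.acts_pre hu t).cases with ⟨V, h', _, h⟩ | ⟨e', _, h', _, h⟩ | ⟨h1, h2, h3, h⟩
      · exact absurd h' (hE t ht V)
      · rw [h]; rfl
      · rw [h]; rfl
    have hst : ∀ t, t₀ ≤ t → _ := fun t ht => X.stay_state hu (hcurs t ht)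
      (by rw [hep t ht]; exact hep _ (by omega))
    -- Epoch 1 is entered without epoch-change messages; the arrival argument needs a later one.
    have hm : 2 ≤ m := by
      have h1 := X.cur_pos_le hu t₀
      have h2 := hne t₀ le_rfl
      rw [hep t₀ le_rfl] at h1 h2
      omega
    have hin : ∀ w, w ∉ S.byz → w ≠ u → ∃ s, ∃ e d, m ≤ e ∧ d.last < e ∧
        (w, Msg.epochChange e d) ∈ (X.st u s).inbox := by
      intro w hw hwu
      obtain ⟨d, hd⟩ := X.exists_epochChange_sent hw (hm.trans (h0 w hw))
      obtain ⟨s, hs⟩ := X.exists_inbox hu hw hwu hd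
      obtain ⟨_, _, _, _, _, _, hl, _⟩ := X.epochChange_of_sent hw hd
      exact ⟨s, _, d, h0 w hw, hl, hs⟩
    choose! sw hsw using hin
    -- The sum serves as a common upper bound of all arrival times.
    set s₁ := t₀ + ∑ w, sw w with hs₁
    have hcard : 2 * P.f ≤ (Finset.univ.filter fun w => ∃ e, (X.st u s₁).ep ≤ e ∧
        Called u (X.pre u s₁) w e).card := by
      refine (correct_others_card S u).trans (Finset.card_le_card fun w hw => ?_)
      simp only [Finset.mem_filter, Finset.mem_univ, true_and] at hw ⊢
      obtain ⟨e, d, h1, h2, h3⟩ := hsw w hw.1 hw.2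
      have h4 : sw w ≤ s₁ + 1 := by
        have := Finset.single_le_sum (f := sw) (fun _ _ => Nat.zero_le _) (Finset.mem_univ w)
        omega
      have h5 := hep s₁ (by omega)
      obtain ⟨e', h6, -, -, h7⟩ := X.called_of_inbox hu hw.2 (X.inbox_mono hu h4 h3) h2 (by
        have := hne s₁ (by omega)
        omega)
      exact ⟨e', h6, h7⟩
    have htimer : ∃ τ, (X.st u (s₁ + 1)).ecTimer = some τ := by
      rw [(hst s₁ (by omega)).2.2.2.2]
      split_ifs with h
      · exact ⟨_, rfl⟩
      · cases hτ : (X.st u s₁).ecTimer with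
        | none => exact absurd ⟨hτ, hne s₁ (by omega), hcard⟩ h
        | some τ => exact ⟨τ, rfl⟩
    obtain ⟨τ, hτ⟩ := htimer
    have hconst : ∀ j, (X.st u (s₁ + 1 + j)).ecTimer = some τ ∧
        (X.st u (s₁ + 1 + j)).fails = (X.st u (s₁ + 1)).fails := by
      intro j
      induction j with
      | zero => exact ⟨hτ, rfl⟩
      | succ j ih =>
        have := hst (s₁ + 1 + j) (by omega)
        rw [ih.1] at this
        refine ⟨?_, ?_⟩
        · have := this.2.2.2.2
          rw [← add_assoc, this]
          simp
        · exact this.2.2.1.trans ih.2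
    set T := τ + P.Te * 2 ^ ((X.st u (s₁ + 1)).fails + 1 - P.f)
    have h1 : Calls S u (X.pre u (s₁ + 1 + T)) (s₁ + 1 + T) := by
      refine Or.inr ⟨hne _ (by omega), τ, ?_, ?_⟩
      · rw [pre_ecTimer, (hconst T).1]
      · rw [pre_fails, (hconst T).2]
        omega
    have h2 := X.ep_lt_of_exists_changesTo hu ⟨_, Or.inl ⟨h1, rfl⟩⟩ (hE _ (by omega))
    rw [hep _ (by omega), hep _ (by omega)] at h2
    omega

theorem exists_ep_ge (m : ℕ) : ∃ t, ∀ u, u ∉ S.byz → m ≤ (X.st u t).ep := by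
  induction m with
  | zero => exact ⟨0, fun _ _ => Nat.zero_le _⟩
  | succ m ih =>
    obtain ⟨t₀, h0⟩ := ih
    have : ∀ u, ∃ t, u ∉ S.byz → m < (X.st u t).ep := fun u => by
      by_cases hu : u ∈ S.byz
      · exact ⟨0, fun h => absurd hu h⟩
      · obtain ⟨t, ht⟩ := X.exists_ep_gt hu m t₀ h0
        exact ⟨t, fun _ => ht⟩
    choose tt htt using this
    refine ⟨∑ u, tt u, fun u hu => (htt u hu).trans_le (X.ep_mono hu ?_)⟩
    exact Finset.single_le_sum (f := tt) (fun _ _ => Nat.zero_le _) (Finset.mem_univ u)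

/-! ## The last moment before an epoch is left -/

/-- The first to leave does not follow f+1 others: a correct one among them would have called for an
epoch up to `m`, and the smallest epoch called for is chosen. So it leaves on its own account, to
the next epoch. -/
theorem calls_of_ep_gt (hu : u ∉ S.byz) {m : ℕ} (h : ∀ w, w ∉ S.byz → (X.st w t).ep ≤ m)
    (hlt : m < (X.st u (t + 1)).ep) :
    (X.st u t).ep = m ∧ (X.st u (t + 1)).ep = m + 1 ∧ Calls S u (X.pre u t) t := by
  have hum := h u hu
  rcases (X.acts_pre hu t).cases with ⟨V, h', _, h0⟩ | ⟨e', _, h', _, h0⟩ | ⟨h1, h2, h3, h0⟩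
  · rw [h0] at hlt
    exact absurd hum (not_le.2 hlt)
  · have h1 : (X.st u (t + 1)).ep = e' := by rw [h0]
    rw [h1] at hlt ⊢
    rcases h' with ⟨hc, he⟩ | ⟨_, hf, hl⟩
    · simp only [pre_ep] at he
      exact ⟨by omega, by omega, hc⟩
    · obtain ⟨w, hw, e, he, hc⟩ := exists_correct_of_quorum S _ hf
      have h2 := X.ep_ge_of_called hu hw hc
      have h3 := hl.2 ⟨he, w, hc⟩
      have := h w hw
      omega
  · rw [h0] at hlt
    exact absurd hum (not_le.2 hlt)

/-- The last time at which no correct replica has left epoch `e`. -/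
noncomputable def last (e : ℕ) : ℕ := sInf {t | ∃ u, u ∉ S.byz ∧ e < (X.st u (t + 1)).ep}

theorem last_spec (e : ℕ) : ∃ u, u ∉ S.byz ∧ e < (X.st u (X.last e + 1)).ep := by
  have : {t | ∃ u, u ∉ S.byz ∧ e < (X.st u (t + 1)).ep}.Nonempty := by
    obtain ⟨t, ht⟩ := X.exists_ep_ge (e + 1)
    obtain ⟨u, hu⟩ := exists_correct S
    exact ⟨t, u, hu, (ht u hu).trans (X.ep_succ_le hu t)⟩
  exact Nat.sInf_mem this

theorem ep_le_of_le_last (he : 1 ≤ e) (ht : t ≤ X.last e) (hu : u ∉ S.byz) :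
    (X.st u t).ep ≤ e := by
  cases t with
  | zero => simpa [X.st_zero u hu, LState.initial]
  | succ t =>
    by_contra! h
    exact Nat.notMem_of_lt_sInf (show t < X.last e from ht) ⟨u, hu, h⟩

theorem lt_of_last_lt (he : 1 ≤ e) (h : e < (X.st u t).ep) (hu : u ∉ S.byz) : X.last e < t := by
  by_contra! h'
  have := X.ep_le_of_le_last he h' hu
  omega

theorem exists_caller (he : 1 ≤ e) : ∃ u, u ∉ S.byz ∧ (X.st u (X.last e)).ep = e ∧
    Calls S u (X.pre u (X.last e)) (X.last e) := by
  obtain ⟨u, hu, h⟩ := X.last_spec e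
  obtain ⟨h1, h2, h3⟩ := X.calls_of_ep_gt hu (fun w hw => X.ep_le_of_le_last he le_rfl hw) h
  exact ⟨u, hu, h1, h3⟩

/-- The first correct replica to pass `e` moves only to `e + 1`, so the front skips no epoch. -/
theorem last_lt_succ (he : 1 ≤ e) : X.last e < X.last (e + 1) := by
  by_contra! h
  obtain ⟨u, hu, h1⟩ := X.last_spec (e + 1)
  obtain ⟨-, h3, -⟩ := X.calls_of_ep_gt hu (fun w hw => X.ep_le_of_le_last he h hw)
    (by omega : e < (X.st u (X.last (e + 1) + 1)).ep)
  omega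

/-- Turns a large epoch number into a late time, which is how GST gets passed. -/
theorem le_last_succ (e : ℕ) : e ≤ X.last (e + 1) := by
  induction e with
  | zero => exact Nat.zero_le _
  | succ e ih =>
    have := X.last_lt_succ (e := e + 1) (by omega)
    omega

/-! ## Synchronization -/

/-- At least `f+1` correct replicas have called for epoch `e` or a later one before time `t`. -/
def Reach (e t : ℕ) : Prop :=
  P.f + 1 ≤ (Finset.univ.filter fun w => w ∉ S.byz ∧ e ≤ (X.st w t).ep).card

variable {X}

theorem Reach.mono (h : X.Reach e t) (ht : t ≤ t') : X.Reach e t' := by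
  refine le_trans h (Finset.card_le_card fun w hw => ?_)
  simp only [Finset.mem_filter, Finset.mem_univ, true_and] at hw ⊢
  exact ⟨hw.1, hw.2.trans (X.ep_mono hw.1 ht)⟩

theorem Reach.exists (h : X.Reach e t) : ∃ w, w ∉ S.byz ∧ e ≤ (X.st w t).ep := by
  obtain ⟨w, hw⟩ := Finset.card_pos.1 (lt_of_lt_of_le (Nat.succ_pos _) h)
  exact ⟨w, by simpa using hw⟩

/-- Two steps, because entering an epoch takes precedence over changing and may use up the first.
Only one epoch is gained for certain, as the smallest one called for is chosen. -/
theorem Reach.catch_up (h : X.Reach e t) (hu : u ∉ S.byz) (hs : max t X.gst + P.Δ ≤ s)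
    (hlt : (X.st u s).ep < e) : (X.st u s).ep < (X.st u (s + 2)).ep := by
  have hcard : P.f + 1 ≤ (Finset.univ.filter fun w => ∃ e, (X.st u s).ep < e ∧
      Called u (X.pre u s) w e).card := by
    refine le_trans h (Finset.card_le_card fun w hw => ?_)
    simp only [Finset.mem_filter, Finset.mem_univ, true_and] at hw ⊢
    obtain ⟨hw, hew⟩ := hw
    have h1 := X.cur_pos_le hu s
    obtain ⟨d, hd⟩ := X.exists_epochChange_sent hw (by omega : 2 ≤ (X.st w t).ep)
    obtain ⟨_, _, _, _, _, _, hl, _⟩ := X.epochChange_of_sent hw hd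
    have hwu : w ≠ u := by
      rintro rfl
      have := X.ep_mono hw (by omega : t ≤ s)
      simp only at this
      omega
    obtain ⟨e', -, h2, -, h3⟩ := X.called_of_inbox hu hwu (X.inbox_timely hu hw hwu hd hs) hl
      (by omega)
    exact ⟨e', h2 (by omega), h3⟩
  by_cases hE : ∃ V, Enters S u (X.pre u s) V
  · obtain ⟨V, hV⟩ := hE
    obtain ⟨h1, h2⟩ := X.cur_succ_of_enters hu hV
    rw [← h2]
    refine X.ep_lt_of_exists_changesTo hu (exists_changesTo ?_) (fun V hV => hV.1 ?_)
    · refine le_trans hcard (Finset.card_le_card fun w hw => ?_)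
      obtain ⟨e', h3, h4⟩ := (Finset.mem_filter.1 hw).2
      refine Finset.mem_filter.2 ⟨Finset.mem_univ _, e', ?_, ?_⟩
      · simpa [h2] using h3
      · exact X.called_mono hu (Nat.le_succ s) h4
    · rw [pre_cur, pre_ep, h1, h2]
  · push Not at hE
    exact (X.ep_lt_of_exists_changesTo hu (exists_changesTo hcard) hE).trans_le
      (X.ep_succ_le hu _)

variable (X)

theorem ep_ge_of_sent_rbReady (hu : u ∉ S.byz) {J} (h : Msg.rbReady e J ∈ (X.st u t).sent) :
    e ≤ (X.st u t).ep := by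
  obtain ⟨t', h1, -, -, h, -⟩ := X.enabled_of_sent hu h (by simp [IsEpochMsg])
  exact h.2.1 ▸ X.ep_mono hu h1.le

/-- Of 2f+1 readies, f+1 are by correct replicas, which send them only after having called for the
epoch. -/
theorem reach_of_rbDelivered (hu : u ∉ S.byz) {J} (h : RBDelivered u (X.pre u t) J) :
    X.Reach (X.st u t).ep t := by
  have h0 : 2 * P.f + 1 ≤ _ := h.2
  have h1 := correct_card_of_quorum S
    (fun w => Has u (X.pre u t) w (Msg.rbReady (X.pre u t).ep J)) (q := P.f + 1) (by omega)
  refine le_trans h1 (Finset.card_le_card fun w hw => ?_)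
  simp only [Finset.mem_filter, Finset.mem_univ, true_and] at hw ⊢
  exact ⟨hw.1, X.ep_ge_of_sent_rbReady hw.1 (X.source_of_has_pre hu hw.2 hw.1)⟩

theorem rbDelivered_pre {J} (h : RBDelivered u (X.st u t) J) : RBDelivered u (X.pre u t) J :=
  ⟨h.1, hasFrom_mono (fun _ => X.has_pre) h.2⟩

theorem rbDelivered_of_enters (hu : u ∉ S.byz) {V} (h : Enters S u (X.pre u t) V) :
    ∃ t' ≤ t, ∃ J, (X.st u t').ep = (X.st u t).ep ∧ RBDelivered u (X.pre u t') J ∧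
      2 * P.f + 1 ≤ J.card ∧ ∀ w, w ∈ J ↔ V w ≠ none := by
  obtain ⟨-, ⟨-, h⟩ | ⟨hp, J, h1, h2, h3, -⟩⟩ := h
  · obtain ⟨t', h1, -, h2⟩ := X.relevant_of_pre_acc hu h
    obtain ⟨-, -, h3, -, -, J, h4, h5, h6⟩ := h2
    exact ⟨t', h1, J, h3.symm, X.rbDelivered_pre h5, h4, h6⟩
  · obtain ⟨t', -, -, -, h4, -⟩ := X.enabled_of_sent hu h1 (by simp [IsEpochMsg])
    exact ⟨t, le_rfl, J, rfl, h2, h4.2.2.2.2.1, h3⟩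

theorem reach_of_enters (hu : u ∉ S.byz) {V} (h : Enters S u (X.pre u t) V) :
    X.Reach (X.st u t).ep t := by
  obtain ⟨t', h1, J, h2, h3, -⟩ := X.rbDelivered_of_enters hu h
  exact (h2 ▸ X.reach_of_rbDelivered hu h3).mono h1

theorem entered_spec (hu : u ∉ S.byz) (h : 2 ≤ (X.st u t).cur) :
    (X.st u t).entered < t ∧
    (X.st u (X.st u t).entered).ep = (X.st u t).cur ∧
    (X.st u ((X.st u t).entered + 1)).cur = (X.st u t).cur ∧
    (∃ V, Enters S u (X.pre u (X.st u t).entered) V ∧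
      (X.st u t).hung = S.hungOf (X.st u t).cur V) ∧
    ∀ v, (X.st u t).entered + 5 * P.Δ ≤ (X.st u t).prog v := by
  induction t with
  | zero => simp [X.st_zero u hu, LState.initial] at h
  | succ t ih =>
    rcases (X.acts_pre hu t).cases with ⟨V, h', _, h0⟩ | ⟨e', _, h', _, h0⟩ | ⟨h1, h2, h3, h0⟩
    · have hc : (X.st u (t + 1)).cur = (X.st u t).ep := by rw [h0]; rfl
      have hn : (X.st u (t + 1)).entered = t := by rw [h0]
      refine ⟨by omega, by rw [hn, hc], by rw [hn], ⟨V, by rw [hn]; exact h', ?_⟩, ?_⟩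
      · rw [hc, h0]; rfl
      · rw [hn, h0]
        exact fun v => le_rfl
    · have hc : (X.st u (t + 1)).cur = (X.st u t).cur := by rw [h0]; rfl
      have hn : (X.st u (t + 1)).entered = (X.st u t).entered := by rw [h0]; rfl
      have hp : (X.st u (t + 1)).prog = (X.st u t).prog := by rw [h0]; rfl
      have hh : (X.st u (t + 1)).hung = (X.st u t).hung := by rw [h0]; rfl
      rw [hc] at h
      rw [hc, hn, hp, hh]
      obtain ⟨i1, i2⟩ := ih h
      exact ⟨by omega, i2⟩
    · have hc : (X.st u (t + 1)).cur = (X.st u t).cur := by rw [h0]; rfl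
      have he : (X.st u (t + 1)).ep = (X.st u t).ep := by rw [h0]; rfl
      obtain ⟨hh, hn, -, hp, -⟩ := X.stay_state hu hc he
      rw [hc] at h
      rw [hc, hn, hp, hh]
      obtain ⟨i1, i2, i3, i4, i5⟩ := ih h
      refine ⟨by omega, i2, i3, i4, fun v => ?_⟩
      have := i5 v
      dsimp only
      split_ifs <;> omega

theorem ecTimer_spec (hu : u ∉ S.byz) {τ} (h : (X.st u t).ecTimer = some τ) :
    τ < t ∧ (X.st u τ).ep = (X.st u t).ep ∧
      2 * P.f ≤ (Finset.univ.filter fun w => ∃ e, (X.st u t).ep ≤ e ∧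
        Called u (X.pre u τ) w e).card := by
  induction t with
  | zero => simp [X.st_zero u hu, LState.initial] at h
  | succ t ih =>
    rcases (X.acts_pre hu t).cases with ⟨V, h', _, h0⟩ | ⟨e', _, h', _, h0⟩ | ⟨h1, h2, h3, h0⟩
    · rw [h0] at h
      simp at h
    · rw [h0] at h
      simp at h
    · have hc : (X.st u (t + 1)).cur = (X.st u t).cur := by rw [h0]; rfl
      have he : (X.st u (t + 1)).ep = (X.st u t).ep := by rw [h0]; rfl
      rw [(X.stay_state hu hc he).2.2.2.2] at h
      rw [he]
      split_ifs at h with hi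
      · obtain rfl := Option.some.inj h
        exact ⟨Nat.lt_succ_self _, rfl, hi.2.2⟩
      · obtain ⟨i1, i2⟩ := ih h
        exact ⟨by omega, i2⟩

/-- The timer starts on 2f other callers. At least f of them are correct, and `u` itself completes
the f+1. -/
theorem reach_of_ecTimer (hu : u ∉ S.byz) {τ} (h : (X.st u t).ecTimer = some τ) :
    X.Reach (X.st u t).ep τ := by
  obtain ⟨h1, h2, h3⟩ := X.ecTimer_spec hu h
  have h4 := correct_card_of_quorum S (fun w => ∃ e, (X.st u t).ep ≤ e ∧
    Called u (X.pre u τ) w e) (q := P.f) (by omega)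
  have h5 : insert u (Finset.univ.filter fun w => w ∉ S.byz ∧ ∃ e, (X.st u t).ep ≤ e ∧
      Called u (X.pre u τ) w e) ⊆
      Finset.univ.filter fun w => w ∉ S.byz ∧ (X.st u t).ep ≤ (X.st w τ).ep := by
    intro w hw
    rw [Finset.mem_insert] at hw
    simp only [Finset.mem_filter, Finset.mem_univ, true_and] at hw ⊢
    rcases hw with rfl | ⟨hw, e, he, hc⟩
    · exact ⟨hu, h2.ge⟩
    · exact ⟨hw, he.trans (X.ep_ge_of_called hu hw hc)⟩
  have h6 := Finset.card_le_card h5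
  rw [Finset.card_insert_of_notMem] at h6
  · unfold Reach
    omega
  · simp only [Finset.mem_filter, not_and]
    rintro - - ⟨e, -, hc⟩
    exact hc.1 rfl

theorem has_ckptCert_of_low {s : LState P} (h : 0 < low S u s v) :
    Has u s v (.ckptCert s.cur v (low S u s v)) :=
  Nat.findGreatest_of_ne_zero (P := fun i => Has u s v (.ckptCert s.cur v i)) rfl h.ne'

theorem low_le_slots {s : LState P} : low S u s v ≤ slots S s v := Nat.findGreatest_le _

theorem le_low {s : LState P} (h : Has u s v (.ckptCert s.cur v i)) (hi : i ≤ slots S s v) :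
    i ≤ low S u s v := Nat.le_findGreatest hi h

theorem cur_leader_of_done (hu : u ∉ S.byz) (hv : v ∉ S.byz) (hi : 1 ≤ i)
    (h : Done S u (X.pre u t) v i) : (X.st u t).cur ≤ (X.st v t).cur := by
  rcases h with h | ⟨x, h⟩
  · have h1 := X.source_of_has_pre hu (has_ckptCert_of_low (lt_of_lt_of_le hi h)) hv
    obtain ⟨t', h2, -, -, h3, -⟩ := X.enabled_of_sent hv h1 (by simp [IsEpochMsg])
    exact h3.2.1.le.trans (X.cur_mono hv h2.le)
  · have h1 := X.source_of_has_pre hu h hv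
    obtain ⟨t', h2, -, -, h3, -⟩ := X.enabled_of_sent hv h1 (by simp [IsEpochMsg])
    exact h3.2.1.le.trans (X.cur_mono hv h2.le)

/-- Why an epoch is left: everything is committed, or a timer of a replica in it has expired, or the
epoch-change timer has. -/
theorem leave_cases (he : 2 ≤ e) :
    (∃ u, u ∉ S.byz ∧ (X.st u (X.last e)).cur = e ∧
      ∀ v i, 1 ≤ i → i ≤ slots S (X.pre u (X.last e)) v → Done S u (X.pre u (X.last e)) v i) ∨
    (∃ u, u ∉ S.byz ∧ (X.st u (X.last e)).cur = e ∧
      ((X.st u (X.last e)).entered + P.T ≤ X.last e ∨ 2 * P.f + 1 ≤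
        (Finset.univ.filter fun v => (X.st u (X.last e)).prog v + P.Tp ≤ X.last e).card)) ∨
    (∃ u, u ∉ S.byz ∧ (X.st u (X.last e)).cur < e ∧ ∃ τ, X.Reach e τ ∧ τ + P.Te ≤ X.last e) := by
  obtain ⟨u, hu, hep, h⟩ := X.exists_caller (by omega : 1 ≤ e)
  rcases h with ⟨h1, h | h | h⟩ | ⟨h1, τ, h2, h3⟩
  · exact Or.inl ⟨u, hu, h1.trans hep, h⟩
  · exact Or.inr (Or.inl ⟨u, hu, h1.trans hep, Or.inl h⟩)
  · exact Or.inr (Or.inl ⟨u, hu, h1.trans hep, Or.inr h⟩)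
  · refine Or.inr (Or.inr ⟨u, hu, ?_, τ, ?_, ?_⟩)
    · have := (X.cur_pos_le hu (X.last e)).2
      simp only [pre_cur, pre_ep] at h1
      omega
    · exact hep ▸ X.reach_of_ecTimer hu h2
    · refine le_trans ?_ h3
      have := Nat.one_le_two_pow (n := (X.pre u (X.last e)).fails + 1 - P.f)
      nlinarith

/-- Every leader has a first local number since `Cmin > 0`, and a correct leader certifies it in
epoch `e` only after entering `e`. -/
theorem cur_eq_of_allDone (hC : 0 < P.Cmin) (he : 2 ≤ e) (hu : u ∉ S.byz)
    (hcur : (X.st u (X.last e)).cur = e)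
    (h : ∀ v i, 1 ≤ i → i ≤ slots S (X.pre u (X.last e)) v → Done S u (X.pre u (X.last e)) v i)
    (hv : v ∉ S.byz) : (X.st v (X.last e)).cur = e := by
  have h1 := X.cur_leader_of_done hu hv le_rfl (h v 1 le_rfl
    ((hC.trans_le (load_ge (S := S) _ v)).trans_le (le_max_left _ _)))
  have h2 := X.ep_le_of_le_last (by omega : 1 ≤ e) le_rfl hv
  have h3 := (X.cur_pos_le hv (X.last e)).2
  omega

theorem entered_le_of_expired (hu : u ∉ S.byz) (he : 2 ≤ e) {D : ℕ} (hT : D ≤ P.T)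
    (hTp : D ≤ P.Tp) (hcur : (X.st u t).cur = e)
    (h : (X.st u t).entered + P.T ≤ s ∨ 2 * P.f + 1 ≤
        (Finset.univ.filter fun v => (X.st u t).prog v + P.Tp ≤ s).card) :
    (X.st u t).entered + D ≤ s := by
  rcases h with h | h
  · omega
  · obtain ⟨v, hv⟩ := Finset.card_pos.1 (lt_of_lt_of_le (Nat.succ_pos _) h)
    have h1 := (X.entered_spec hu (hcur ▸ he)).2.2.2.2 v
    have h2 : (X.st u t).prog v + P.Tp ≤ s := by simpa using hv
    omega

/-- If everything is committed, all correct replicas are in the epoch. Otherwise the expired timer,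
of length at least `D`, was set when f+1 correct replicas had already reached the epoch. -/
theorem gap (hC : 0 < P.Cmin) (he : 2 ≤ e) {D : ℕ} (hT : D ≤ P.T) (hTp : D ≤ P.Tp)
    (hTe : D ≤ P.Te) : (∀ u, u ∉ S.byz → (X.st u (X.last e)).cur = e) ∨
      ∃ s, s + D ≤ X.last e ∧ X.Reach e s := by
  rcases X.leave_cases he with ⟨u, hu, hcur, h⟩ | ⟨u, hu, hcur, h⟩ | ⟨u, hu, -, τ, h1, h2⟩
  · exact Or.inl fun v hv => X.cur_eq_of_allDone hC he hu hcur h hv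
  · refine Or.inr ⟨(X.st u (X.last e)).entered,
      X.entered_le_of_expired hu he hT hTp hcur h, ?_⟩
    obtain ⟨-, h3, -, ⟨V, h4, -⟩, -⟩ := X.entered_spec hu (hcur ▸ he)
    have := X.reach_of_enters hu h4
    rwa [h3, hcur] at this
  · exact Or.inr ⟨τ, by omega, h1⟩

/-- The stretch of length `D` before `last (e + 1)` leaves time for two catch-ups of two steps each
after the delay. The front advances by one epoch and a straggler by two, so the lag decreases. -/
theorem ep_last_succ_ge (hC : 0 < P.Cmin) (he : 1 ≤ e) {D : ℕ} (hT : D ≤ P.T) (hTp : D ≤ P.Tp)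
    (hTe : D ≤ P.Te) (hD : P.Δ + 4 ≤ D) (hg : X.gst + D ≤ X.last (e + 1)) (hu : u ∉ S.byz) :
    min (e + 1) ((X.st u (X.last e)).ep + 2) ≤ (X.st u (X.last (e + 1))).ep := by
  rcases X.gap hC (by omega : 2 ≤ e + 1) hT hTp hTe with h | ⟨s, h1, h2⟩
  · have h1 := h u hu
    have h2 := (X.cur_pos_le hu (X.last (e + 1))).2
    exact (min_le_left _ _).trans (h1.ge.trans h2)
  · set s' := X.last (e + 1) - D with hs'
    have h3 : X.Reach (e + 1) s' := h2.mono (by omega)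
    obtain ⟨w, hw, h4⟩ := h3.exists
    have h5 := X.lt_of_last_lt he (t := s') (lt_of_lt_of_le (Nat.lt_succ_self e) h4) hw
    have m1 : (X.st u (X.last e)).ep ≤ (X.st u (s' + P.Δ)).ep := X.ep_mono hu (by omega)
    have m2 : (X.st u (s' + P.Δ)).ep ≤ (X.st u (s' + P.Δ + 2)).ep := X.ep_mono hu (by omega)
    have m3 : (X.st u (s' + P.Δ + 2)).ep ≤ (X.st u (s' + P.Δ + 2 + 2)).ep :=
      X.ep_mono hu (by omega)
    have m4 : (X.st u (s' + P.Δ + 2 + 2)).ep ≤ (X.st u (X.last (e + 1))).ep :=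
      X.ep_mono hu (by omega)
    have c1 := h3.catch_up hu (s := s' + P.Δ) (by omega)
    have c2 := h3.catch_up hu (s := s' + P.Δ + 2) (by omega)
    omega

/-- Eventually, no correct replica leaves an epoch-change before all have called for it. -/
theorem eventually_sync (hC : 0 < P.Cmin) {D : ℕ} (hT : D ≤ P.T) (hTp : D ≤ P.Tp)
    (hTe : D ≤ P.Te) (hD : P.Δ + 4 ≤ D) :
    ∃ e₀, 1 ≤ e₀ ∧ X.gst ≤ X.last e₀ ∧
      ∀ e ≥ e₀, ∀ u, u ∉ S.byz → (X.st u (X.last e)).ep = e := by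
  -- By `le_last_succ`, every later `last` is then at least `D` after GST.
  set e₁ := X.gst + D + 1 with he₁
  -- The lag left by this bound, `e₁ + j - 2 * j`, is used up at `j = e₁`.
  have key : ∀ u, u ∉ S.byz → ∀ j, min (e₁ + j) (2 * j) ≤ (X.st u (X.last (e₁ + j))).ep := by
    intro u hu j
    induction j with
    | zero => simp
    | succ j ih =>
      have h1 := X.ep_last_succ_ge (e := e₁ + j) hC (by omega) hT hTp hTe hD (by
        have := X.le_last_succ (e₁ + j)
        omega) hu
      rw [← add_assoc]
      omega
  refine ⟨e₁ + e₁, by omega, ?_, fun e he u hu => ?_⟩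
  · have := X.le_last_succ (e₁ + e₁ - 1)
    rw [show e₁ + e₁ - 1 + 1 = e₁ + e₁ by omega] at this
    omega
  · have h1 := key u hu (e - e₁)
    rw [show e₁ + (e - e₁) = e by omega] at h1
    have h2 := X.ep_le_of_le_last (by omega : 1 ≤ e) le_rfl hu
    omega

end Execution
end FnF

namespace FnF

variable {P : Params} {S : System P}

namespace Execution

variable (X : Execution S) {u v w : Rep P} {t t' s e i : ℕ} {x x' : Item P}

/-! ## The least cost of an epoch-change -/

/-- All correct replicas are changing to epoch `e - 1` or in it when the first of them leaves it, and
this happens after GST. -/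
structure SyncAt (e : ℕ) : Prop where
  two_le : 2 ≤ e
  gst_le : X.gst ≤ X.last (e - 1)
  ep_eq : ∀ u, u ∉ S.byz → (X.st u (X.last (e - 1))).ep = e - 1

variable {X}

theorem SyncAt.last_lt (h : X.SyncAt e) (hu : u ∉ S.byz) (he : e ≤ (X.st u t).ep) :
    X.last (e - 1) < t := by
  have := h.two_le
  exact X.lt_of_last_lt (by omega) (by omega) hu

/-- A synchronized replica is at most one epoch behind, so a single catch-up suffices. -/
theorem SyncAt.reach_all (h : X.SyncAt e) (hR : X.Reach e t) (hs : t + P.Δ + 2 ≤ s)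
    (hu : u ∉ S.byz) : e ≤ (X.st u s).ep := by
  obtain ⟨w, hw, hew⟩ := hR.exists
  have h1 := h.last_lt hw hew
  have h2 := h.gst_le
  have h3 := h.ep_eq u hu
  have m1 := X.ep_mono hu (by omega : X.last (e - 1) ≤ t + P.Δ)
  have m2 := X.ep_mono hu (by omega : t + P.Δ ≤ t + P.Δ + 2)
  have m3 := X.ep_mono hu hs
  have c := hR.catch_up hu (s := t + P.Δ) (by omega)
  simp only at m1 m2 m3
  omega

variable (X)

/-- An epoch-change message carries a checkpoint-certificate for each leader besides its signature,
hence `n + 1` authenticators however few local numbers are open. -/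
theorem mul_le_sum_epochChange (Q : Finset (Rep P))
    (h : ∀ w ∈ Q, ∃ d, (w, Msg.epochChange e d) ∈ (X.st u t).acc) :
    Q.card * (P.n + 1) ≤
      ∑ a ∈ (X.st u t).acc.filter (fun a => ∃ d, a.2 = .epochChange e d), costBound a.2 := by
  have hne : Nonempty (ECData P) := ⟨⟨0, fun _ => 0, fun _ _ => none, fun _ _ => none⟩⟩
  choose! d hd using h
  have h1 : Q.card ≤ ((X.st u t).acc.filter (fun a => ∃ d, a.2 = .epochChange e d)).card :=
    Finset.card_le_card_of_injOn (fun w => (w, Msg.epochChange e (d w)))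
      (fun w hw => by
        simp only [Finset.coe_filter, Set.mem_ofPred_eq]
        exact ⟨hd w hw, d w, rfl⟩)
      (fun w _ w' _ h => (Prod.mk.inj h).1)
  refine (Nat.mul_le_mul_right _ h1).trans ?_
  rw [← smul_eq_mul]
  refine Finset.card_nsmul_le_sum _ _ _ ?_
  rintro ⟨a, m⟩ hm
  obtain ⟨-, d, rfl⟩ := Finset.mem_filter.1 hm
  exact le_auths d

/-- The two kinds of verification are disjoint parts of `ucost`. The new-epoch message is charged
with the `acc` of its own time step, on which its cost depends. -/
theorem sum_epochChange_add_newEpoch_le (hu : u ∉ S.byz) {V} (hs : s < t)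
    (hV : (w, Msg.newEpoch e V) ∈ X.proc u s) :
    ∑ a ∈ (X.st u t).acc.filter (fun a => ∃ d, a.2 = .epochChange e d), costBound a.2 +
      verifyCost u (X.pre u s).acc (.newEpoch e V) ≤ X.ucost (ForEpochChange e) u t := by
  unfold ucost
  refine le_trans ?_ (Nat.le_add_right _ _)
  rw [← X.sum_acc hu (fun a => ∃ d, a.2 = .epochChange e d) (fun a => costBound a.2)]
  have h1 : verifyCost u (X.pre u s).acc (.newEpoch e V) ≤ ∑ t' ∈ Finset.range t,
      ∑ a ∈ (X.proc u t').filter (fun a => ∃ V, a.2 = .newEpoch e V),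
        verifyCost u ((X.st u t').acc ∪ X.proc u t') a.2 := by
    refine le_trans ?_ (Finset.single_le_sum (fun _ _ => Nat.zero_le _) (Finset.mem_range.2 hs))
    exact Finset.single_le_sum (f := fun a : Rep P × Msg P =>
      verifyCost u ((X.st u s).acc ∪ X.proc u s) a.2) (fun _ _ => Nat.zero_le _)
      (Finset.mem_filter.2 ⟨hV, V, rfl⟩)
  refine (Nat.add_le_add_left h1 _).trans ?_
  rw [← Finset.sum_add_distrib]
  refine Finset.sum_le_sum fun t' _ => ?_
  have h2 : ∑ a ∈ (X.proc u t').filter (fun a => ∃ d, a.2 = .epochChange e d), costBound a.2 =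
      ∑ a ∈ (X.proc u t').filter (fun a => ∃ d, a.2 = .epochChange e d),
        verifyCost u ((X.st u t').acc ∪ X.proc u t') a.2 := by
    refine Finset.sum_congr rfl ?_
    rintro ⟨a, m⟩ hm
    obtain ⟨-, d, rfl⟩ := Finset.mem_filter.1 hm
    rfl
  rw [h2, ← Finset.sum_union]
  · refine Finset.sum_le_sum_of_subset fun a ha => ?_
    rw [Finset.mem_union, Finset.mem_filter, Finset.mem_filter] at ha
    rw [Finset.mem_filter]
    rcases ha with ⟨h, h'⟩ | ⟨h, h'⟩
    · exact ⟨h, Or.inl h'⟩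
    · exact ⟨h, Or.inr (Or.inr h')⟩
  · refine Finset.disjoint_left.2 ?_
    rintro ⟨a, m⟩ ha hb
    obtain ⟨-, d, rfl⟩ := Finset.mem_filter.1 ha
    obtain ⟨-, V, h⟩ := Finset.mem_filter.1 hb
    simp at h

theorem sum_epochChange_le (hu : u ∉ S.byz) :
    ∑ a ∈ (X.st u t).acc.filter (fun a => ∃ d, a.2 = .epochChange e d), costBound a.2 ≤
      X.ucost (ForEpochChange e) u t := by
  unfold ucost
  refine le_trans ?_ (Nat.le_add_right _ _)
  rw [← X.sum_acc hu (fun a => ∃ d, a.2 = .epochChange e d) (fun a => costBound a.2)]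
  refine Finset.sum_le_sum fun t' _ => ?_
  have h2 : ∑ a ∈ (X.proc u t').filter (fun a => ∃ d, a.2 = .epochChange e d), costBound a.2 =
      ∑ a ∈ (X.proc u t').filter (fun a => ∃ d, a.2 = .epochChange e d),
        verifyCost u ((X.st u t').acc ∪ X.proc u t') a.2 := by
    refine Finset.sum_congr rfl ?_
    rintro ⟨a, m⟩ hm
    obtain ⟨-, d, rfl⟩ := Finset.mem_filter.1 hm
    rfl
  rw [h2]
  refine Finset.sum_le_sum_of_subset fun a ha => ?_
  rw [Finset.mem_filter] at ha ⊢
  exact ⟨ha.1, Or.inl ha.2⟩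

/-- Entering rests on the epoch-change messages of 2f others. Each has been verified on its own
arrival or as part of the new-epoch message, where exactly those missing from `acc` are charged. -/
theorem le_ucost_of_enters (hu : u ∉ S.byz) {V} (h : Enters S u (X.pre u s) V) (hs : s < t) :
    2 * P.f * (P.n + 1) ≤ X.ucost (ForEpochChange (X.st u s).ep) u t := by
  obtain ⟨-, -, J, -, -, hJ, hJV⟩ := X.rbDelivered_of_enters hu h
  have hJu : 2 * P.f ≤ (J.erase u).card := by
    have := Finset.pred_card_le_card_erase (s := J) (a := u)
    omega
  have hJd : ∀ w ∈ J.erase u, w ≠ u ∧ ∃ d, V w = some d := fun w hw => by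
    rw [Finset.mem_erase] at hw
    exact ⟨hw.1, Option.ne_none_iff_exists'.1 ((hJV w).1 hw.2)⟩
  obtain ⟨-, ⟨hp, h⟩ | ⟨hp, J', -, -, hJ'V, hV⟩⟩ := h
  · obtain ⟨s', hs', hV, -⟩ := X.relevant_of_pre_acc hu h
    simp only [pre_ep] at hV
    set e := (X.st u s).ep
    set acc := (X.pre u s').acc with hacc
    refine le_trans ?_ (X.sum_epochChange_add_newEpoch_le hu (by omega : s' < t) hV)
    -- `Q`: verified on arrival. `Q'`: verified within the new-epoch message.
    set Q := (J.erase u).filter fun w => ∃ d, V w = some d ∧ (w, Msg.epochChange e d) ∈ acc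
    set Q' := (J.erase u).filter fun w => ¬ ∃ d, V w = some d ∧ (w, Msg.epochChange e d) ∈ acc
    have hQ : Q.card + Q'.card = (J.erase u).card := Finset.card_filter_add_card_filter_not _
    have h1 : Q.card * (P.n + 1) ≤ _ := X.mul_le_sum_epochChange (u := u) (t := t) (e := e) Q
      fun w hw => by
        obtain ⟨d, -, hd⟩ := (Finset.mem_filter.1 hw).2
        rw [hacc, X.pre_acc_eq hu] at hd
        exact ⟨d, X.acc_mono hu (by omega) hd⟩
    have h2 : Q'.card * (P.n + 1) ≤ verifyCost u acc (.newEpoch e V) := by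
      simp only [verifyCost]
      refine le_trans ?_ (Nat.le_add_left _ _)
      rw [← smul_eq_mul]
      refine le_trans ?_ (Finset.sum_le_sum_of_subset (Finset.subset_univ Q'))
      refine Finset.card_nsmul_le_sum _ _ _ fun w hw => ?_
      obtain ⟨hw, hn⟩ := Finset.mem_filter.1 hw
      obtain ⟨hwu, d, hd⟩ := hJd w hw
      rw [if_pos hwu, hd, Option.map_some, Option.getD_some, if_neg (fun h => hn ⟨d, hd, h⟩)]
      exact le_auths d
    calc 2 * P.f * (P.n + 1) ≤ (Q.card + Q'.card) * (P.n + 1) :=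
          Nat.mul_le_mul_right _ (by omega)
      _ ≤ _ := by rw [add_mul]; exact Nat.add_le_add h1 h2
  · refine le_trans ?_ (X.sum_epochChange_le hu)
    refine (Nat.mul_le_mul_right _ hJu).trans (X.mul_le_sum_epochChange _ fun w hw => ?_)
    obtain ⟨hwu, d, hd⟩ := hJd w hw
    have := (has_other hwu).1 (hV w d hd)
    rw [X.pre_acc_eq hu] at this
    exact ⟨d, X.acc_mono hu (by omega) this⟩

/-- A replica that has entered has paid by `le_ucost_of_enters`. One that is still changing at time
`q` has received the messages of 2f other correct replicas. Hence unsuccessful epoch-changes cost as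
much as successful ones. -/
theorem le_ucost_forEpochChange (hsync : X.SyncAt e) (hC : 0 < P.Cmin) {D : ℕ} (hT : D ≤ P.T)
    (hTp : D ≤ P.Tp) (hTe : D ≤ P.Te) (hD : 2 * P.Δ + 4 ≤ D) (hu : u ∉ S.byz) :
    2 * P.f * (P.n + 1) ≤ X.ucost (ForEpochChange e) u (X.last e) := by
  have he := hsync.two_le
  have hent : ∀ t ≤ X.last e, (X.st u t).cur = e →
      2 * P.f * (P.n + 1) ≤ X.ucost (ForEpochChange e) u (X.last e) := by
    intro t ht hcur
    obtain ⟨h1, h2, -, ⟨V, h3, -⟩, -⟩ := X.entered_spec hu (hcur ▸ he)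
    have := X.le_ucost_of_enters hu h3 (t := X.last e) (by omega)
    rwa [h2, hcur] at this
  rcases X.gap hC he hT hTp hTe with h | ⟨s, h1, h2⟩
  · exact hent _ le_rfl (h u hu)
  · obtain ⟨w₀, hw₀, h3⟩ := h2.exists
    have h4 := hsync.last_lt hw₀ h3
    have h5 := hsync.gst_le
    have hep : ∀ w, w ∉ S.byz → ∀ r, s + P.Δ + 2 ≤ r → r ≤ X.last e → (X.st w r).ep = e :=
      fun w hw r hr hr' => le_antisymm (X.ep_le_of_le_last (by omega) hr' hw)
        (hsync.reach_all h2 hr hw)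
    -- `Δ + 2` until all correct replicas have called for `e`, then `Δ` for their messages.
    set q := s + 2 * P.Δ + 2 with hq
    by_cases hcur : (X.st u q).cur = e
    · exact hent q (by omega) hcur
    · refine le_trans ?_ (X.sum_epochChange_le hu)
      refine (Nat.mul_le_mul_right _ (correct_others_card S u)).trans
        (X.mul_le_sum_epochChange _ fun w hw => ?_)
      obtain ⟨hw, hwu⟩ := (Finset.mem_filter.1 hw).2
      have h6 := hep w hw (s + P.Δ + 2) le_rfl (by omega)
      obtain ⟨d, hd⟩ := X.exists_epochChange_sent hw (h6.symm ▸ he)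
      rw [h6] at hd
      obtain ⟨_, _, _, _, _, _, hl, _⟩ := X.epochChange_of_sent hw hd
      have h7 := hep u hu q (by omega) (by omega)
      obtain ⟨e', -, -, h8, -, d', h9⟩ := X.called_of_inbox hu hwu
        (X.inbox_timely hu hw hwu hd (s := q) (by omega)) hl (Or.inr ⟨h7.symm, by omega⟩)
      rw [h8 h7, X.pre_acc_eq hu] at h9
      exact ⟨d', X.acc_mono hu (by omega) h9⟩

theorem le_cost_forEpochChange (hsync : X.SyncAt e) (hC : 0 < P.Cmin) {D : ℕ} (hT : D ≤ P.T)
    (hTp : D ≤ P.Tp) (hTe : D ≤ P.Te) (hD : 2 * P.Δ + 4 ≤ D) :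
    (2 * P.f + 1) * (2 * P.f * (P.n + 1)) ≤ X.cost (ForEpochChange e) 0 (X.last e) := by
  rw [X.cost_zero]
  refine (Nat.mul_le_mul_right _ (correct_card S)).trans ?_
  rw [← smul_eq_mul]
  exact Finset.card_nsmul_le_sum _ _ _ fun u hu =>
    X.le_ucost_forEpochChange hsync hC hT hTp hTe hD (Finset.mem_filter.1 hu).2

end Execution
end FnF

namespace FnF

variable {P : Params} {S : System P}

namespace Execution

variable (X : Execution S) {u v w : Rep P} {t t' s b e i : ℕ} {x x' : Item P}

/-! ## Epoch-changes under a correct primary -/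

/-- With cap one, a message can be passed over only for a competitor; if the sole possible
competitor is the message itself, it is accepted. -/
theorem mem_pre_acc_of_inbox (hu : u ∉ S.byz) {m : Msg P}
    (hi : (w, m) ∈ (X.st u (t + 1)).inbox) (hR : Relevant S u (X.st u t) w m) (hcap : cap m = 1)
    (huniq : ∀ b ∈ (X.pre u t).acc, Competes (X.st u t) (w, m) b → b = (w, m)) :
    (w, m) ∈ (X.pre u t).acc := by
  rcases X.accepted_or_full hu hi hR with h | h
  · exact h
  · rw [hcap] at h
    obtain ⟨b, hb⟩ := Finset.card_pos.1 (lt_of_lt_of_le Nat.one_pos h)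
    rw [Finset.mem_filter] at hb
    exact huniq b hb.1 hb.2 ▸ hb.1

theorem hung_spec (hu : u ∉ S.byz) (h : 2 ≤ (X.st u t).cur) :
    ∃ V, (X.st u t).hung = S.hungOf (X.st u t).cur V ∧
      Has u (X.st u t) (S.prim (X.st u t).cur) (.newEpoch (X.st u t).cur V) := by
  induction t with
  | zero => simp [X.st_zero u hu, LState.initial] at h
  | succ t ih =>
    rcases (X.acts_pre hu t).cases with ⟨V, h', ho, h0⟩ | ⟨e', _, h', _, h0⟩ | ⟨h1, h2, h3, h0⟩
    · have hc : (X.st u (t + 1)).cur = (X.st u t).ep := by rw [h0]; rfl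
      have hh : (X.st u (t + 1)).hung = S.hungOf (X.st u t).ep V := by rw [h0]; rfl
      rw [hc, hh]
      refine ⟨V, rfl, ?_⟩
      rcases h'.2 with ⟨-, h4⟩ | ⟨h4, -⟩
      · rw [X.pre_acc_eq hu] at h4
        exact Or.inl h4
      · refine Or.inr ⟨h4.symm, ?_⟩
        rw [X.sent_succ hu, ho, if_pos h4]
        exact Finset.mem_union_right _ (Finset.mem_singleton_self _)
    all_goals
      have hc : (X.st u (t + 1)).cur = (X.st u t).cur := by rw [h0]; rfl
      have hh : (X.st u (t + 1)).hung = (X.st u t).hung := by rw [h0]; rfl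
      rw [hc] at h ⊢
      rw [hh]
      obtain ⟨V, i1, i2⟩ := ih h
      exact ⟨V, i1, X.has_mono hu (Nat.le_succ t) i2⟩

theorem prim_sent_newEpoch (he : 2 ≤ e) (hp : S.prim e ∉ S.byz) (hu : u ∉ S.byz)
    (hcur : (X.st u t).cur = e) : ∃ V, (X.st u t).hung = S.hungOf e V ∧
      Msg.newEpoch e V ∈ (X.st (S.prim e) t).sent := by
  obtain ⟨V, h1, h2⟩ := X.hung_spec hu (hcur ▸ he)
  rw [hcur] at h1 h2
  exact ⟨V, h1, X.source_of_has hu h2 hp⟩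

theorem cur_prim_ge (he : 2 ≤ e) (hp : S.prim e ∉ S.byz) (hu : u ∉ S.byz)
    (hcur : (X.st u t).cur = e) : e ≤ (X.st (S.prim e) t).cur := by
  obtain ⟨V, -, h⟩ := X.prim_sent_newEpoch he hp hu hcur
  obtain ⟨_, _, _, _, _, _, _, h, _⟩ := X.newEpoch_of_sent hp h
  exact h

/-- A correct primary sends one new-epoch message, and the hanging items are a function of it. -/
theorem hung_eq (he : 2 ≤ e) (hp : S.prim e ∉ S.byz) (hu : u ∉ S.byz) (hw : w ∉ S.byz)
    (hcur : (X.st u t).cur = e) (hcur' : (X.st w t').cur = e) :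
    (X.st u t).hung = (X.st w t').hung := by
  obtain ⟨V, h1, h2⟩ := X.prim_sent_newEpoch he hp hu hcur
  obtain ⟨V', h1', h2'⟩ := X.prim_sent_newEpoch he hp hw hcur'
  rw [h1, h1', X.newEpoch_unique hp (X.sent_mono hp (le_max_left t t') h2)
    (X.sent_mono hp (le_max_right t t') h2')]

theorem rbReady_of_cur (he : 2 ≤ e) (hu : u ∉ S.byz) (hcur : (X.st u t).cur = e) :
    ∃ J, Msg.rbReady e J ∈ (X.st u t).sent := by
  obtain ⟨h1, h2, -, ⟨V, h3, -⟩, -⟩ := X.entered_spec hu (hcur ▸ he)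
  obtain ⟨t', h4, J, h5, h6, -⟩ := X.rbDelivered_of_enters hu h3
  have h7 := h6.1
  rw [pre_ep, h5, h2, hcur] at h7
  exact ⟨J, X.sent_mono hu (by omega) h7⟩

theorem mem_sent_succ_of_enabled (hu : u ∉ S.byz)
    (hc : (X.st u (t + 1)).cur = (X.st u t).cur) (he : (X.st u (t + 1)).ep = (X.st u t).ep)
    {m : Msg P} (h : m ∉ (X.st u t).sent → Enabled S u (X.pre u t) m) :
    m ∈ (X.st u (t + 1)).sent := by
  rw [X.sent_succ hu, Finset.mem_union]
  by_cases hm : m ∈ (X.st u t).sent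
  · exact Or.inl hm
  · exact Or.inr (((X.out_of_stay hu hc he).2.2 m).2 ⟨hm, h hm⟩)

theorem has_rbReady_of_sent (hu : u ∉ S.byz) (hw : w ∉ S.byz) {J}
    (h : Msg.rbReady e J ∈ (X.st w s).sent) (hs : max s X.gst + P.Δ ≤ t)
    (hep : (X.st u t).ep = e) (hcur : (X.st u t).cur ≠ e) (hst : s ≤ t) :
    Has u (X.pre u t) w (.rbReady e J) := by
  by_cases hwu : w = u
  · subst hwu
    exact Or.inr ⟨rfl, X.sent_mono hw hst h⟩
  · refine Or.inl (X.mem_pre_acc_of_inbox hu (X.inbox_timely hu hw hwu h hs)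
      ⟨hwu, by omega, hep.symm⟩ rfl ?_)
    rintro ⟨w', m⟩ hb hc
    cases m <;> try exact hc.elim
    obtain ⟨rfl, rfl⟩ := hc
    rw [X.rbReady_unique hw hw h (X.source_of_has_pre hu (Or.inl hb) hw)]

theorem has_rbEcho_of_sent (hu : u ∉ S.byz) (hw : w ∉ S.byz) {J}
    (h : Msg.rbEcho e J ∈ (X.st w s).sent) (hs : max s X.gst + P.Δ ≤ t)
    (hep : (X.st u t).ep = e) (hcur : (X.st u t).cur ≠ e) (hst : s ≤ t) :
    Has u (X.pre u t) w (.rbEcho e J) := by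
  by_cases hwu : w = u
  · subst hwu
    exact Or.inr ⟨rfl, X.sent_mono hw hst h⟩
  · refine Or.inl (X.mem_pre_acc_of_inbox hu (X.inbox_timely hu hw hwu h hs)
      ⟨hwu, by omega, hep.symm⟩ rfl ?_)
    rintro ⟨w', m⟩ hb hc
    cases m <;> try exact hc.elim
    obtain ⟨rfl, rfl⟩ := hc
    rw [X.rbEcho_unique hw (X.sent_mono hw hst h) (X.source_of_has_pre hu (Or.inl hb) hw)]

theorem has_rbInit_of_sent (hu : u ∉ S.byz) (hp : S.prim e ∉ S.byz) {J}
    (h : Msg.rbInit e J ∈ (X.st (S.prim e) s).sent) (hs : max s X.gst + P.Δ ≤ t)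
    (hep : (X.st u t).ep = e) (hcur : (X.st u t).cur ≠ e) (hst : s ≤ t) :
    Has u (X.pre u t) (S.prim e) (.rbInit e J) := by
  by_cases hwu : S.prim e = u
  · refine Or.inr ⟨hwu, ?_⟩
    rw [hwu] at h
    exact X.sent_mono hu hst h
  · have hJ : 2 * P.f + 1 ≤ J.card := by
      obtain ⟨_, -, -, -, h, -⟩ := X.enabled_of_sent hp h (by simp [IsEpochMsg])
      exact h.2.2.2.2.1
    refine Or.inl (X.mem_pre_acc_of_inbox hu (X.inbox_timely hu hp hwu h hs)
      ⟨hwu, by omega, hep.symm, rfl, hJ⟩ rfl ?_)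
    rintro ⟨w', m⟩ hb hc
    cases m <;> try exact hc.elim
    obtain rfl := hc
    obtain ⟨t', ht', -, hR⟩ := X.relevant_of_pre_acc hu hb
    obtain rfl := hR.2.2.2.1
    have h2 := X.source_of_has_pre hu (Or.inl hb) hp
    rw [X.rbInit_unique hp ((X.has_self_pre hp).2 (X.sent_mono hp hst h))
      ((X.has_self_pre hp).2 h2)]

variable {X}

/-- If a correct primary has entered its epoch, all correct replicas follow. -/
theorem SyncAt.cur_eq_of_prim (h : X.SyncAt e) (hp : S.prim e ∉ S.byz)
    (hb : e ≤ (X.st (S.prim e) b).cur) (hs : b + 2 * P.Δ + 5 ≤ s) (hZ : s ≤ X.last e)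
    (hu : u ∉ S.byz) : (X.st u s).cur = e := by
  have he := h.two_le
  have hepZ : ∀ w, w ∉ S.byz → ∀ r ≤ X.last e, (X.st w r).ep ≤ e := fun w hw r hr =>
    X.ep_le_of_le_last (by omega) hr hw
  have hcurZ : ∀ w, w ∉ S.byz → ∀ r ≤ X.last e, (X.st w r).cur ≤ e := fun w hw r hr =>
    (X.cur_pos_le hw r).2.trans (hepZ w hw r hr)
  have hbcur : (X.st (S.prim e) b).cur = e := le_antisymm (hcurZ _ hp b (by omega)) hb
  have hgb : X.gst < b := by
    have h1 := h.last_lt hp (t := b) (hb.trans (X.cur_pos_le hp b).2)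
    have h2 := h.gst_le
    omega
  obtain ⟨V, -, hV⟩ := X.prim_sent_newEpoch he hp hp hbcur
  obtain ⟨E, hE, hepE, -, -, -, hEnt, -, -, -⟩ := X.newEpoch_of_sent hp hV
  obtain ⟨-, ⟨hne, -⟩ | ⟨-, J, hJ1, hJ2, hJ3, hJ4⟩⟩ := hEnt
  · exact absurd (by rw [pre_ep, hepE]) hne
  rw [pre_ep, hepE] at hJ1 hJ4
  have hJcard : 2 * P.f + 1 ≤ J.card := by
    obtain ⟨_, -, -, -, h, -⟩ := X.enabled_of_sent hp hJ1 (by simp [IsEpochMsg])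
    exact h.2.2.2.2.1
  -- Delivery at the primary shows f+1 correct readies. They draw all others into the epoch-change
  -- and then, by amplification, into sending ready.
  have hready : P.f + 1 ≤ (Finset.univ.filter fun w => w ∉ S.byz ∧
      Msg.rbReady e J ∈ (X.st w b).sent).card := by
    have h0 : 2 * P.f + 1 ≤ _ := hJ2.2
    rw [pre_ep, hepE] at h0
    refine (correct_card_of_quorum S
      (fun w => Has (S.prim e) (X.pre (S.prim e) E) w (Msg.rbReady e J)) (q := P.f + 1)
      (by omega)).trans (Finset.card_le_card fun w hw => ?_)
    simp only [Finset.mem_filter, Finset.mem_univ, true_and] at hw ⊢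
    exact ⟨hw.1, X.sent_mono hw.1 hE.le (X.source_of_has_pre hp hw.2 hw.1)⟩
  have hR : X.Reach e b := by
    refine le_trans hready (Finset.card_le_card fun w hw => ?_)
    simp only [Finset.mem_filter, Finset.mem_univ, true_and] at hw ⊢
    exact ⟨hw.1, X.ep_ge_of_sent_rbReady hw.1 hw.2⟩
  have hep : ∀ w, w ∉ S.byz → ∀ r, b + P.Δ + 2 ≤ r → r ≤ X.last e → (X.st w r).ep = e :=
    fun w hw r hr hr' => le_antisymm (hepZ w hw r hr') (h.reach_all hR hr hw)
  obtain ⟨w₁, hw₁⟩ := Finset.card_pos.1 (lt_of_lt_of_le (Nat.succ_pos _) hready)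
  simp only [Finset.mem_filter, Finset.mem_univ, true_and] at hw₁
  set s₁ := b + P.Δ + 2 with hs₁
  have hall : ∀ w, w ∉ S.byz → Msg.rbReady e J ∈ (X.st w (s₁ + 1)).sent := by
    intro w hw
    by_cases hcur : (X.st w (s₁ + 1)).cur = e
    · obtain ⟨J', hJ'⟩ := X.rbReady_of_cur he hw hcur
      rwa [X.rbReady_unique hw₁.1 hw hw₁.2 hJ']
    · have h1 := hcurZ w hw (s₁ + 1) (by omega)
      have h2 := X.cur_succ_le hw s₁
      have h3 : (X.st w (s₁ + 1)).cur = (X.st w s₁).cur := by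
        rcases (X.acts_pre hw s₁).cases with ⟨V, h', _, h0⟩ | ⟨e', _, h', _, h0⟩ | ⟨_, _, _, h0⟩
        · exfalso
          have := (X.cur_succ_of_enters hw h').1
          rw [hep w hw s₁ (by omega) (by omega)] at this
          exact hcur this
        · rw [h0]; rfl
        · rw [h0]; rfl
      refine X.mem_sent_succ_of_enabled hw h3 ?_ fun hn => ?_
      · rw [hep w hw s₁ (by omega) (by omega), hep w hw (s₁ + 1) (by omega) (by omega)]
      · have hep1 := hep w hw s₁ (by omega) (by omega)
        refine ⟨?_, hep1.symm, Or.inr ?_, fun J' hJ' => ?_⟩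
        · rw [pre_cur, pre_ep, hep1]
          omega
        · refine le_trans hready (Finset.card_le_card fun z hz => ?_)
          simp only [Finset.mem_filter, Finset.mem_univ, true_and] at hz ⊢
          exact X.has_rbReady_of_sent hw hz.1 hz.2 (by omega) hep1 (by omega) (by omega)
        · have := X.rbReady_unique hw₁.1 hw hw₁.2 hJ'
          subst this
          exact hn hJ'
  by_contra hcur
  set s₂ := s₁ + 1 + P.Δ with hs₂
  have hlt : ∀ r ≤ s, (X.st u r).cur < e := fun r hr => by
    have h1 := hcurZ u hu s hZ
    have h2 := X.cur_mono hu hr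
    simp only at h2
    omega
  have hup : S.prim e ≠ u := by
    rintro rfl
    have := hlt b (by omega)
    omega
  -- Needed at the beginning of step `s₂ + 1`, because relevance of the new-epoch message is judged
  -- in that state.
  have hdel : RBDelivered u (X.st u (s₂ + 1)) J := by
    have h0 := hep u hu (s₂ + 1) (by omega) (by omega)
    refine ⟨?_, ?_⟩
    · rw [h0]
      exact X.sent_mono hu (by omega) (hall u hu)
    · rw [h0]
      refine quorum_of_correct S _ fun w hw => X.has_succ_of_pre hu ?_
      exact X.has_rbReady_of_sent hu hw (hall w hw) (by omega)
        (hep u hu s₂ (by omega) (by omega)) (hlt s₂ (by omega)).ne (by omega)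
  have hepu := hep u hu (s₂ + 1) (by omega) (by omega)
  have hacc : (S.prim e, Msg.newEpoch e V) ∈ (X.pre u (s₂ + 1)).acc := by
    refine X.mem_pre_acc_of_inbox hu (X.inbox_timely hu hp hup hV (by omega)) ?_ rfl ?_
    · refine ⟨hup, ?_, hepu.symm, rfl, fun w d hd => ?_, J, hJcard, hdel, hJ3⟩
      · rw [hepu]
        exact (hlt _ (by omega)).ne
      · have hH := hJ4 w d hd
        rcases hH with hH | ⟨-, hH⟩
        · obtain ⟨_, -, -, hH⟩ := X.relevant_of_pre_acc hp hH
          exact hH.2.1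
        · obtain ⟨_, _, _, _, _, _, hl, _⟩ := X.epochChange_of_sent hp hH
          exact hl
    · rintro ⟨w', m⟩ hb hc
      cases m <;> try exact hc.elim
      obtain rfl := hc
      obtain ⟨t', ht', -, hR⟩ := X.relevant_of_pre_acc hu hb
      obtain rfl := hR.2.2.2.1
      have h2 := X.source_of_has_pre hu (Or.inl hb) hp
      rw [X.newEpoch_unique hp (X.sent_mono hp (by omega : b ≤ s₂ + 1) hV) h2]
  have hEn : Enters S u (X.pre u (s₂ + 1)) V := by
    refine ⟨?_, Or.inl ⟨?_, ?_⟩⟩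
    · rw [pre_cur, pre_ep, hepu]
      exact (hlt _ (by omega)).ne
    · rw [pre_ep, hepu]
      exact hup.symm
    · rwa [pre_ep, hepu]
  have h1 := (X.cur_succ_of_enters hu hEn).1
  rw [hepu] at h1
  have := hlt (s₂ + 1 + 1) (by omega)
  omega

/-- A correct primary enters its epoch soon after `f+1` correct replicas have called for it. -/
theorem SyncAt.prim_enters (h : X.SyncAt e) (hp : S.prim e ∉ S.byz) (hR : X.Reach e s)
    (hZ : s + 5 * P.Δ + 6 ≤ X.last e) :
    e ≤ (X.st (S.prim e) (s + 5 * P.Δ + 6)).cur := by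
  have he := h.two_le
  by_contra! hcon
  set p := S.prim e with hpdef
  set F := s + 5 * P.Δ + 6 with hF
  obtain ⟨w₀, hw₀, hew₀⟩ := hR.exists
  have hgs : X.gst < s := by
    have h1 := h.last_lt hw₀ hew₀
    have h2 := h.gst_le
    omega
  -- Nobody enters before the primary. As long as it has not entered, all correct replicas stay out
  -- of the epoch, so the broadcast can go on.
  have hcur : ∀ w, w ∉ S.byz → ∀ r ≤ F, (X.st w r).cur < e := by
    intro w hw r hr
    have h1 := (X.cur_pos_le hw r).2.trans (X.ep_le_of_le_last (e := e) (by omega) (by omega) hw)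
    refine lt_of_le_of_ne h1 fun h2 => ?_
    have h3 : e ≤ (X.st p r).cur := X.cur_prim_ge he hp hw h2
    have h4 := X.cur_mono hp hr
    simp only at h4
    omega
  have hep : ∀ w, w ∉ S.byz → ∀ r, s + P.Δ + 2 ≤ r → r ≤ F → (X.st w r).ep = e :=
    fun w hw r hr hr' => le_antisymm (X.ep_le_of_le_last (e := e) (by omega) (by omega) hw)
      (h.reach_all hR hr hw)
  have hcurs : ∀ w, w ∉ S.byz → ∀ r, s + P.Δ + 2 ≤ r → r < F →
      (X.st w (r + 1)).cur = (X.st w r).cur := by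
    intro w hw r hr hr'
    rcases (X.acts_pre hw r).cases with ⟨V, h', _, h0⟩ | ⟨e', _, h', _, h0⟩ | ⟨_, _, _, h0⟩
    · have h1 := (X.cur_succ_of_enters hw h').1
      rw [hep w hw r hr hr'.le] at h1
      exact absurd h1 (hcur w hw (r + 1) hr').ne
    · rw [h0]; rfl
    · rw [h0]; rfl
  have hsend : ∀ w, w ∉ S.byz → ∀ r, s + P.Δ + 2 ≤ r → r < F → ∀ m : Msg P,
      (m ∉ (X.st w r).sent → Enabled S w (X.pre w r) m) → m ∈ (X.st w (r + 1)).sent :=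
    fun w hw r hr hr' m hm => X.mem_sent_succ_of_enabled hw (hcurs w hw r hr hr')
      ((hep w hw (r + 1) (by omega) hr').trans (hep w hw r hr hr'.le).symm) hm
  have hne : ∀ w, w ∉ S.byz → ∀ r, s + P.Δ + 2 ≤ r → r ≤ F →
      (X.pre w r).cur ≠ (X.pre w r).ep := fun w hw r hr hr' => by
    rw [pre_cur, pre_ep, hep w hw r hr hr']
    exact (hcur w hw r hr').ne
  -- Milestones: at `s₁` all have called, at `s₂` the primary holds their messages, at `s₃` its
  -- proposal has arrived, at `s₄` the echoes, at `s₅` the readies; the primary enters in the step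
  -- to `F`.
  set s₁ := s + P.Δ + 2 with hs₁
  set s₂ := s₁ + P.Δ with hs₂
  have hEC : ∀ w, w ∉ S.byz → ∃ d, Has p (X.pre p s₂) w (.epochChange e d) := by
    intro w hw
    have h6 := hep w hw s₁ le_rfl (by omega)
    obtain ⟨d, hd⟩ := X.exists_epochChange_sent hw (h6.symm ▸ he)
    rw [h6] at hd
    by_cases hwp : w = p
    · subst hwp
      exact ⟨d, Or.inr ⟨rfl, X.sent_mono hw (by omega) hd⟩⟩
    · obtain ⟨_, _, _, _, _, _, hl, _⟩ := X.epochChange_of_sent hw hd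
      have h7 := hep p hp s₂ (by omega) (by omega)
      obtain ⟨e', -, -, h8, -, d', h9⟩ := X.called_of_inbox hp hwp
        (X.inbox_timely hp hw hwp hd (s := s₂) (by omega)) hl
        (Or.inr ⟨h7.symm, by rw [h7]; exact (hcur p hp s₂ (by omega)).ne⟩)
      rw [h8 h7] at h9
      exact ⟨d', Or.inl h9⟩
  obtain ⟨J, hJ⟩ : ∃ J, Msg.rbInit e J ∈ (X.st p (s₂ + 1)).sent := by
    by_contra! hno
    refine hno _ (hsend p hp s₂ (by omega) (by omega) (.rbInit e
      (Finset.univ.filter fun w => ∃ d, Has p (X.pre p s₂) w (.epochChange e d))) fun hn => ?_)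
    refine ⟨hne p hp s₂ (by omega) (by omega), (hep p hp s₂ (by omega) (by omega)).symm, rfl,
      rfl, quorum_of_correct S _ hEC, fun J' hJ' => hno J' (X.sent_mono hp (Nat.le_succ _) hJ')⟩
  have hJuniq : ∀ r J', Msg.rbInit e J' ∈ (X.st p r).sent → J' = J := fun r J' hJ' =>
    X.rbInit_unique hp (t := max r (s₂ + 1)) (Or.inr ⟨rfl, X.sent_mono hp (le_max_left _ _) hJ'⟩)
      (Or.inr ⟨rfl, X.sent_mono hp (le_max_right _ _) hJ⟩)
  set s₃ := s₂ + 1 + P.Δ with hs₃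
  have hechoJ : ∀ w, w ∉ S.byz → ∀ r J', Msg.rbEcho e J' ∈ (X.st w r).sent → J' = J := by
    intro w hw r J' hJ'
    obtain ⟨r', -, -, -, h1, -⟩ := X.enabled_of_sent hw hJ' (by simp [IsEpochMsg])
    exact hJuniq r' J' (X.source_of_has_pre hw h1.2.2.1 hp)
  have hecho : ∀ w, w ∉ S.byz → Msg.rbEcho e J ∈ (X.st w (s₃ + 1)).sent := by
    intro w hw
    refine hsend w hw s₃ (by omega) (by omega) _ fun hn => ?_
    refine ⟨hne w hw s₃ (by omega) (by omega), (hep w hw s₃ (by omega) (by omega)).symm, ?_,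
      fun J' hJ' => ?_⟩
    · exact X.has_rbInit_of_sent hw hp hJ (by omega) (hep w hw s₃ (by omega) (by omega))
        (hcur w hw s₃ (by omega)).ne (by omega)
    · have := hechoJ w hw _ J' hJ'
      subst this
      exact hn hJ'
  set s₄ := s₃ + 1 + P.Δ with hs₄
  have hready : ∀ w, w ∉ S.byz → Msg.rbReady e J ∈ (X.st w (s₄ + 1)).sent := by
    intro w hw
    refine hsend w hw s₄ (by omega) (by omega) _ fun hn => ?_
    refine ⟨hne w hw s₄ (by omega) (by omega), (hep w hw s₄ (by omega) (by omega)).symm,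
      Or.inl (quorum_of_correct S _ fun z hz => ?_), fun J' hJ' => ?_⟩
    · exact X.has_rbEcho_of_sent hw hz (hecho z hz) (by omega) (hep w hw s₄ (by omega) (by omega))
        (hcur w hw s₄ (by omega)).ne (by omega)
    · obtain ⟨z, hz, h1⟩ := X.exists_correct_of_combinable (X.combinable_rbEcho hw hJ')
      have := hechoJ z hz _ J' h1
      subst this
      exact hn hJ'
  set s₅ := s₄ + 1 + P.Δ with hs₅
  have hep5 := hep p hp s₅ (by omega) (by omega)
  have hdel : RBDelivered p (X.pre p s₅) J := by
    refine ⟨?_, ?_⟩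
    · rw [pre_ep, hep5]
      exact X.sent_mono hp (by omega) (hready p hp)
    · rw [pre_ep, hep5]
      exact quorum_of_correct S _ fun z hz =>
        X.has_rbReady_of_sent hp hz (hready z hz) (by omega) hep5 (hcur p hp s₅ (by omega)).ne
          (by omega)
  have hJHas : ∀ w ∈ J, ∃ d, Has p (X.pre p s₅) w (.epochChange e d) := by
    intro w hw
    obtain ⟨r, hr, -, -, h1, -⟩ := X.enabled_of_sent hp hJ (by simp [IsEpochMsg])
    rw [h1.2.2.2.1] at hw
    obtain ⟨d, hd⟩ := (Finset.mem_filter.1 hw).2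
    exact ⟨d, X.has_pre (X.has_mono hp (by omega) (X.has_succ_of_pre hp hd))⟩
  have hEn : Enters S p (X.pre p s₅)
      (fun w => if h : w ∈ J then some (hJHas w h).choose else none) := by
    refine ⟨hne p hp s₅ (by omega) (by omega), Or.inr ⟨by rw [pre_ep, hep5], J, ?_, hdel, ?_, ?_⟩⟩
    · rw [pre_ep, hep5]
      exact X.sent_mono hp (by omega) hJ
    · intro w
      by_cases hw : w ∈ J <;> simp [hw]
    · intro w d hd
      dsimp only at hd
      by_cases hw : w ∈ J
      · rw [dif_pos hw] at hd
        rw [pre_ep, hep5, ← Option.some.inj hd]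
        exact (hJHas w hw).choose_spec
      · rw [dif_neg hw] at hd
        cases hd
  have h1 := (X.cur_succ_of_enters hp hEn).1
  rw [hep5] at h1
  have := hcur p hp (s₅ + 1) (by omega)
  omega

/-- An epoch under a correct primary is entered by all correct replicas; it is left when everything is
committed at some replica, or some timers have expired. -/
theorem SyncAt.correct_prim_cases (h : X.SyncAt e) (hp : S.prim e ∉ S.byz) (hC : 0 < P.Cmin)
    {D : ℕ} (hT : D ≤ P.T) (hTp : D ≤ P.Tp) (hTe : D ≤ P.Te) (hD : 7 * P.Δ + 11 ≤ D) :
    (∃ u, u ∉ S.byz ∧ (X.st u (X.last e)).cur = e ∧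
      (∀ w, w ∉ S.byz → (X.st w (X.last e)).cur = e) ∧
      ∀ v i, 1 ≤ i → i ≤ slots S (X.pre u (X.last e)) v → Done S u (X.pre u (X.last e)) v i) ∨
    (∃ u, u ∉ S.byz ∧ (X.st u (X.last e)).cur = e ∧
      (X.st u (X.last e)).entered + D ≤ X.last e ∧
      (∀ w, w ∉ S.byz → ∀ t, (X.st u (X.last e)).entered + 2 * P.Δ + 6 ≤ t → t ≤ X.last e →
        (X.st w t).cur = e) ∧
      ((X.st u (X.last e)).entered + P.T ≤ X.last e ∨ 2 * P.f + 1 ≤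
        (Finset.univ.filter fun v => (X.st u (X.last e)).prog v + P.Tp ≤ X.last e).card)) := by
  have he := h.two_le
  rcases X.leave_cases he with ⟨u, hu, hcur, hd⟩ | ⟨u, hu, hcur, hd⟩ | ⟨u, hu, hcur, τ, h1, h2⟩
  · exact Or.inl ⟨u, hu, hcur, fun v hv => X.cur_eq_of_allDone hC he hu hcur hd hv, hd⟩
  · refine Or.inr ⟨u, hu, hcur, X.entered_le_of_expired hu he hT hTp hcur hd,
      fun w hw t ht ht' => ?_, hd⟩
    have h1 := (X.entered_spec hu (hcur ▸ he)).2.2.1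
    exact h.cur_eq_of_prim hp (X.cur_prim_ge he hp hu (h1.trans hcur)) (by omega) ht' hw
  -- After f+1 correct replicas have called, `5 * Δ + 6` steps bring in the primary and `2 * Δ + 5`
  -- more all others, before the epoch-change timer expires.
  · exfalso
    have h3 := h.prim_enters hp h1 (by omega)
    have := h.cur_eq_of_prim hp h3 (s := X.last e) (by omega) le_rfl hu
    omega

end Execution
end FnF

namespace FnF

variable {P : Params} {S : System P}

namespace Execution

variable (X : Execution S) {u v w : Rep P} {t t' r s B e i j : ℕ} {x x' : Item P}

/-! ## Progress of a correct leader -/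

theorem ckptCert_of_sent (hf : 0 < P.f) (hv : v ∉ S.byz)
    (h : Msg.ckptCert e v i ∈ (X.st v t).sent) :
    ∃ t' < t, (X.st v t').cur = e ∧ 1 ≤ i ∧ i ≤ slots S (X.pre v t') v ∧ P.k ∣ i ∧
      ∀ j, 1 ≤ j → j ≤ i → Done S v (X.pre v t') v j := by
  obtain ⟨t₁, h1, -, -, h2, -⟩ := X.enabled_of_sent hv h (by simp [IsEpochMsg])
  obtain ⟨t₂, h3, -, -, h4, -⟩ := X.enabled_of_sent hv (X.checkpoint_of_hasFrom hf hv h2.2.2.2)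
    (by simp [IsEpochMsg])
  exact ⟨t₂, by omega, h4.2.1.symm, h4.2.2⟩

/-- A number below the leader's own checkpoint was done when the leader signed that checkpoint, by a
certificate or by an earlier checkpoint. Going back in time ends at a certificate. -/
theorem committed_of_ckptCert (hf : 0 < P.f) (hv : v ∉ S.byz)
    (h : Msg.ckptCert e v i ∈ (X.st v t).sent) (hj : 1 ≤ j) (hji : j ≤ i) :
    ∃ x, Msg.committed e v j x ∈ (X.st v t).sent := by
  induction t using Nat.strong_induction_on generalizing i with
  | _ t ih =>
    obtain ⟨t', h1, h2, -, -, -, h3⟩ := X.ckptCert_of_sent hf hv h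
    rcases h3 j hj hji with h4 | ⟨x, h4⟩
    · have h5 := (X.has_self_pre hv).1 (has_ckptCert_of_low (lt_of_lt_of_le hj h4))
      rw [pre_cur, h2] at h5
      obtain ⟨x, hx⟩ := ih t' h1 h5 h4
      exact ⟨x, X.sent_mono hv h1.le hx⟩
    · rw [pre_cur, h2] at h4
      exact ⟨x, X.sent_mono hv h1.le ((X.has_self_pre hv).1 h4)⟩

theorem committed_of_done (hf : 0 < P.f) (hu : u ∉ S.byz) (hv : v ∉ S.byz) (hj : 1 ≤ j)
    (h : Done S u (X.pre u t) v j) :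
    ∃ x, Msg.committed (X.st u t).cur v j x ∈ (X.st v t).sent := by
  rcases h with h | ⟨x, h⟩
  · exact X.committed_of_ckptCert hf hv
      (X.source_of_has_pre hu (has_ckptCert_of_low (lt_of_lt_of_le hj h)) hv) hj h
  · exact ⟨x, X.source_of_has_pre hu h hv⟩

theorem low_mono {s s' : LState P} (hc : s.cur = s'.cur) (hs : slots S s v = slots S s' v)
    (h : ∀ m, Has u s v m → Has u s' v m) : low S u s v ≤ low S u s' v := by
  rcases Nat.eq_zero_or_pos (low S u s v) with h0 | h0
  · omega
  · refine le_low (hc ▸ h _ (has_ckptCert_of_low h0)) (hs ▸ low_le_slots)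

/-- From time `B` until the first correct replica leaves it, all correct replicas are in epoch `e`,
whose primary is correct. -/
structure Settled (e B : ℕ) : Prop where
  two_le : 2 ≤ e
  prim : S.prim e ∉ S.byz
  gst_le : X.gst ≤ B
  cur_eq : ∀ u, u ∉ S.byz → ∀ t, B ≤ t → t ≤ X.last e → (X.st u t).cur = e

/-- The leader `v` has sent commit-certificates for its first `i` local numbers before time `t`. -/
def Committed (e : ℕ) (v : Rep P) (i t : ℕ) : Prop :=
  ∀ j, 1 ≤ j → j ≤ i → ∃ x, Msg.committed e v j x ∈ (X.st v t).sent

variable {X}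

theorem Committed.mono (hv : v ∉ S.byz) (h : X.Committed e v i t) (ht : t ≤ t') :
    X.Committed e v i t' := fun j h1 h2 =>
  (h j h1 h2).imp fun _ hx => X.sent_mono hv ht hx

theorem slots_eq (he : 2 ≤ e) (hp : S.prim e ∉ S.byz) (hu : u ∉ S.byz) (hw : w ∉ S.byz)
    (hcur : (X.st u t).cur = e) (hcur' : (X.st w t').cur = e) :
    slots S (X.st u t) v = slots S (X.st w t') v := by
  unfold slots
  rw [hcur, hcur', X.hung_eq he hp hu hw hcur hcur']

namespace Settled

variable (h : X.Settled e B)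
include h

theorem ep_eq (hu : u ∉ S.byz) (hB : B ≤ t) (hZ : t ≤ X.last e) : (X.st u t).ep = e := by
  have h1 := h.two_le
  have h2 := h.cur_eq u hu t hB hZ
  have h3 := (X.cur_pos_le hu t).2
  have h4 := X.ep_le_of_le_last (by omega : 1 ≤ e) hZ hu
  omega

theorem send (hu : u ∉ S.byz) (hB : B ≤ t) (hZ : t < X.last e) {m : Msg P}
    (hm : m ∉ (X.st u t).sent → Enabled S u (X.pre u t) m) : m ∈ (X.st u (t + 1)).sent :=
  X.mem_sent_succ_of_enabled hu
    ((h.cur_eq u hu _ (by omega) hZ).trans (h.cur_eq u hu t hB hZ.le).symm)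
    ((h.ep_eq hu (by omega) hZ).trans (h.ep_eq hu hB hZ.le).symm) hm

theorem low_le_low (hu : u ∉ S.byz) (hcur : (X.st u t).cur = e) (ht : t ≤ t')
    (hcur' : (X.st u t').cur = e) : low S u (X.st u t) v ≤ low S u (X.st u t') v :=
  low_mono (hcur.trans hcur'.symm) (slots_eq h.two_le h.prim hu hu hcur hcur')
    fun _ => X.has_mono hu ht

theorem low_pre_le (hu : u ∉ S.byz) (hcur : (X.st u t).cur = e)
    (hcur' : (X.st u (t + 1)).cur = e) :
    low S u (X.pre u t) v ≤ low S u (X.st u (t + 1)) v :=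
  low_mono (s := X.pre u t) (hcur.trans hcur'.symm)
    (slots_eq (X := X) (t := t) h.two_le h.prim hu hu hcur hcur') fun _ => X.has_succ_of_pre hu

omit h in
theorem low_le_pre : low S u (X.st u t) v ≤ low S u (X.pre u t) v :=
  low_mono rfl rfl fun _ => X.has_pre

/-- Checkpoint-certificates for `v` originate from `v`, so no replica is ahead of a correct leader.
-/
theorem low_pre_le_leader (hu : u ∉ S.byz) (hv : v ∉ S.byz) (hcur : (X.st u t).cur = e)
    (hcur' : (X.st v t).cur = e) : low S u (X.pre u t) v ≤ low S v (X.st v t) v := by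
  rcases Nat.eq_zero_or_pos (low S u (X.pre u t) v) with h0 | h0
  · omega
  · have h1 := X.source_of_has_pre hu (has_ckptCert_of_low h0) hv
    have h2 := slots_eq (X := X) (v := v) h.two_le h.prim hu hv hcur hcur'
    refine le_low (Or.inr ⟨rfl, ?_⟩) ?_
    · rw [hcur', ← hcur]
      exact h1
    · rw [← h2]
      exact low_le_slots

/-- A certificate stays within the upper watermark of its leader; another replica can accept it once
it has the leader's checkpoint. -/
theorem committed_window (hf : 0 < P.f) (hv : v ∉ S.byz) (hcur : (X.st v t).cur = e)
    (hm : Msg.committed e v j x ∈ (X.st v t).sent) :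
    1 ≤ j ∧ j ≤ slots S (X.st v t) v ∧ j ≤ low S v (X.st v t) v + 2 * P.k := by
  obtain ⟨-, -, h1⟩ := X.leader_chain hf hv hm
  obtain ⟨t', h2, -, -, h3, h4, -⟩ := X.enabled_of_sent hv h1 (by simp [IsEpochMsg])
  have hc : (X.st v t').cur = e := h3.2.1.symm
  obtain ⟨h5, h6, h7⟩ := h3.2.2.1
  have h8 := h.low_pre_le (v := v) hv hc (h4.trans hc)
  have h9 := h.low_le_low (v := v) hv (h4.trans hc) h2 hcur
  have h10 : slots S (X.pre v t') v = slots S (X.st v t) v :=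
    slots_eq (X := X) (t := t') h.two_le h.prim hv hv hc hcur
  omega

theorem low_propagates (hf : 0 < P.f) (hu : u ∉ S.byz) (hv : v ∉ S.byz) (hB : B ≤ t)
    (hZ : t + P.Δ + 1 ≤ X.last e) :
    low S v (X.st v t) v ≤ low S u (X.st u (t + P.Δ + 1)) v := by
  by_cases hvu : v = u
  · subst hvu
    exact h.low_le_low hu (h.cur_eq v hv t hB (by omega)) (by omega)
      (h.cur_eq v hv _ (by omega) hZ)
  · set ℓ := low S v (X.st v t) v with hℓ
    by_contra! hlt
    have hcv := h.cur_eq v hv t hB (by omega)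
    have hcu := h.cur_eq u hu (t + P.Δ) (by omega) (by omega)
    have hcu' := h.cur_eq u hu (t + P.Δ + 1) (by omega) hZ
    have h1 : Msg.ckptCert e v ℓ ∈ (X.st v t).sent := by
      have h0 := X.has_pre (has_ckptCert_of_low (S := S) (u := v) (v := v) (s := X.st v t)
        (by omega))
      rw [hcv] at h0
      exact (X.has_self_pre hv).1 h0
    obtain ⟨-, -, -, -, -, hk, -⟩ := X.ckptCert_of_sent hf hv h1
    have hsl : ℓ ≤ slots S (X.st u (t + P.Δ)) v := by
      rw [slots_eq (X := X) h.two_le h.prim hu hv hcu hcv]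
      exact low_le_slots
    have hsl' : ℓ ≤ slots S (X.st u (t + P.Δ + 1)) v := by
      rw [slots_eq (X := X) h.two_le h.prim hu hv hcu' hcv]
      exact low_le_slots
    have hg := h.gst_le
    have hacc : (v, Msg.ckptCert e v ℓ) ∈ (X.pre u (t + P.Δ)).acc := by
      refine X.mem_pre_acc_of_inbox hu (X.inbox_timely hu hv hvu h1 (by omega)) ?_ rfl ?_
      · have h2 := h.low_le_low (v := v) hu hcu (by omega : t + P.Δ ≤ t + P.Δ + 1) hcu'
        exact ⟨hvu, (h.ep_eq hu (by omega) (by omega)).trans hcu.symm, hcu.symm, rfl, by omega,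
          hsl, hk⟩
      · rintro ⟨w', m⟩ hb hc
        cases m <;> try exact hc.elim
        obtain ⟨rfl, rfl, rfl⟩ := hc
        obtain ⟨t', ht', -, hR⟩ := X.relevant_of_pre_acc hu hb
        have hw' : w' = v := hR.2.2.2.1
        subst hw'
        rfl
    have h3 := X.has_succ_of_pre hu (Or.inl hacc)
    have := le_low (S := S) (hcu'.symm ▸ h3) hsl'
    omega

/-- A commit-certificate sent by a correct leader is accepted by everybody. -/
theorem received (hf : 0 < P.f) (hu : u ∉ S.byz) (hv : v ∉ S.byz) (hB : B ≤ t)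
    (hZ : t + P.Δ + 2 ≤ X.last e) (hm : Msg.committed e v j x ∈ (X.st v t).sent) :
    Has u (X.st u (t + P.Δ + 2)) v (.committed e v j x) := by
  by_cases hvu : v = u
  · exact Or.inr ⟨hvu, by subst hvu; exact X.sent_mono hv (by omega) hm⟩
  · refine X.has_succ_of_pre hu (t := t + P.Δ + 1) (Or.inl ?_)
    have hg := h.gst_le
    have hcv := h.cur_eq v hv t hB (by omega)
    have hcu := h.cur_eq u hu (t + P.Δ + 1) (by omega) (by omega)
    obtain ⟨h1, h2, h3⟩ := h.committed_window hf hv hcv hm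
    -- The leader's checkpoint has to be in place before the certificate is sure to lie below the
    -- upper watermark of `u`; this costs one further step.
    have h4 := h.low_propagates hf hu hv hB (by omega)
    have h5 := slots_eq (X := X) (v := v) h.two_le h.prim hu hv hcu hcv
    refine X.mem_pre_acc_of_inbox hu (X.inbox_timely hu hv hvu hm (by omega)) ?_ rfl ?_
    · exact ⟨hvu, (h.ep_eq hu (by omega) (by omega)).trans hcu.symm, hcu.symm, rfl, h1, by omega,
        by omega⟩
    · rintro ⟨w', m⟩ hb hc
      cases m <;> try exact hc.elim
      obtain ⟨rfl, rfl, rfl⟩ := hc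
      obtain ⟨t', ht', -, hR⟩ := X.relevant_of_pre_acc hu hb
      have hw' : w' = v := hR.2.2.2.1
      subst hw'
      have h6 := X.source_of_has_pre hu (Or.inl hb) hv
      rw [X.commit_unique hf hv (X.sent_mono hv (by omega) (X.leader_chain hf hv hm).1)
        (X.leader_chain hf hv h6).1]

omit h in
/-- The leader obtains a quorum of partial signatures. -/
theorem leader_collects (hv : v ∉ S.byz) {m : Msg P}
    (hall : ∀ w, w ∉ S.byz → m ∈ (X.st w s).sent) (hr : max s X.gst + P.Δ ≤ r) (hsr : s ≤ r)
    (hR : ∀ w, w ≠ v → Relevant S v (X.st v r) w m) (hcap : cap m = 2 * P.f)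
    (hcomp : ∀ w, ∀ b ∈ (X.pre v r).acc, Competes (X.st v r) (w, m) b → b.2 = m) :
    HasFrom v (X.pre v r) (2 * P.f + 1) m := by
  have hown : m ∈ (X.pre v r).sent := X.sent_mono hv hsr (hall v hv)
  by_cases hA : ∀ w, w ∉ S.byz → w ≠ v → (w, m) ∈ (X.pre v r).acc
  · refine quorum_of_correct S _ fun w hw => ?_
    by_cases hwv : w = v
    · exact Or.inr ⟨hwv, hown⟩
    · exact Or.inl (hA w hw hwv)
  -- A signature left out means that the leader has already taken 2f from others for `m`; with its
  -- own they form a quorum.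
  · push Not at hA
    obtain ⟨w, hw, hwv, hn⟩ := hA
    have h1 := (X.accepted_or_full hv (X.inbox_timely hv hw hwv (hall w hw) hr)
      (hR w hwv)).resolve_left hn
    rw [hcap] at h1
    unfold HasFrom
    have h2 : ((X.pre v r).acc.filter (Competes (X.st v r) (w, m))).card ≤
        ((Finset.univ.filter fun z => Has v (X.pre v r) z m).erase v).card := by
      refine Finset.card_le_card_of_injOn Prod.fst ?_ ?_
      · rintro ⟨z, m'⟩ hz
        obtain ⟨hz1, hc⟩ := Finset.mem_filter.1 (Finset.mem_coe.1 hz)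
        have e1 : m' = m := hcomp w _ hz1 hc
        subst e1
        exact Finset.mem_coe.2 (Finset.mem_erase.2 ⟨X.ne_of_pre_acc hv hz1,
          Finset.mem_filter.2 ⟨Finset.mem_univ _, Or.inl hz1⟩⟩)
      · rintro ⟨z, m'⟩ hz ⟨z', m''⟩ hz' hzz
        obtain ⟨hz, hc⟩ := Finset.mem_filter.1 (Finset.mem_coe.1 hz)
        obtain ⟨hz', hc'⟩ := Finset.mem_filter.1 (Finset.mem_coe.1 hz')
        have e1 := hcomp w _ hz hc
        have e2 := hcomp w _ hz' hc'
        simp only at e1 e2 hzz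
        rw [e1, e2, hzz]
    have hv' : v ∈ Finset.univ.filter fun z => Has v (X.pre v r) z m :=
      Finset.mem_filter.2 ⟨Finset.mem_univ _, Or.inr ⟨rfl, hown⟩⟩
    rw [Finset.card_erase_of_mem hv'] at h2
    have := Finset.card_pos.2 ⟨v, hv'⟩
    omega

theorem send_ckptCert (hv : v ∉ S.byz) (hB : B ≤ s) (hZ : s + P.Δ < X.last e)
    (hall : ∀ w, w ∉ S.byz → Msg.checkpoint e v i ∈ (X.st w s).sent) :
    Msg.ckptCert e v i ∈ (X.st v (s + P.Δ + 1)).sent := by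
  have hg := h.gst_le
  have hcv := h.cur_eq v hv (s + P.Δ) (by omega) (by omega)
  have hev := h.ep_eq hv (by omega : B ≤ s + P.Δ) (by omega)
  refine h.send hv (by omega) hZ fun hn => ?_
  refine ⟨hev.trans hcv.symm, hcv.symm, rfl, leader_collects hv hall (by omega) (by omega)
    (fun w hw => ?_) rfl ?_⟩
  · exact ⟨hw, hev.trans hcv.symm, hcv.symm, rfl, X.sent_mono hv (by omega) (hall v hv), hn⟩
  · rintro w ⟨w', m⟩ hb hc
    cases m <;> try exact hc.elim
    obtain ⟨rfl, rfl, rfl⟩ := hc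
    rfl

theorem send_prepared (hv : v ∉ S.byz) (hB : B ≤ s) (hZ : s + P.Δ < X.last e)
    (hall : ∀ w, w ∉ S.byz → Msg.prepare e v i x ∈ (X.st w s).sent) :
    Msg.prepared e v i x ∈ (X.st v (s + P.Δ + 1)).sent := by
  have hg := h.gst_le
  have hcv := h.cur_eq v hv (s + P.Δ) (by omega) (by omega)
  have hev := h.ep_eq hv (by omega : B ≤ s + P.Δ) (by omega)
  have hown := X.sent_mono hv (by omega : s ≤ s + P.Δ) (hall v hv)
  refine h.send hv (by omega) hZ fun hn => ?_
  refine ⟨hev.trans hcv.symm, hcv.symm, rfl, leader_collects hv hall (by omega) (by omega)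
    (fun w hw => ?_) rfl ?_⟩
  · exact ⟨hw, hev.trans hcv.symm, hcv.symm, rfl, hown, hn⟩
  · rintro w ⟨w', m⟩ hb hc
    cases m <;> try exact hc.elim
    obtain ⟨rfl, rfl, rfl⟩ := hc
    obtain ⟨t', ht', -, hR⟩ := X.relevant_of_pre_acc hv hb
    rw [X.prepare_unique hv hown (X.sent_mono hv ht' hR.2.2.2.2.1)]

theorem send_committed (hf : 0 < P.f) (hv : v ∉ S.byz) (hB : B ≤ s) (hZ : s + P.Δ < X.last e)
    (hall : ∀ w, w ∉ S.byz → Msg.commit e v i x ∈ (X.st w s).sent) :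
    Msg.committed e v i x ∈ (X.st v (s + P.Δ + 1)).sent := by
  have hg := h.gst_le
  have hcv := h.cur_eq v hv (s + P.Δ) (by omega) (by omega)
  have hev := h.ep_eq hv (by omega : B ≤ s + P.Δ) (by omega)
  have hown := X.sent_mono hv (by omega : s ≤ s + P.Δ) (hall v hv)
  refine h.send hv (by omega) hZ fun hn => ?_
  refine ⟨hev.trans hcv.symm, hcv.symm, rfl, leader_collects hv hall (by omega) (by omega)
    (fun w hw => ?_) rfl ?_⟩
  · exact ⟨hw, hev.trans hcv.symm, hcv.symm, rfl, hown, hn⟩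
  · rintro w ⟨w', m⟩ hb hc
    cases m <;> try exact hc.elim
    obtain ⟨rfl, rfl, rfl⟩ := hc
    obtain ⟨t', ht', -, hR⟩ := X.relevant_of_pre_acc hv hb
    rw [X.commit_unique hf hv hown (X.sent_mono hv ht' hR.2.2.2.2.1)]

/-- After the first `i` local numbers of a correct leader are committed, all correct replicas have a
stable checkpoint less than `k` below. -/
theorem low_ge (hf : 0 < P.f) (hk : 0 < P.k) (hu : u ∉ S.byz) (hv : v ∉ S.byz) (hB : B ≤ t)
    (hG : X.Committed e v i t) (his : i ≤ slots S (X.st v t) v)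
    (hZ : t + 3 * P.Δ + 5 ≤ X.last e) (hr : t + 3 * P.Δ + 5 ≤ r) (hrZ : r ≤ X.last e) :
    i < low S u (X.st u r) v + P.k := by
  -- The largest multiple of `k` up to `i`. Its commit-certificates reach everybody within `Δ + 2`;
  -- signing, collecting and distributing the checkpoint takes `2 * Δ + 3` more.
  set q := P.k * (i / P.k) with hq
  have hqi : q ≤ i := Nat.mul_div_le i P.k
  have hiq : i < q + P.k := Nat.lt_mul_div_succ i hk
  suffices q ≤ low S u (X.st u r) v by omega
  rcases Nat.eq_zero_or_pos q with h0 | h0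
  · omega
  · have hcv := h.cur_eq v hv t hB (by omega)
    set t₁ := t + P.Δ + 2 with ht₁
    have hck : ∀ w, w ∉ S.byz → Msg.checkpoint e v q ∈ (X.st w (t₁ + 1)).sent := by
      intro w hw
      have hcw := h.cur_eq w hw t₁ (by omega) (by omega)
      refine h.send hw (by omega) (by omega) fun _ => ?_
      refine ⟨(h.ep_eq hw (by omega) (by omega)).trans hcw.symm, hcw.symm, h0, ?_,
        Dvd.intro _ rfl, fun j h1 h2 => Or.inr ?_⟩
      · have : slots S (X.pre w t₁) v = slots S (X.st v t) v :=
          slots_eq (X := X) (t := t₁) h.two_le h.prim hw hv hcw hcv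
        omega
      · obtain ⟨x, hx⟩ := hG j h1 (by omega)
        refine ⟨x, ?_⟩
        rw [pre_cur, hcw]
        exact X.has_pre (h.received hf hw hv hB (by omega) hx)
    have h1 := h.send_ckptCert hv (by omega) (by omega) hck
    have hcv' := h.cur_eq v hv (t₁ + 1 + P.Δ + 1) (by omega) (by omega)
    have h2 : q ≤ low S v (X.st v (t₁ + 1 + P.Δ + 1)) v := by
      refine le_low (Or.inr ⟨rfl, ?_⟩) ?_
      · rwa [hcv']
      · rw [slots_eq (X := X) (v := v) h.two_le h.prim hv hv hcv' hcv]
        omega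
    have h3 := h.low_propagates hf hu hv (t := t₁ + 1 + P.Δ + 1) (by omega) (by omega)
    have h4 := h.low_le_low (v := v) hu (h.cur_eq u hu (t₁ + 1 + P.Δ + 1 + P.Δ + 1) (by omega)
      (by omega)) (by omega : _ ≤ r) (h.cur_eq u hu r (by omega) hrZ)
    omega

end Settled

end Execution
end FnF

/-! ### The phases by which a correct leader commits one local number. -/

namespace FnF

variable {P : Params} {S : System P}

namespace Execution

variable {X : Execution S} {u v w : Rep P} {t t' r s B e i j : ℕ} {x x' : Item P}

namespace Settled

variable (h : X.Settled e B)
include h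

theorem slots_eq' (hu : u ∉ S.byz) (hw : w ∉ S.byz) (hB : B ≤ t) (hZ : t ≤ X.last e)
    (hB' : B ≤ t') (hZ' : t' ≤ X.last e) :
    slots S (X.st u t) v = slots S (X.st w t') v :=
  slots_eq h.two_le h.prim hu hw (h.cur_eq u hu t hB hZ) (h.cur_eq w hw t' hB' hZ')

theorem low_lt (hf : 0 < P.f) (hv : v ∉ S.byz) (hj : 1 ≤ j) (hB : B ≤ t) (hZ : t ≤ X.last e)
    (hn : ∀ x, Msg.committed e v j x ∉ (X.st v t).sent) : low S v (X.st v t) v < j := by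
  by_contra! hlt
  have h1 := X.has_pre (has_ckptCert_of_low (S := S) (u := v) (v := v) (s := X.st v t) (by omega))
  rw [h.cur_eq v hv t hB hZ] at h1
  obtain ⟨x, hx⟩ := X.committed_of_ckptCert hf hv ((X.has_self_pre hv).1 h1) hj hlt
  exact hn x hx

/-- An earlier prepare at this place was for the same item: what was proposed then is still
proposed, and proposals are unique. -/
theorem prepare_sent (hu : u ∉ S.byz) (hB : B ≤ t) (hZ : t < X.last e)
    (hw : InWindow S u (X.pre u t) v i) (hp : Proposed S u (X.pre u t) v i x) :
    Msg.prepare e v i x ∈ (X.st u (t + 1)).sent := by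
  have hcu := h.cur_eq u hu t hB hZ.le
  refine h.send hu hB hZ fun hn => ⟨(h.ep_eq hu hB hZ.le).trans hcu.symm, hcu.symm, hw, hp,
    fun x' hx' => hn ?_⟩
  obtain ⟨t₁, h1, -, -, h2, h3, -, h4⟩ := X.enabled_of_sent hu hx' (by simp [IsEpochMsg])
  have hc : (X.st u t₁).cur = e := h2.2.1.symm
  have hh : (X.st u t₁).hung = (X.st u t).hung := X.hung_eq h.two_le h.prim hu hu hc hcu
  have h5 : Proposed S u (X.pre u t) v i x' := by
    rcases h2.2.2.2.1 with h5 | ⟨h5, h6⟩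
    · exact Or.inl (by rwa [pre_hung, hh] at h5)
    · refine Or.inr ⟨?_, ?_⟩
      · unfold FreshItem at h5 ⊢
        rwa [pre_hung, pre_cur, hh, hc, ← hcu] at h5
      · rw [pre_cur, hc] at h6
        rw [pre_cur, hcu]
        exact X.has_pre (X.has_mono hu h1 (X.has_succ_of_pre hu h6))
  rwa [X.proposed_unique hu hp h5]

theorem prePrepare_received (hu : u ∉ S.byz) (hv : v ∉ S.byz) (hB : B ≤ t)
    (hZ : t + P.Δ ≤ X.last e) (hm : Msg.prePrepare e v i x ∈ (X.st v t).sent)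
    (hw : InWindow S u (X.st u (t + P.Δ)) v i) (hfresh : FreshItem S (X.st u (t + P.Δ)) v i x) :
    Has u (X.pre u (t + P.Δ)) v (.prePrepare e v i x) := by
  by_cases hvu : v = u
  · exact Or.inr ⟨hvu, by subst hvu; exact X.sent_mono hv (by omega) hm⟩
  · have hg := h.gst_le
    have hcu := h.cur_eq u hu (t + P.Δ) (by omega) hZ
    refine Or.inl (X.mem_pre_acc_of_inbox hu (X.inbox_timely hu hv hvu hm (by omega)) ?_ rfl ?_)
    · exact ⟨hvu, (h.ep_eq hu (by omega) hZ).trans hcu.symm, hcu.symm, rfl, hw, hfresh⟩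
    · rintro ⟨w', m⟩ hb hc
      cases m <;> try exact hc.elim
      obtain ⟨rfl, rfl, rfl⟩ := hc
      obtain ⟨t', ht', -, hR⟩ := X.relevant_of_pre_acc hu hb
      have hw' : w' = v := hR.2.2.2.1
      subst hw'
      have h6 := X.source_of_has_pre hu (Or.inl hb) hv
      rw [(X.prePrepare_of_sent hv hm).2, (X.prePrepare_of_sent hv h6).2]

theorem prepared_received (hf : 0 < P.f) (hu : u ∉ S.byz) (hv : v ∉ S.byz) (hB : B ≤ t)
    (hZ : t + P.Δ ≤ X.last e) (hm : Msg.prepared e v i x ∈ (X.st v t).sent)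
    (hw : InWindow S u (X.st u (t + P.Δ)) v i) :
    Has u (X.pre u (t + P.Δ)) v (.prepared e v i x) := by
  by_cases hvu : v = u
  · exact Or.inr ⟨hvu, by subst hvu; exact X.sent_mono hv (by omega) hm⟩
  · have hg := h.gst_le
    have hcu := h.cur_eq u hu (t + P.Δ) (by omega) hZ
    refine Or.inl (X.mem_pre_acc_of_inbox hu (X.inbox_timely hu hv hvu hm (by omega)) ?_ rfl ?_)
    · exact ⟨hvu, (h.ep_eq hu (by omega) hZ).trans hcu.symm, hcu.symm, rfl, hw⟩
    · rintro ⟨w', m⟩ hb hc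
      cases m <;> try exact hc.elim
      obtain ⟨rfl, rfl, rfl⟩ := hc
      obtain ⟨t', ht', -, hR⟩ := X.relevant_of_pre_acc hu hb
      have hw' : w' = v := hR.2.2.2.1
      subst hw'
      have h6 := X.source_of_has_pre hu (Or.inl hb) hv
      rw [X.prepare_unique hv (X.prepare_of_prepared hf hv (X.sent_mono hv (by omega) hm)).2
        (X.prepare_of_prepared hf hv h6).2]

theorem commit_sent (hf : 0 < P.f) (hu : u ∉ S.byz) (hv : v ∉ S.byz) (hB : B ≤ t)
    (hZ : t + P.Δ < X.last e) (hm : Msg.prepared e v i x ∈ (X.st v t).sent)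
    (hw : InWindow S u (X.st u (t + P.Δ)) v i) :
    Msg.commit e v i x ∈ (X.st u (t + P.Δ + 1)).sent := by
  have hcu := h.cur_eq u hu (t + P.Δ) (by omega) hZ.le
  refine h.send hu (by omega) hZ fun hn => ⟨(h.ep_eq hu (by omega) hZ.le).trans hcu.symm,
    hcu.symm, ?_, fun x' hx' => hn ?_⟩
  · exact h.prepared_received hf hu hv hB hZ.le hm hw
  · obtain ⟨t₁, h1, h2⟩ := X.prepared_of_commit hu hx'
    have h3 := X.sent_mono hv h1.le (X.source_of_has_pre hu h2 hv)
    rwa [X.prepare_unique hv (X.prepare_of_prepared hf hv (X.sent_mono hv (by omega) hm)).2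
      (X.prepare_of_prepared hf hv h3).2]

/-- A correct leader commits its next local number within bounded time. -/
theorem commit_next (hf : 0 < P.f) (hk : 0 < P.k) (hv : v ∉ S.byz) (hB : B ≤ t)
    (hG : X.Committed e v i t) (his : i + 1 ≤ slots S (X.st v t) v)
    (hZ : t + 7 * P.Δ + 10 ≤ X.last e) :
    ∃ x, Msg.committed e v (i + 1) x ∈ (X.st v (t + 7 * P.Δ + 10)).sent := by
  by_contra! hn
  -- No checkpoint covers `i + 1` while it is uncommitted, and by `low_ge` the checkpoints are less
  -- than `k` below `i`.
  have hlow : ∀ u, u ∉ S.byz → ∀ r, t + 3 * P.Δ + 5 ≤ r → r ≤ t + 7 * P.Δ + 10 →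
      InWindow S u (X.st u r) v (i + 1) ∧ InWindow S u (X.pre u r) v (i + 1) := by
    intro u hu r h1 h2
    have hcu := h.cur_eq u hu r (by omega) (by omega)
    have hcv := h.cur_eq v hv r (by omega) (by omega)
    have h3 := h.low_lt hf hv (j := i + 1) (t := r) (by omega) (by omega) (by omega)
      fun x hx => hn x (X.sent_mono hv h2 hx)
    have h4 := h.low_pre_le_leader (v := v) hu hv hcu hcv
    have h5 : low S u (X.st u r) v ≤ low S u (X.pre u r) v := low_le_pre
    have h6 := h.low_ge hf hk hu hv hB hG (by omega) (by omega) h1 (by omega)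
    have h7 : slots S (X.st u r) v = slots S (X.st v t) v :=
      h.slots_eq' hu hv (by omega) (by omega) hB (by omega)
    have h8 : slots S (X.pre u r) v = slots S (X.st v t) v := h7
    unfold InWindow
    omega
  -- A hanging item is known from the new-epoch message; otherwise the pre-prepare of the leader
  -- takes one step and one delay.
  have hprop : ∃ x, ∀ u, u ∉ S.byz →
      Proposed S u (X.pre u (t + 3 * P.Δ + 5 + 1 + P.Δ)) v (i + 1) x := by
    have hh : ∀ u, u ∉ S.byz → ∀ r, B ≤ r → r ≤ X.last e →
        (X.st u r).hung = (X.st v t).hung := fun u hu r h1 h2 =>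
      X.hung_eq h.two_le h.prim hu hv (h.cur_eq u hu r h1 h2) (h.cur_eq v hv t hB (by omega))
    rcases Nat.lt_or_ge i ((X.st v t).hung v).length with hi | hi
    · refine ⟨((X.st v t).hung v)[i], fun u hu => Or.inl ⟨by omega, ?_⟩⟩
      rw [pre_hung, hh u hu _ (by omega) (by omega)]
      simp
    · have hcv := h.cur_eq v hv t hB (by omega)
      have hload : i + 1 ≤ S.load e v := by
        unfold slots at his
        rw [hcv] at his
        omega
      have hfr : ∀ u, u ∉ S.byz → ∀ r, B ≤ r → r ≤ X.last e →
          FreshItem S (X.st u r) v (i + 1) ((e, v, i + 1), some (S.pend e v (i + 1))) := by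
        intro u hu r h1 h2
        unfold FreshItem
        rw [hh u hu r h1 h2, h.cur_eq u hu r h1 h2]
        exact ⟨by omega, hload, rfl, _, rfl, S.pend_owner _ _ _⟩
      have hpp : Msg.prePrepare e v (i + 1) ((e, v, i + 1), some (S.pend e v (i + 1))) ∈
          (X.st v (t + 3 * P.Δ + 5 + 1)).sent := by
        have hc := h.cur_eq v hv (t + 3 * P.Δ + 5) (by omega) (by omega)
        refine h.send hv (by omega) (by omega) fun _ => ⟨(h.ep_eq hv (by omega)
          (by omega)).trans hc.symm, hc.symm, rfl, (hlow v hv _ le_rfl (by omega)).2, ?_, hload,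
          rfl⟩
        rw [pre_hung, hh v hv _ (by omega) (by omega)]
        omega
      refine ⟨_, fun u hu => Or.inr ⟨hfr u hu _ (by omega) (by omega), ?_⟩⟩
      rw [pre_cur, h.cur_eq u hu _ (by omega) (by omega)]
      exact h.prePrepare_received hu hv (by omega) (by omega) hpp
        (hlow u hu _ (by omega) (by omega)).1 (hfr u hu _ (by omega) (by omega))
  obtain ⟨x, hx⟩ := hprop
  -- One step for the prepares, then `Δ + 1` each for prepared, commit and committed: `7 * Δ + 10`
  -- in all.
  have h1 : ∀ u, u ∉ S.byz →
      Msg.prepare e v (i + 1) x ∈ (X.st u (t + 3 * P.Δ + 5 + 1 + P.Δ + 1)).sent := fun u hu =>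
    h.prepare_sent hu (by omega) (by omega) (hlow u hu _ (by omega) (by omega)).2 (hx u hu)
  have h2 := h.send_prepared hv (by omega) (by omega) h1
  have h3 := fun u hu => h.commit_sent hf hu hv (by omega) (by omega) h2
    (hlow u hu _ (by omega) (by omega)).1
  have h4 := h.send_committed hf hv (by omega) (by omega) h3
  exact hn x (X.sent_mono hv (by omega) h4)

theorem committed_after (hf : 0 < P.f) (hk : 0 < P.k) (hv : v ∉ S.byz) (i : ℕ)
    (hi : i ≤ S.load e v) (hZ : B + i * (7 * P.Δ + 10) ≤ X.last e) :
    X.Committed e v i (B + i * (7 * P.Δ + 10)) := by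
  induction i with
  | zero => intro j h1 h2; omega
  | succ i ih =>
    have e1 : B + (i + 1) * (7 * P.Δ + 10) = B + i * (7 * P.Δ + 10) + 7 * P.Δ + 10 := by ring
    rw [e1] at hZ ⊢
    have h1 := ih (by omega) (by omega)
    intro j hj1 hj2
    rcases Nat.lt_or_ge i j with h2 | h2
    · obtain rfl : j = i + 1 := by omega
      refine h.commit_next hf hk hv (by omega) h1 ?_ (by omega)
      unfold slots
      rw [h.cur_eq v hv _ (by omega) (by omega)]
      omega
    · exact (h1.mono hv (by omega)) j hj1 h2

/-- The no-progress timer of a leader is reset by its commit-certificates. -/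
theorem le_prog (hu : u ∉ S.byz) (hB : B ≤ r) (hrt : r < t) (hZ : t ≤ X.last e)
    (hc : ∃ i x, (v, Msg.committed e v i x) ∈ X.proc u r ∨
      (u = v ∧ Msg.committed e v i x ∈ X.out u r)) : r ≤ (X.st u t).prog v := by
  induction t, hrt using Nat.le_induction with
  | base =>
    have hcu := h.cur_eq u hu r hB (by omega)
    obtain ⟨-, -, -, h1, -⟩ := X.stay_state hu
      ((h.cur_eq u hu (r + 1) (by omega) hZ).trans hcu.symm)
      ((h.ep_eq hu (by omega) hZ).trans (h.ep_eq hu hB (by omega)).symm)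
    rw [h1, hcu]
    simp only [if_pos hc]
    exact le_max_right _ _
  | succ t hrt ih =>
    have hcu := h.cur_eq u hu t (by omega) (by omega)
    obtain ⟨-, -, -, h1, -⟩ := X.stay_state hu
      ((h.cur_eq u hu (t + 1) (by omega) hZ).trans hcu.symm)
      ((h.ep_eq hu (by omega) hZ).trans (h.ep_eq hu (by omega) (by omega)).symm)
    rw [h1]
    have := ih (by omega)
    dsimp only
    split_ifs <;> omega

end Settled

end Execution
end FnF

/-! ### Throughput of an epoch with a correct primary. -/

namespace FnF

variable {P : Params} {S : System P}

namespace Execution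

variable {X : Execution S} {u v w : Rep P} {t t' r s B e i j : ℕ} {x x' : Item P}

/-- Were some number still open, `commit_next` and `received` would bring its certificate to `u`
within `8 * Δ + 18` of the last reset and reset the timer once more. The offset 6 absorbs the
constant in the time from which the epoch is settled, and makes the new reset strictly later. -/
theorem Settled.committed_of_expired (h : X.Settled e B) (hf : 0 < P.f) (hk : 0 < P.k)
    (hu : u ∉ S.byz) (hv : v ∉ S.byz) (hB : B ≤ (X.st u (X.last e)).prog v + 6) (i : ℕ)
    (hi : i ≤ S.load e v) (hTp : 8 * P.Δ + 18 ≤ P.Tp)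
    (hx : (X.st u (X.last e)).prog v + P.Tp ≤ X.last e) :
    X.Committed e v i ((X.st u (X.last e)).prog v + 6) := by
  set q := (X.st u (X.last e)).prog v with hq
  induction i with
  | zero => intro j h1 h2; omega
  | succ i ih =>
    have hG := ih (by omega)
    intro j hj1 hj2
    rcases Nat.lt_or_ge i j with h2 | h2
    · obtain rfl : j = i + 1 := by omega
      by_contra! hn
      have hslots : i + 1 ≤ slots S (X.st v (q + 6)) v := by
        unfold slots
        rw [h.cur_eq v hv _ (by omega) (by omega)]
        omega
      obtain ⟨x, hc⟩ := h.commit_next hf hk hv hB hG hslots (by omega)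
      have hr := h.received hf hu hv (by omega) (by omega) hc
      rcases hr with hr | ⟨rfl, hr⟩
      · obtain ⟨r, hr1, hr2⟩ := (X.mem_acc hu).1 hr
        have h3 : q + 6 ≤ r := by
          by_contra! hlt
          have h4 : Has u (X.pre u r) v (.committed e v (i + 1) x) :=
            Or.inl (by rw [pre_acc]; exact Finset.mem_union_right _ hr2)
          exact hn x (X.sent_mono hv hlt.le (X.source_of_has_pre hu h4 hv))
        have h5 := h.le_prog (v := v) hu (by omega) (by omega : r < X.last e) le_rfl
          ⟨_, _, Or.inl hr2⟩
        omega
      · obtain ⟨r, hr1, hr2⟩ := (X.mem_sent hu).1 hr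
        have h3 : q + 6 ≤ r := by
          by_contra! hlt
          exact hn x ((X.mem_sent hu).2 ⟨r, hlt, hr2⟩)
        have h5 := h.le_prog (v := v) hu (by omega) (by omega : r < X.last e) le_rfl
          ⟨_, _, Or.inr ⟨rfl, hr2⟩⟩
        omega
    · exact hG j hj1 h2

/-- In an epoch with a correct primary, at least `f + 1` correct leaders commit their minimum
load. -/
theorem SyncAt.exists_committed (h : X.SyncAt e) (hp : S.prim e ∉ S.byz) (hf : 0 < P.f)
    (hk : 0 < P.k) (hC : 0 < P.Cmin) (hTp : 10 * P.Δ + 18 ≤ P.Tp) (hTe : 10 * P.Δ + 18 ≤ P.Te)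
    (hT : 10 * P.Δ + 18 + P.Cmin * (7 * P.Δ + 10) ≤ P.T) :
    (∀ u, u ∉ S.byz → (X.st u (X.last e)).cur = e) ∧
    P.f + 1 ≤ (Finset.univ.filter fun v =>
      v ∉ S.byz ∧ X.Committed e v P.Cmin (X.last e)).card := by
  rcases h.correct_prim_cases hp hC (by omega : 10 * P.Δ + 18 ≤ P.T) hTp hTe (by omega) with
    ⟨u, hu, hcur, hall, hdone⟩ | ⟨u, hu, hcur, hD, hall, hcase⟩
  · refine ⟨hall, ?_⟩
    have hcc := correct_card S
    refine (by omega : P.f + 1 ≤ 2 * P.f + 1).trans (hcc.trans (Finset.card_le_card ?_))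
    intro v hv
    have hv' := (Finset.mem_filter.1 hv).2
    refine Finset.mem_filter.2 ⟨Finset.mem_univ _, hv', fun j h1 h2 => ?_⟩
    have h3 : j ≤ slots S (X.pre u (X.last e)) v := by
      have := load_ge (S := S) (X.st u (X.last e)).cur v
      unfold slots
      rw [pre_cur]
      omega
    have := X.committed_of_done hf hu hv' h1 (hdone v j h1 h3)
    rwa [hcur] at this
  · have hent := X.entered_spec hu (by rw [hcur]; exact h.two_le)
    rw [hcur] at hent
    have hlt := h.last_lt hu hent.2.1.ge
    set b := (X.st u (X.last e)).entered with hb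
    have hS : X.Settled e (b + 2 * P.Δ + 6) :=
      ⟨h.two_le, hp, by have := h.gst_le; omega, hall⟩
    refine ⟨fun w hw => hall w hw _ (by omega) le_rfl, ?_⟩
    -- An expired epoch timer leaves time for `Cmin` numbers in sequence at every correct leader. Of
    -- 2f+1 expired no-progress timers, f+1 belong to correct leaders, which have finished.
    rcases hcase with hc | hc
    · have hcc := correct_card S
      refine (by omega : P.f + 1 ≤ 2 * P.f + 1).trans (hcc.trans (Finset.card_le_card ?_))
      intro v hv
      have hv' := (Finset.mem_filter.1 hv).2
      refine Finset.mem_filter.2 ⟨Finset.mem_univ _, hv', ?_⟩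
      exact (hS.committed_after hf hk hv' P.Cmin (load_ge e v) (by omega)).mono hv' (by omega)
    · refine (correct_card_of_quorum S _ (q := P.f + 1) ((by omega : _ ≤ 2 * P.f + 1).trans
        hc)).trans (Finset.card_le_card ?_)
      intro v hv
      obtain ⟨-, hv', hx⟩ := Finset.mem_filter.1 hv
      refine Finset.mem_filter.2 ⟨Finset.mem_univ _, hv', ?_⟩
      have := hent.2.2.2.2 v
      exact (hS.committed_of_expired hf hk hu hv' (by omega) P.Cmin (load_ge e v) (by omega)
        hx).mono hv' (by omega)

/-! ## Committed requests -/

theorem has_committed_of_comm {s : LState P} {j : Fin (2 * P.k)}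
    (h : (ecData S u s).comm v j = some x) :
    ∃ i, Has u s v (.committed s.cur v i x) := by
  simp only [ecData] at h
  split_ifs at h with h'
  · obtain rfl := Option.some.inj h
    exact ⟨_, h'.choose_spec⟩

variable (X)

/-- A correct sender of an epoch-change message held the certificates in it; a byzantine one is
bound by `ECValid`. -/
theorem combinable_of_comm {d : ECData P} {j : Fin (2 * P.k)}
    (h : (w ∉ S.byz → ∃ t' < t, Msg.epochChange e d ∈ X.out w t') ∧
      (w ∈ S.byz → ECValid S X.out t d)) (hj : d.comm v j = some x) :
    ∃ e' i, Combinable S X.out t (.commit e' v i x) := by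
  by_cases hw : w ∈ S.byz
  · exact ⟨_, _, (h.2 hw).2.2.2 v j x hj⟩
  · obtain ⟨t', h1, h2⟩ := h.1 hw
    obtain ⟨-, -, rfl, -⟩ := X.epochChange_of_out hw h2
    obtain ⟨i, hi⟩ := has_committed_of_comm hj
    exact ⟨_, i, X.combinable_mono h1.le (X.combinable_of_committed hw hi)⟩

theorem ecSource_of_has (hu : u ∉ S.byz) {d : ECData P}
    (h : Has u (X.pre u t) w (.epochChange e d)) :
    (w ∉ S.byz → ∃ t' < t, Msg.epochChange e d ∈ X.out w t') ∧
      (w ∈ S.byz → ECValid S X.out t d) := by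
  refine ⟨fun hw => (X.mem_sent hw).1 (X.source_of_has_pre hu h hw), fun hw => ?_⟩
  rcases h with h | ⟨rfl, -⟩
  · obtain ⟨t₁, h1, h2, -⟩ := X.relevant_of_pre_acc hu h
    obtain ⟨t₂, h3, h4⟩ := X.deliv_of_proc hu h2
    have h5 : ECValid S X.out t₂ d := X.deliv_byz u hu w hw t₂ _ h4
    have h6 : t₂ ≤ t := by omega
    refine ⟨h5.1.imp id fun ⟨J, hJ⟩ => ⟨J, X.combinable_mono h6 hJ⟩,
      fun v => (h5.2.1 v).imp id (X.combinable_mono h6), fun v j x hx => ?_,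
      fun v j x hx => X.combinable_mono h6 (h5.2.2.2 v j x hx)⟩
    obtain ⟨e, v', i, h7⟩ := h5.2.2.1 v j x hx
    exact ⟨e, v', i, X.combinable_mono h6 h7⟩
  · exact absurd hw hu

theorem ecSource_of_sent_newEpoch (hu : u ∉ S.byz) {V} (h : Msg.newEpoch e V ∈ (X.st u t).sent)
    {d} (hd : V w = some d) :
    (w ∉ S.byz → ∃ t' < t, Msg.epochChange e d ∈ X.out w t') ∧
      (w ∈ S.byz → ∃ t' ≤ t, ECValid S X.out t' d) := by
  obtain ⟨t₁, h1, h2, -, -, h3, h4, -⟩ := X.newEpoch_of_sent hu h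
  rcases h4.2 with ⟨h5, -⟩ | ⟨-, J, -, -, -, h5⟩
  · rw [pre_ep, h2] at h5
    exact absurd h3 h5
  · have h6 := h5 w d hd
    rw [pre_ep, h2] at h6
    obtain ⟨h7, h8⟩ := X.ecSource_of_has hu h6
    exact ⟨fun hw => (h7 hw).imp fun _ h9 => ⟨h9.1.trans h1, h9.2⟩, fun hw => ⟨t₁, h1.le, h8 hw⟩⟩

/-- Every committed request has been signed by `f + 1` correct replicas. -/
theorem commit_card_of_mem_committed {sn : SeqNo P} (h : sn ∈ X.committed t) :
    ∃ e v i, ∃ r : ℕ, P.f + 1 ≤ (Finset.univ.filter fun w =>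
      w ∉ S.byz ∧ Msg.commit e v i (sn, some r) ∈ (X.st w t).sent).card := by
  obtain ⟨r, ⟨e, v, i, h⟩ | ⟨u, hu, e, V, h, w, d, v, j, hd, hj⟩⟩ := h
  · exact ⟨e, v, i, r, X.commit_card_of_committedAt h⟩
  · suffices ∃ t' ≤ t, ∃ e' i, Combinable S X.out t' (.commit e' v i (sn, some r)) by
      obtain ⟨t', ht', e', i, h1⟩ := this
      exact ⟨e', v, i, r, X.correct_card_of_combinable (X.combinable_mono ht' h1)⟩
    have hcorr : ∀ p, p ∉ S.byz → ∀ s ≤ t, Msg.newEpoch e V ∈ (X.st p s).sent →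
        ∃ t' ≤ t, ∃ e' i, Combinable S X.out t' (.commit e' v i (sn, some r)) := by
      intro p hp s hs h1
      obtain ⟨h2, h3⟩ := X.ecSource_of_sent_newEpoch hp h1 hd
      by_cases hw : w ∈ S.byz
      · obtain ⟨t', h4, h5⟩ := h3 hw
        exact ⟨t', by omega, X.combinable_of_comm (e := e) ⟨absurd hw, fun _ => h5⟩ hj⟩
      · exact ⟨s, hs, X.combinable_of_comm ⟨h2, (absurd · hw)⟩ hj⟩
    by_cases hp : S.prim e ∈ S.byz
    · rcases h with h | ⟨rfl, -⟩
      · obtain ⟨t₁, h1, h2, -⟩ := X.relevant_of_acc hu h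
        obtain ⟨t₂, h3, h4⟩ := X.deliv_of_proc hu h2
        exact ⟨t₂, by omega, X.combinable_of_comm (X.deliv_byz u hu _ hp t₂ _ h4 w d hd) hj⟩
      · exact absurd hp hu
    · exact hcorr _ hp t le_rfl (X.source_of_has hu h hp)

theorem committedIn_subset : X.committedIn e t ⊆ X.committed t :=
  fun _ ⟨_, v, i, r, h⟩ => ⟨r, Or.inl ⟨e, v, i, h⟩⟩

/-- Each committed sequence number occurs in a commit message of a correct replica, and only
finitely many have been sent. Without finiteness `ncard` would be a junk value. -/
theorem committed_finite (t : ℕ) : (X.committed t).Finite := by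
  have h : (⋃ w ∈ (Finset.univ.filter fun w => w ∉ S.byz : Finset (Rep P)),
      (fun m : Msg P => match m with
        | .commit _ _ _ x => x.1
        | _ => (0, 0, 0)) '' ((X.st w t).sent : Set (Msg P))).Finite :=
    Set.Finite.biUnion (Finset.finite_toSet _) fun w _ => (Finset.finite_toSet _).image _
  refine h.subset fun sn hsn => ?_
  obtain ⟨e, v, i, r, h1⟩ := X.commit_card_of_mem_committed hsn
  obtain ⟨w, hw⟩ := Finset.card_pos.1 (by omega : 0 < (Finset.univ.filter fun w =>
      w ∉ S.byz ∧ Msg.commit e v i (sn, some r) ∈ (X.st w t).sent).card)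
  obtain ⟨-, hw1, hw2⟩ := Finset.mem_filter.1 hw
  simp only [Set.mem_iUnion]
  exact ⟨w, Finset.mem_filter.2 ⟨Finset.mem_univ _, hw1⟩, _, hw2, rfl⟩

theorem committed_mono (h : t ≤ t') : X.committed t ⊆ X.committed t' := by
  rintro sn ⟨r, ⟨e, v, i, u, hu, h1⟩ | ⟨u, hu, e, V, h1, h2⟩⟩
  · exact ⟨r, Or.inl ⟨e, v, i, u, hu, X.has_mono hu h h1⟩⟩
  · exact ⟨r, Or.inr ⟨u, hu, e, V, X.has_mono hu h h1, h2⟩⟩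

/-- Computing the partial signatures for the committed requests. -/
theorem committed_mul_le_cost (t : ℕ) :
    (X.committed t).ncard * (P.f + 1) ≤ X.cost (fun _ => True) 0 t := by
  have hfin := X.committed_finite t
  choose! e v i r h using fun sn (h : sn ∈ X.committed t) => X.commit_card_of_mem_committed h
  set D := hfin.toFinset.image fun sn => Msg.commit (e sn) (v sn) (i sn) (sn, some (r sn)) with hD
  have h1 : D.card = (X.committed t).ncard := by
    rw [hD, Finset.card_image_of_injective, Set.ncard_eq_toFinset_card _ hfin]
    intro a b hab
    simp only [Msg.commit.injEq, Prod.mk.injEq] at hab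
    exact hab.2.2.2.1
  rw [← h1]
  refine X.card_mul_le_cost D _ (fun _ _ => trivial) fun m hm => ?_
  obtain ⟨sn, hsn, rfl⟩ := Finset.mem_image.1 hm
  exact h sn (hfin.mem_toFinset.1 hsn)

variable {X}

/-- Hanging items fill at most the first `n * (2 * k)` local numbers; any higher one carries a
client request under a new sequence number. -/
theorem fresh_of_prepare (hu : u ∉ S.byz) (h : Msg.prepare e v j x ∈ (X.st u t).sent)
    (hj : P.n * (2 * P.k) < j) : x.1 = (e, v, j) ∧ ∃ r, x.2 = some r := by
  obtain ⟨t₁, -, -, -, h2, -⟩ := X.enabled_of_sent hu h (by simp [IsEpochMsg])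
  have hc : (X.st u t₁).cur = e := h2.2.1.symm
  rcases h2.2.2.2.1 with ⟨-, h3⟩ | ⟨h3, -⟩
  · have := (List.getElem?_eq_some_iff.1 h3).1
    have h4 := X.hung_length_le hu t₁ v
    rw [pre_hung] at this
    omega
  · refine ⟨?_, h3.2.2.2.imp fun _ => And.left⟩
    rw [h3.2.2.1, pre_cur, hc]

/-- An epoch with a correct primary commits the minimum loads of `f + 1` leaders, except for the
numbers that may be taken by hanging requests. -/
theorem SyncAt.le_ncard_committedIn (h : X.SyncAt e) (hp : S.prim e ∉ S.byz) (hf : 0 < P.f)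
    (hk : 0 < P.k) (hC : 0 < P.Cmin) (hTp : 10 * P.Δ + 18 ≤ P.Tp) (hTe : 10 * P.Δ + 18 ≤ P.Te)
    (hT : 10 * P.Δ + 18 + P.Cmin * (7 * P.Δ + 10) ≤ P.T) :
    (P.f + 1) * (P.Cmin - P.n * (2 * P.k)) ≤ (X.committedIn e (X.last e)).ncard := by
  obtain ⟨-, h1⟩ := h.exists_committed hp hf hk hC hTp hTe hT
  set F := Finset.univ.filter fun v => v ∉ S.byz ∧ X.Committed e v P.Cmin (X.last e)
  have h2 : (((F ×ˢ Finset.Ioc (P.n * (2 * P.k)) P.Cmin).image fun a =>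
      ((e, a.1, a.2) : SeqNo P) : Finset (SeqNo P)) : Set (SeqNo P)) ⊆
      X.committedIn e (X.last e) := by
    intro sn hsn
    obtain ⟨⟨v, j⟩, ha, rfl⟩ := Finset.mem_image.1 (Finset.mem_coe.1 hsn)
    obtain ⟨hv, hj⟩ := Finset.mem_product.1 ha
    obtain ⟨-, hv, hG⟩ := Finset.mem_filter.1 hv
    obtain ⟨hj1, hj2⟩ := Finset.mem_Ioc.1 hj
    obtain ⟨x, hx⟩ := hG j (by omega) hj2
    obtain ⟨hx1, r, hx2⟩ := fresh_of_prepare hv (X.leader_chain hf hv hx).2.2 hj1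
    refine ⟨rfl, v, j, r, v, hv, Or.inr ⟨rfl, ?_⟩⟩
    rwa [← hx1, ← hx2]
  have h3 := Set.ncard_le_ncard h2 ((X.committed_finite _).subset X.committedIn_subset)
  rw [Set.ncard_coe_finset, Finset.card_image_of_injective, Finset.card_product, Nat.card_Ioc]
    at h3
  · exact (Nat.mul_le_mul_right _ h1).trans h3
  · rintro ⟨v, j⟩ ⟨v', j'⟩ hab
    simpa using hab

end Execution
end FnF

namespace FnF

variable {P : Params} {S : System P}

/-! ## The primary rotation -/

section Rotation

variable {perf : ℕ → ℕ} {prim : ℕ → Rep P} {queue : ℕ → List (Rep P)} {byz : Finset (Rep P)}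
  {a b e e' m : ℕ} {u : Rep P}

theorem le_lastTurn (he : 1 ≤ e) (hee : e < e') (hp : prim e = u) : e ≤ lastTurn prim e' u :=
  Nat.le_findGreatest (by omega) ⟨he, hp⟩

/-- The rules for the queue of the current cycle. -/
def QueueStep (perf : ℕ → ℕ) (prim : ℕ → Rep P) (queue : ℕ → List (Rep P)) (e : ℕ) : Prop :=
  (lastTurn prim e (prim e) + P.g = e ∧ queue (e + 1) = queue e) ∨
    ((∀ u, lastTurn prim e u + P.g ≠ e) ∧
      ((queue e ≠ [] ∧ queue e = prim e :: queue (e + 1)) ∨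
       (queue e = [] ∧ IsBest perf prim e (prim e :: queue (e + 1)))))

/-- The epochs from `a` to `b` that are not interruptions of the cycle. -/
def cycleEpochs (prim : ℕ → Rep P) (a b : ℕ) : Finset ℕ :=
  (Finset.Ico a b).filter fun e => lastTurn prim e (prim e) + P.g ≠ e

/-- Within a cycle, each epoch that is not an interruption takes one primary from the front of the
queue. -/
theorem queue_eq_append (hq : ∀ e, a ≤ e → e < b → QueueStep perf prim queue e) (hab : a ≤ b)
    (hn : ∀ e, a ≤ e → e < b → lastTurn prim e (prim e) + P.g ≠ e → queue e ≠ []) :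
    ∃ l : List (Rep P), queue a = l ++ queue b ∧ l.length = (cycleEpochs prim a b).card ∧
      ∀ u ∈ l, ∃ e, a ≤ e ∧ e < b ∧ prim e = u := by
  induction b, hab using Nat.le_induction with
  | base => exact ⟨[], by simp [cycleEpochs]⟩
  | succ b hab ih =>
    obtain ⟨l, h1, h2, h3⟩ := ih (fun e h h' => hq e h (by omega)) fun e h h' => hn e h (by omega)
    have hI : Finset.Ico a (b + 1) = insert b (Finset.Ico a b) := by
      ext z; simp only [Finset.mem_Ico, Finset.mem_insert]; omega
    rcases hq b hab (by omega) with ⟨h4, h5⟩ | ⟨h4, ⟨-, h5⟩ | ⟨h5, -⟩⟩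
    · refine ⟨l, by rw [h5, h1], ?_, fun u hu => ?_⟩
      · rw [h2, cycleEpochs, cycleEpochs, hI, Finset.filter_insert, if_neg (not_not.2 h4)]
      · obtain ⟨e, h6, h7, h8⟩ := h3 u hu
        exact ⟨e, h6, by omega, h8⟩
    · refine ⟨l ++ [prim b], by rw [h1, h5]; simp, ?_, fun u hu => ?_⟩
      · rw [cycleEpochs, hI, Finset.filter_insert, if_pos (h4 _),
          Finset.card_insert_of_notMem (by simp)]
        simp [h2, cycleEpochs]
      · rcases List.mem_append.1 hu with hu | hu
        · obtain ⟨e, h6, h7, h8⟩ := h3 u hu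
          exact ⟨e, h6, by omega, h8⟩
        · exact ⟨b, hab, by omega, (List.mem_singleton.1 hu).symm⟩
    · exact absurd h5 (hn b hab (by omega) (h4 _))

theorem length_le_of_mem_byz {l : List (Rep P)} (h : l.Nodup) (h' : ∀ u ∈ l, u ∈ byz) :
    l.length ≤ byz.card := by
  rw [← List.toFinset_card_of_nodup h]
  exact Finset.card_le_card fun u hu => h' u (List.mem_toFinset.1 hu)

/-- In a stretch of at most `g` epochs a replica interrupts at most once: for a second interruption
its last turn, `g` epochs back, would have to lie before the stretch. -/
theorem interruptions_card_le (ha : 1 ≤ a) (hb : b ≤ a + P.g)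
    (hbyz : ∀ e, a ≤ e → e < b → prim e ∈ byz) :
    ((Finset.Ico a b).filter fun e => ¬ lastTurn prim e (prim e) + P.g ≠ e).card ≤ byz.card := by
  refine Finset.card_le_card_of_injOn prim ?_ ?_
  · intro e he
    obtain ⟨h1, h2⟩ := Finset.mem_Ico.1 (Finset.mem_filter.1 (Finset.mem_coe.1 he)).1
    exact hbyz e h1 h2
  · have key : ∀ e e', e ∈ (Finset.Ico a b).filter
        (fun e => ¬ lastTurn prim e (prim e) + P.g ≠ e) → e' ∈ (Finset.Ico a b).filter
        (fun e => ¬ lastTurn prim e (prim e) + P.g ≠ e) → prim e = prim e' → e < e' → False := by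
      intro e e' he he' h hlt
      obtain ⟨h1, -⟩ := Finset.mem_filter.1 he
      obtain ⟨h2, h3⟩ := Finset.mem_filter.1 he'
      have h4 := le_lastTurn (prim := prim) (by have := Finset.mem_Ico.1 h1; omega) hlt h
      have h5 := Finset.mem_Ico.1 h1
      have h6 := Finset.mem_Ico.1 h2
      omega
    intro e he e' he' h
    rcases lt_trichotomy e e' with h1 | h1 | h1
    · exact (key e e' he he' h h1).elim
    · exact h1
    · exact (key e' e he' he h.symm h1).elim

theorem queue_nodup (h0 : queue (P.n + 1) = [])
    (hq : ∀ e, P.n < e → QueueStep perf prim queue e) (he : P.n < e) : (queue e).Nodup := by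
  induction e, he using Nat.le_induction with
  | base => rw [h0]; exact List.nodup_nil
  | succ e he ih =>
    rcases hq e he with ⟨-, h⟩ | ⟨-, ⟨-, h⟩ | ⟨-, h⟩⟩
    · rwa [h]
    · rw [h] at ih
      exact (List.nodup_cons.1 ih).2
    · exact (List.nodup_cons.1 h.1).2

/-- After the exploration phase, any `n` consecutive epochs include one with a correct primary. -/
theorem IsRotation.exists_notMem (hrot : IsRotation (P := P) perf prim) (hbyz : byz.card ≤ P.f)
    (hg : P.n ≤ P.g) (hm : P.n < m) : ∃ e, m ≤ e ∧ e < m + P.n ∧ prim e ∉ byz := by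
  obtain ⟨-, queue, h0, hq⟩ := hrot
  change ∀ e, P.n < e → QueueStep perf prim queue e at hq
  by_contra! hall
  -- If all n primaries are byzantine, at most f epochs are interruptions. A queue without
  -- repetitions supplies at most f byzantine primaries, and a list of 2f+1 determined meanwhile is
  -- not exhausted. So at most two queues are involved, giving 2f further epochs and fewer than n in
  -- all.
  have hI := interruptions_card_le (a := m) (b := m + P.n) (prim := prim) (byz := byz) (by omega)
    (by omega) fun e h1 h2 => hall e h1 h2
  have hN : (cycleEpochs prim m (m + P.n)).card + ((Finset.Ico m (m + P.n)).filter fun e =>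
      ¬ lastTurn prim e (prim e) + P.g ≠ e).card = P.n := by
    rw [cycleEpochs, Finset.card_filter_add_card_filter_not, Nat.card_Ico]
    omega
  have hn : P.n = 3 * P.f + 1 := rfl
  -- a stretch without a new cycle
  have key : ∀ a b, m ≤ a → a ≤ b → b ≤ m + P.n →
      (∀ e, a ≤ e → e < b → lastTurn prim e (prim e) + P.g ≠ e → queue e ≠ []) →
      ∃ l : List (Rep P), queue a = l ++ queue b ∧ l.length = (cycleEpochs prim a b).card ∧
        ∀ u ∈ l, u ∈ byz := by
    intro a b h1 h2 h3 h4
    obtain ⟨l, h5, h6, h7⟩ := queue_eq_append (fun e h h' => hq e (by omega)) h2 h4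
    refine ⟨l, h5, h6, fun u hu => ?_⟩
    obtain ⟨e, h8, h9, rfl⟩ := h7 u hu
    exact hall e (by omega) (by omega)
  have key' : ∀ b, m ≤ b → b ≤ m + P.n →
      (∀ e, m ≤ e → e < b → lastTurn prim e (prim e) + P.g ≠ e → queue e ≠ []) →
      (cycleEpochs prim m b).card ≤ P.f := by
    intro b h1 h2 h3
    obtain ⟨l, h4, h5, h6⟩ := key m b le_rfl h1 h2 h3
    have h7 := queue_nodup h0 hq hm
    rw [h4] at h7
    have := length_le_of_mem_byz (List.nodup_append.1 h7).1 h6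
    omega
  let R : ℕ → Prop := fun e => lastTurn prim e (prim e) + P.g ≠ e ∧ queue e = []
  by_cases hR : ∃ e, m ≤ e ∧ e < m + P.n ∧ R e
  · set e₁ := Nat.find hR with he₁
    obtain ⟨h1, h2, h3, h4⟩ := Nat.find_spec hR
    rw [← he₁] at h1 h2 h3 h4
    have h5 := key' e₁ h1 h2.le fun e ha hb hc hd =>
      Nat.find_min hR hb ⟨ha, by omega, hc, hd⟩
    have hbest : IsBest perf prim e₁ (prim e₁ :: queue (e₁ + 1)) := by
      rcases hq e₁ (by omega) with ⟨h, -⟩ | ⟨-, ⟨h, -⟩ | ⟨-, h⟩⟩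
      · exact absurd h h3
      · exact absurd h4 h
      · exact h
    have key2 : ∀ b, e₁ + 1 ≤ b → b ≤ m + P.n →
        (∀ e, e₁ + 1 ≤ e → e < b → lastTurn prim e (prim e) + P.g ≠ e → queue e ≠ []) →
        1 + (cycleEpochs prim (e₁ + 1) b).card ≤ P.f ∧
        2 * P.f + 1 = 1 + (cycleEpochs prim (e₁ + 1) b).card + (queue b).length := by
      intro b h6 h7 h8
      obtain ⟨l, h9, h10, h11⟩ := key (e₁ + 1) b (by omega) h6 h7 h8
      have h12 := hbest.1
      have h13 := hbest.2.1
      rw [h9, ← List.cons_append] at h12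
      have h14 := length_le_of_mem_byz (byz := byz) (List.nodup_append.1 h12).1 (by
        intro u hu
        rcases List.mem_cons.1 hu with rfl | hu
        · exact hall e₁ h1 h2
        · exact h11 u hu)
      rw [h9] at h13
      simp only [List.length_cons, List.length_append] at h13 h14
      omega
    -- A second redetermination would require 2f+1 distinct primaries to be used up, all of them
    -- byzantine.
    have h6 : ∀ e, e₁ + 1 ≤ e → e < m + P.n → lastTurn prim e (prim e) + P.g ≠ e →
        queue e ≠ [] := by
      by_contra! hR2
      have hR2' : ∃ e, e₁ + 1 ≤ e ∧ e < m + P.n ∧ R e := by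
        obtain ⟨e, ha, hb, hc, hd⟩ := hR2
        exact ⟨e, ha, hb, hc, hd⟩
      obtain ⟨h7, h8, h9, h10⟩ := Nat.find_spec hR2'
      have h11 := key2 _ h7 h8.le fun e ha hb hc hd =>
        Nat.find_min hR2' hb ⟨ha, by omega, hc, hd⟩
      rw [h10] at h11
      simp only [List.length_nil] at h11
      omega
    have h7 := (key2 (m + P.n) (by omega) le_rfl h6).1
    have h8 : (cycleEpochs prim m (m + P.n)).card ≤ (cycleEpochs prim m e₁).card +
        (1 + (cycleEpochs prim (e₁ + 1) (m + P.n)).card) := by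
      have : cycleEpochs prim m (m + P.n) ⊆ cycleEpochs prim m e₁ ∪
          ({e₁} ∪ cycleEpochs prim (e₁ + 1) (m + P.n)) := by
        intro z hz
        simp only [cycleEpochs, Finset.mem_union, Finset.mem_filter, Finset.mem_Ico,
          Finset.mem_singleton] at hz ⊢
        have := hz.2
        rcases lt_trichotomy z e₁ with h | h | h
        · exact Or.inl ⟨⟨hz.1.1, h⟩, this⟩
        · exact Or.inr (Or.inl h)
        · exact Or.inr (Or.inr ⟨⟨h, hz.1.2⟩, this⟩)
      refine (Finset.card_le_card this).trans ((Finset.card_union_le _ _).trans ?_)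
      exact Nat.add_le_add_left (Finset.card_union_le _ _) _
    omega
  · have h1 := key' (m + P.n) (by omega) le_rfl fun e ha hb hc hd => hR ⟨e, ha, hb, hc, hd⟩
    omega

end Rotation

end FnF

/-! ### Charging the work to committed requests and epochs. -/

namespace FnF

variable {P : Params} {S : System P}

/-- The messages for the checkpoint at local number `i` of leader `v` in epoch `e`. -/
def ForCheckpoint (e : ℕ) (v : Rep P) (i : ℕ) (m : Msg P) : Prop :=
  m = .checkpoint e v i ∨ m = .ckptCert e v i

namespace Execution

variable (X : Execution S) {u v w : Rep P} {t t' r s M e i j : ℕ} {x x' : Item P}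

/-! ## The cost of checkpoints -/

theorem ucost_forCheckpoint_le (hu : u ∉ S.byz) (e : ℕ) (v : Rep P) (i t : ℕ) :
    X.ucost (ForCheckpoint e v i) u t ≤ 3 + if u = v then 2 * P.f else 0 := by
  have hN : ∀ m : Msg P, ForCheckpoint e v i m → ¬ IsEpochMsg m := by
    rintro m (rfl | rfl) <;> simp [IsEpochMsg]
  have hacc : ∑ a ∈ (X.st u t).acc.filter (fun a => ForCheckpoint e v i a.2), costBound a.2 ≤
      1 + if u = v then 2 * P.f else 0 := by
    have h0 : ∀ C : Rep P × Msg P → Prop, (∀ a, C a → ForCheckpoint e v i a.2) → ∀ c,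
        ((X.st u t).acc.filter C).card ≤ c →
        ∑ a ∈ (X.st u t).acc.filter C, costBound a.2 ≤ c := by
      intro C hC c hc
      have := sum_filter_le_of_card (X.st u t).acc C (fun a => costBound a.2) (b := 1) hc
        (fun a _ ha => (costBound_of_not_epochMsg (hN _ (hC a ha))).le)
      simpa using this
    have h1 := h0 (fun a => a.2 = .ckptCert e v i) (fun a h => Or.inr h) 1
      (X.card_acc_class_le hu _ 1
        (by rintro s ⟨a, _⟩ ⟨b, _⟩ rfl rfl; simp [Competes])
        (by rintro ⟨a, _⟩ rfl; simp [cap]) t)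
    have h2 := h0 (fun a => a.2 = .checkpoint e v i) (fun a h => Or.inl h)
      (if u = v then 2 * P.f else 0) (by
        split_ifs with huv
        · exact X.card_acc_class_le hu _ _
            (by rintro s ⟨a, _⟩ ⟨b, _⟩ rfl rfl; simp [Competes])
            (by rintro ⟨a, _⟩ rfl; simp [cap]) t
        · rw [Nat.le_zero, Finset.card_eq_zero, Finset.filter_eq_empty_iff]
          rintro ⟨a, _⟩ ha rfl
          obtain ⟨t', -, -, h⟩ := X.relevant_of_acc hu ha
          exact huv h.2.2.2.1)
    refine (sum_filter_or_le _ _ (fun a => a.2 = .ckptCert e v i)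
      (fun a => a.2 = .checkpoint e v i) _ fun a _ h => h.symm).trans (Nat.add_le_add h1 h2)
  have hsent : ∑ m ∈ (X.st u t).sent.filter (ForCheckpoint e v i), computeCost m ≤ 2 := by
    have := sum_filter_le_of_card (X.st u t).sent (ForCheckpoint e v i) computeCost
      (c := 2) (b := 1) (by
        refine (Finset.card_le_card (t := {.checkpoint e v i, .ckptCert e v i}) fun m hm => ?_).trans
          Finset.card_le_two
        simpa [ForCheckpoint] using (Finset.mem_filter.1 hm).2)
      fun m _ hm => (computeCost_of_not_epochMsg (hN m hm)).le
    simpa using this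
  have := X.ucost_le (t := t) hu (ForCheckpoint e v i)
  split_ifs at hacc ⊢ <;> omega

theorem cost_forCheckpoint_le (e : ℕ) (v : Rep P) (i t : ℕ) :
    X.cost (ForCheckpoint e v i) 0 t ≤ 4 * P.n := by
  refine (X.cost_le_of_ucost_le _ fun u hu => X.ucost_forCheckpoint_le hu e v i t).trans ?_
  rw [Finset.sum_add_distrib, Finset.sum_ite_eq' Finset.univ v]
  simp only [Finset.sum_const, Finset.card_univ, Fintype.card_fin, Finset.mem_univ, if_true,
    smul_eq_mul, Params.n]
  omega

/-! ## Local numbers in use -/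

/-- Up to local number `i`, leader `v` has had messages in its window in epoch `e`. -/
def InUse (e : ℕ) (v : Rep P) (i t : ℕ) : Prop :=
  ∃ w, w ∉ S.byz ∧ ∃ s < t, (X.st w s).cur = e ∧ 1 ≤ i ∧ i ≤ low S w (X.pre w s) v + 2 * P.k

variable {X}

theorem InUse.mono (h : X.InUse e v i t) (ht : t ≤ t') : X.InUse e v i t' := by
  obtain ⟨w, hw, s, hs, h⟩ := h
  exact ⟨w, hw, s, by omega, h⟩

variable (X)

theorem inUse_of_window (hu : u ∉ S.byz) (hs : s < t) (he : e = (X.st u s).cur) (hi : 1 ≤ i)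
    (h : i ≤ low S u (X.st u s) v + 2 * P.k) : X.InUse e v i t := by
  have : low S u (X.st u s) v ≤ low S u (X.pre u s) v := Settled.low_le_pre
  exact ⟨u, hu, s, hs, he.symm, hi, by omega⟩

theorem inUse_of_prepare (hu : u ∉ S.byz) (h : Msg.prepare e v i x ∈ (X.st u t).sent) :
    X.InUse e v i t := by
  obtain ⟨s, hs, -, -, h2, -⟩ := X.enabled_of_sent hu h (by simp [IsEpochMsg])
  exact ⟨u, hu, s, hs, h2.2.1.symm, by have := h2.2.2.1.1; omega, h2.2.2.1.2.1⟩

theorem inUse_of_prepared (hf : 0 < P.f) (hu : u ∉ S.byz)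
    (h : Has u (X.st u t) v (.prepared e v i x)) : X.InUse e v i t := by
  rcases h with h | ⟨-, h⟩
  · obtain ⟨s, hs, -, hR⟩ := X.relevant_of_acc hu h
    have hw := hR.2.2.2.2
    exact X.inUse_of_window hu hs hR.2.2.1 (by have := hw.1; omega) hw.2.1
  · exact X.inUse_of_prepare hu (X.prepare_of_prepared hf hu h).2

theorem inUse_of_commit (hf : 0 < P.f) (hu : u ∉ S.byz)
    (h : Msg.commit e v i x ∈ (X.st u t).sent) : X.InUse e v i t := by
  obtain ⟨s, hs, h1⟩ := X.prepared_of_commit hu h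
  exact (X.inUse_of_prepared hf hu (X.has_succ_of_pre hu h1)).mono hs

theorem inUse_of_sent (hf : 0 < P.f) (hu : u ∉ S.byz) {m} (h : m ∈ (X.st u t).sent)
    (hm : ForRequest e v i m) : X.InUse e v i t := by
  obtain ⟨x, rfl | rfl | rfl | rfl | rfl⟩ := hm
  · obtain ⟨s, hs, -, -, h2, -⟩ := X.enabled_of_sent hu h (by simp [IsEpochMsg])
    exact ⟨u, hu, s, hs, h2.2.1.symm, by have := h2.2.2.2.1.1; omega, h2.2.2.2.1.2.1⟩
  · exact X.inUse_of_prepare hu h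
  · exact X.inUse_of_prepare hu (X.prepare_of_prepared hf hu h).2
  · exact X.inUse_of_commit hf hu h
  · exact X.inUse_of_commit hf hu (X.commit_of_committed hf hu h).2

theorem inUse_of_acc (hf : 0 < P.f) (hu : u ∉ S.byz) {a} (h : a ∈ (X.st u t).acc)
    (hm : ForRequest e v i a.2) : X.InUse e v i t := by
  obtain ⟨w, m⟩ := a
  obtain ⟨s, hs, -, hR⟩ := X.relevant_of_acc hu h
  obtain ⟨x, rfl | rfl | rfl | rfl | rfl⟩ := hm
  · have hw := hR.2.2.2.2.1
    exact X.inUse_of_window hu hs hR.2.2.1 (by have := hw.1; omega) hw.2.1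
  · exact (X.inUse_of_prepare hu hR.2.2.2.2.1).mono hs.le
  · have hw := hR.2.2.2.2
    exact X.inUse_of_window hu hs hR.2.2.1 (by have := hw.1; omega) hw.2.1
  · exact (X.inUse_of_commit hf hu hR.2.2.2.2.1).mono hs.le
  · have hw := hR.2.2.2.2
    exact X.inUse_of_window hu hs hR.2.2.1 hw.1 hw.2.1

/-- The leader may be byzantine: a correct signer of a checkpoint holds a commit-certificate for the
number, or an earlier checkpoint above it, which again has a correct signer. -/
theorem committedAt_of_checkpoint (hu : u ∉ S.byz)
    (h : Msg.checkpoint e v i ∈ (X.st u t).sent) (hj : 1 ≤ j) (hji : j ≤ i) :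
    ∃ x, X.CommittedAt e v j x t := by
  induction t using Nat.strong_induction_on generalizing i u with
  | _ t ih =>
    obtain ⟨s, hs, -, -, h2, -⟩ := X.enabled_of_sent hu h (by simp [IsEpochMsg])
    have hc : (X.st u s).cur = e := h2.2.1.symm
    rcases h2.2.2.2.2.2 j hj hji with h3 | ⟨x, h3⟩
    · have h4 := has_ckptCert_of_low (lt_of_lt_of_le hj h3)
      rw [pre_cur, hc] at h4
      obtain ⟨w, hw, h5⟩ := X.exists_correct_of_combinable (X.combinable_of_ckptCert hu h4)
      obtain ⟨x, u', hu', hx⟩ := ih s hs hw h5 h3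
      exact ⟨x, u', hu', X.has_mono hu' hs.le hx⟩
    · rw [pre_cur, hc] at h3
      exact ⟨x, u, hu, X.has_mono hu hs (X.has_succ_of_pre hu h3)⟩

theorem committedAt_of_low (hu : u ∉ S.byz) (hs : s ≤ t) (hc : (X.st u s).cur = e) (hj : 1 ≤ j)
    (h : j ≤ low S u (X.pre u s) v) : ∃ x, X.CommittedAt e v j x t := by
  have h4 := has_ckptCert_of_low (lt_of_lt_of_le hj h)
  rw [pre_cur, hc] at h4
  obtain ⟨w, hw, h5⟩ := X.exists_correct_of_combinable (X.combinable_of_ckptCert hu h4)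
  exact X.committedAt_of_checkpoint hw (X.sent_mono hw hs h5) hj h

/-- Beyond the first `n * (2 * k)` positions items are fresh, so the position is itself the sequence
number and different positions count as different requests. -/
theorem mem_committed_of_committedAt (h : X.CommittedAt e v j x t) (hj : P.n * (2 * P.k) < j) :
    (e, v, j) ∈ X.committed t := by
  obtain ⟨w, hw⟩ := Finset.card_pos.1 (lt_of_lt_of_le P.f.succ_pos
    (X.commit_card_of_committedAt h))
  obtain ⟨-, hw1, hw2⟩ := Finset.mem_filter.1 hw
  obtain ⟨s, hs, h1⟩ := X.prepared_of_commit hw1 hw2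
  obtain ⟨p, hp, h2⟩ := X.exists_correct_of_combinable (X.combinable_of_prepared hw1 h1)
  obtain ⟨h3, r, h4⟩ := fresh_of_prepare hp h2 hj
  refine ⟨r, Or.inl ⟨e, v, j, ?_⟩⟩
  rwa [← h3, ← h4]

/-- The highest checkpoint of leader `v` in epoch `e` at a correct replica. -/
noncomputable def maxLow (e : ℕ) (v : Rep P) (t : ℕ) : ℕ :=
  ((Finset.univ.filter fun u => u ∉ S.byz) ×ˢ Finset.range t).sup fun a =>
    if (X.st a.1 a.2).cur = e then low S a.1 (X.pre a.1 a.2) v else 0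

theorem committedAt_of_le_maxLow (hj : 1 ≤ j) (h : j ≤ X.maxLow e v t) :
    ∃ x, X.CommittedAt e v j x t := by
  obtain ⟨⟨u, s⟩, ha, h1⟩ := (Finset.le_sup_iff (show (⊥ : ℕ) < j from hj)).1 h
  obtain ⟨hu, hs⟩ := Finset.mem_product.1 ha
  simp only at h1
  split_ifs at h1 with hc
  · exact X.committedAt_of_low (Finset.mem_filter.1 hu).2 (Finset.mem_range.1 hs).le hc hj h1
  · omega

/-- A number in use is at most 2k above the highest checkpoint, below which everything is committed.
This ties the work to committed numbers even for byzantine leaders. -/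
theorem InUse.le {X : Execution S} (h : X.InUse e v i t) :
    1 ≤ i ∧ i ≤ X.maxLow e v t + 2 * P.k := by
  obtain ⟨w, hw, s, hs, hc, h1, h2⟩ := h
  refine ⟨h1, h2.trans (Nat.add_le_add_right ?_ _)⟩
  have := Finset.le_sup (s := (Finset.univ.filter fun u => u ∉ S.byz) ×ˢ Finset.range t)
    (b := (w, s)) (f := fun a : Rep P × ℕ =>
    if (X.st a.1 a.2).cur = e then low S a.1 (X.pre a.1 a.2) v else 0)
    (Finset.mem_product.2 ⟨Finset.mem_filter.2 ⟨Finset.mem_univ w, hw⟩, Finset.mem_range.2 hs⟩)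
  simp only [if_pos hc] at this
  exact this

theorem InUse.epoch_le {X : Execution S} (h : X.InUse e v i t)
    (hM : ∀ u, u ∉ S.byz → (X.st u t).ep ≤ M) : e ∈ Finset.Icc 1 M := by
  obtain ⟨w, hw, s, hs, rfl, -⟩ := h
  have h1 := X.cur_pos_le hw s
  have h2 : (X.st w s).ep ≤ (X.st w t).ep := X.ep_mono hw hs.le
  have h3 := hM w hw
  exact Finset.mem_Icc.2 ⟨h1.1, by omega⟩

end Execution
end FnF

namespace FnF

variable {P : Params} {S : System P}

namespace Execution

variable (X : Execution S) {u v w : Rep P} {t t' r s M e i j : ℕ} {x x' : Item P}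

/-! ## The total cost -/

theorem checkpoint_of_sent (hf : 0 < P.f) (hu : u ∉ S.byz) {m} (h : m ∈ (X.st u t).sent)
    (hm : ForCheckpoint e v i m) : Msg.checkpoint e v i ∈ (X.st u t).sent := by
  rcases hm with rfl | rfl
  · exact h
  · obtain ⟨s, hs, -, -, h2, -⟩ := X.enabled_of_sent hu h (by simp [IsEpochMsg])
    exact X.sent_mono hu hs.le (X.checkpoint_of_hasFrom hf hu h2.2.2.2)

theorem checkpoint_of_acc (hu : u ∉ S.byz) {a} (h : a ∈ (X.st u t).acc)
    (hm : ForCheckpoint e v i a.2) :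
    ∃ w, w ∉ S.byz ∧ Msg.checkpoint e v i ∈ (X.st w t).sent := by
  obtain ⟨w, m⟩ := a
  obtain ⟨s, hs, -, hR⟩ := X.relevant_of_acc hu h
  rcases hm with rfl | rfl
  · exact ⟨u, hu, X.sent_mono hu hs.le hR.2.2.2.2.1⟩
  · have hw : w = v := hR.2.2.2.1
    subst hw
    exact X.exists_correct_of_combinable (X.combinable_of_ckptCert hu (X.has_pre (Or.inl h)))

/-- The numbers with checkpoints until time `t`. -/
noncomputable def checkpointIndex (M t : ℕ) : Finset (SeqNo P) :=
  (Finset.Icc 1 M ×ˢ Finset.univ ×ˢ Finset.Icc 1 (P.n * (2 * P.k))) ∪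
    (X.committed_finite t).toFinset

/-- The numbers in use until time `t`. -/
noncomputable def requestIndex (M t : ℕ) : Finset (SeqNo P) :=
  X.checkpointIndex M t ∪
    (Finset.Icc 1 M ×ˢ Finset.univ ×ˢ Finset.range (2 * P.k)).image fun a =>
      (a.1, a.2.1, X.maxLow a.1 a.2.1 t + a.2.2 + 1)

theorem checkpointIndex_card_le (M t : ℕ) : (X.checkpointIndex M t).card ≤
    M * (P.n * (P.n * (2 * P.k))) + (X.committed t).ncard := by
  refine (Finset.card_union_le _ _).trans ?_
  rw [← Set.ncard_eq_toFinset_card _ (X.committed_finite t)]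
  simp

theorem requestIndex_card_le (M t : ℕ) : (X.requestIndex M t).card ≤
    M * (P.n * (P.n * (2 * P.k))) + (X.committed t).ncard + M * (P.n * (2 * P.k)) := by
  refine (Finset.card_union_le _ _).trans (Nat.add_le_add (X.checkpointIndex_card_le M t) ?_)
  refine Finset.card_image_le.trans ?_
  simp

theorem mem_checkpointIndex (hM : e ∈ Finset.Icc 1 M) (hi : 1 ≤ i)
    (h : X.CommittedAt e v i x t) : (e, v, i) ∈ X.checkpointIndex M t := by
  unfold checkpointIndex
  by_cases hn : i ≤ P.n * (2 * P.k)
  · refine Finset.mem_union_left _ (Finset.mem_product.2 ⟨hM, Finset.mem_product.2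
      ⟨Finset.mem_univ _, Finset.mem_Icc.2 ⟨hi, hn⟩⟩⟩)
  · exact Finset.mem_union_right _ ((Set.Finite.mem_toFinset _).2
      (X.mem_committed_of_committedAt h (by omega)))

theorem mem_checkpointIndex_of_sent (hM : ∀ u, u ∉ S.byz → (X.st u t).ep ≤ M) (hu : u ∉ S.byz)
    (h : Msg.checkpoint e v i ∈ (X.st u t).sent) : (e, v, i) ∈ X.checkpointIndex M t := by
  obtain ⟨s, hs, -, -, h2, -⟩ := X.enabled_of_sent hu h (by simp [IsEpochMsg])
  have hc : (X.st u s).cur = e := h2.2.1.symm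
  have h1 := X.cur_pos_le hu s
  have h3 : (X.st u s).ep ≤ (X.st u t).ep := X.ep_mono hu hs.le
  have h4 := hM u hu
  obtain ⟨x, hx⟩ := X.committedAt_of_checkpoint hu h h2.2.2.1 le_rfl
  exact X.mem_checkpointIndex (Finset.mem_Icc.2 (by omega)) h2.2.2.1 hx

theorem mem_requestIndex (hM : ∀ u, u ∉ S.byz → (X.st u t).ep ≤ M) (h : X.InUse e v i t) :
    (e, v, i) ∈ X.requestIndex M t := by
  obtain ⟨h1, h2⟩ := h.le
  have h3 := h.epoch_le hM
  unfold requestIndex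
  by_cases hi : i ≤ X.maxLow e v t
  · obtain ⟨x, hx⟩ := X.committedAt_of_le_maxLow h1 hi
    exact Finset.mem_union_left _ (X.mem_checkpointIndex h3 h1 hx)
  · refine Finset.mem_union_right _ (Finset.mem_image.2 ⟨(e, v, i - X.maxLow e v t - 1),
      Finset.mem_product.2 ⟨h3, Finset.mem_product.2 ⟨Finset.mem_univ _,
        Finset.mem_range.2 (by simp only; omega)⟩⟩, ?_⟩)
    simp only [Prod.mk.injEq, true_and]
    omega

theorem cost_requests_le (hf : 0 < P.f) (hM : ∀ u, u ∉ S.byz → (X.st u t).ep ≤ M) :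
    X.cost (fun m => ∃ e v i, ForRequest e v i m) 0 t ≤ (X.requestIndex M t).card * (10 * P.n) := by
  refine (X.cost_le_sum (X.requestIndex M t) _
    (fun a : SeqNo P => ForRequest a.1 a.2.1 a.2.2) ?_ ?_).trans ?_
  · rintro u hu a ha ⟨e, v, i, hm⟩
    exact ⟨(e, v, i), X.mem_requestIndex hM (X.inUse_of_acc hf hu ha hm), hm⟩
  · rintro u hu m h ⟨e, v, i, hm⟩
    exact ⟨(e, v, i), X.mem_requestIndex hM (X.inUse_of_sent hf hu h hm), hm⟩
  · exact Finset.sum_le_card_nsmul _ _ _ fun a _ => X.cost_forRequest_le hf _ _ _ _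

theorem cost_checkpoints_le (hf : 0 < P.f) (hM : ∀ u, u ∉ S.byz → (X.st u t).ep ≤ M) :
    X.cost (fun m => ∃ e v i, ForCheckpoint e v i m) 0 t ≤
      (X.checkpointIndex M t).card * (4 * P.n) := by
  refine (X.cost_le_sum (X.checkpointIndex M t) _
    (fun a : SeqNo P => ForCheckpoint a.1 a.2.1 a.2.2) ?_ ?_).trans ?_
  · rintro u hu a ha ⟨e, v, i, hm⟩
    obtain ⟨w, hw, h⟩ := X.checkpoint_of_acc hu ha hm
    exact ⟨(e, v, i), X.mem_checkpointIndex_of_sent hM hw h, hm⟩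
  · rintro u hu m h ⟨e, v, i, hm⟩
    exact ⟨(e, v, i), X.mem_checkpointIndex_of_sent hM hu (X.checkpoint_of_sent hf hu h hm), hm⟩
  · exact Finset.sum_le_card_nsmul _ _ _ fun a _ => X.cost_forCheckpoint_le _ _ _ _

theorem epoch_le_of_sent (hu : u ∉ S.byz) {m} (h : m ∈ (X.st u t).sent)
    (hm : ForEpochChange e m) : e ≤ (X.st u t).ep := by
  have key : ∀ m, ¬ IsEpochMsg m → m ∈ (X.st u t).sent →
      (∀ s, Enabled S u s m → e = s.ep) → e ≤ (X.st u t).ep := by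
    intro m hn h hE
    obtain ⟨s, hs, -, -, h2, -⟩ := X.enabled_of_sent hu h hn
    rw [hE _ h2]
    exact X.ep_mono hu hs.le
  rcases hm with ⟨d, rfl⟩ | ⟨J, rfl | rfl | rfl⟩ | ⟨V, rfl⟩
  · obtain ⟨s, hs, -, -, -, h2, -⟩ := X.epochChange_of_sent hu h
    exact h2
  · exact key _ (by simp [IsEpochMsg]) h fun s h => h.2.1
  · exact key _ (by simp [IsEpochMsg]) h fun s h => h.2.1
  · exact key _ (by simp [IsEpochMsg]) h fun s h => h.2.1
  · obtain ⟨s, hs, -, -, -, -, -, h2, -⟩ := X.newEpoch_of_sent hu h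
    exact h2.trans (X.cur_pos_le hu t).2

/-- Among the messages of an epoch-change, only the calls themselves are processed ahead of the
receiver's epoch. -/
theorem epoch_le_of_acc (hu : u ∉ S.byz) {a} (h : a ∈ (X.st u t).acc)
    (hm : ForEpochChange e a.2) : e ≤ (X.st u t).ep ∨ ∃ d, a.2 = .epochChange e d := by
  obtain ⟨w, m⟩ := a
  obtain ⟨s, hs, -, hR⟩ := X.relevant_of_acc hu h
  have h1 : (X.st u s).ep ≤ (X.st u t).ep := X.ep_mono hu hs.le
  rcases hm with ⟨d, rfl⟩ | ⟨J, rfl | rfl | rfl⟩ | ⟨V, rfl⟩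
  · exact Or.inr ⟨d, rfl⟩
  · exact Or.inl (hR.2.2.1.le.trans h1)
  · exact Or.inl (hR.2.2.le.trans h1)
  · exact Or.inl (hR.2.2.le.trans h1)
  · exact Or.inl (hR.2.2.1.le.trans h1)

/-- Each epoch up to `M` is charged in full. Beyond `M` only the messages of
`cost_highEpochChange_le` remain, charged once for all epochs. -/
theorem cost_epochChanges_le (hM : ∀ u, u ∉ S.byz → (X.st u t).ep ≤ M) :
    X.cost (fun m => ∃ e, ForEpochChange e m) 0 t ≤
      (M + 1) * (P.n ^ 3 * (13 + 12 * P.k)) + P.n * (P.n * (1 + P.n + P.n * (4 * P.k))) := by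
  refine (X.cost_le_add _ (fun m => ∃ e ≤ M, ForEpochChange e m)
    (fun m => ∃ e > M, ForEpochChange e m) ?_).trans (Nat.add_le_add ?_ ?_)
  · rintro m ⟨e, he⟩
    exact (le_or_gt e M).imp (fun h => ⟨e, h, he⟩) fun h => ⟨e, h, he⟩
  · refine (X.cost_le_sum (Finset.range (M + 1)) _ (fun e => ForEpochChange e) ?_ ?_).trans ?_
    · rintro u hu a ha ⟨e, he, hm⟩
      exact ⟨e, Finset.mem_range.2 (by omega), hm⟩
    · rintro u hu m ha ⟨e, he, hm⟩
      exact ⟨e, Finset.mem_range.2 (by omega), hm⟩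
    · refine (Finset.sum_le_card_nsmul _ _ _ fun e _ => X.cost_forEpochChange_le e t).trans ?_
      simp
  · refine (X.cost_le_sum {()} _ (fun _ => fun m => ∃ e d, m = .epochChange e d ∧
      ∀ u, u ∉ S.byz → (X.st u t).ep < e) ?_ ?_).trans ?_
    · rintro u hu a ha ⟨e, he, hm⟩
      have h1 := hM u hu
      rcases X.epoch_le_of_acc hu ha hm with h | ⟨d, h⟩
      · omega
      · exact ⟨(), Finset.mem_singleton_self _, e, d, h, fun w hw => by have := hM w hw; omega⟩
    · rintro u hu m h ⟨e, he, hm⟩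
      have h1 := hM u hu
      have h2 := X.epoch_le_of_sent hu h hm
      omega
    · rw [Finset.sum_singleton]
      exact X.cost_highEpochChange_le t

/-- A committed request is charged `10 * n` for its own messages and `4 * n` for a possible
checkpoint at its number. The rest is proportional to the number of epochs: positions open to
hanging items, numbers in open windows, and epoch-changes. -/
theorem cost_le (hf : 0 < P.f) (hM : ∀ u, u ∉ S.byz → (X.st u t).ep ≤ M) :
    X.cost (fun _ => True) 0 t ≤
      14 * P.n * (X.committed t).ncard + (M + 1) * (P.n ^ 3 * (15 + 64 * P.k)) := by
  have h1 := X.cost_le_add (t := t) (fun _ => True) (fun m => ∃ e v i, ForRequest e v i m)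
    (fun m => (∃ e v i, ForCheckpoint e v i m) ∨ ∃ e, ForEpochChange e m) (by
      intro m _
      unfold ForRequest ForCheckpoint ForEpochChange
      cases m <;> simp)
  have h2 := X.cost_le_add (t := t)
    (fun m => (∃ e v i, ForCheckpoint e v i m) ∨ ∃ e, ForEpochChange e m) _ _ fun _ => id
  have h3 := X.cost_requests_le hf hM
  have h4 := X.cost_checkpoints_le hf hM
  have h5 := X.cost_epochChanges_le hM
  have h6 := Nat.mul_le_mul_right (10 * P.n) (X.requestIndex_card_le M t)
  have h7 := Nat.mul_le_mul_right (4 * P.n) (X.checkpointIndex_card_le M t)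
  refine (by omega : X.cost (fun _ => True) 0 t ≤ _ + (_ + _)).trans
    ((Nat.add_le_add (h3.trans h6) (Nat.add_le_add (h4.trans h7) h5)).trans ?_)
  have hn : 1 ≤ P.n := by simp [Params.n]
  generalize P.n = n at hn ⊢
  generalize (X.committed t).ncard = C
  generalize P.k = k
  have e1 : n * n ≤ n ^ 3 := by nlinarith [Nat.mul_le_mul hn (le_refl (n * n))]
  have e2 : M * k * (n * n) ≤ M * k * n ^ 3 := Nat.mul_le_mul_left _ e1
  nlinarith [Nat.zero_le (k * n ^ 3), Nat.zero_le (M * n ^ 3), Nat.zero_le (M * k * n ^ 3), e1]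

end Execution
end FnF

/-! ### Throughput over many epochs and amortization. -/

namespace FnF

variable {P : Params} {S : System P}

namespace Execution

variable (X : Execution S) {u v w : Rep P} {t t' r s M e e₁ i j Q : ℕ}

theorem last_mono (he : 1 ≤ e) (h : e ≤ i) : X.last e ≤ X.last i := by
  induction i, h using Nat.le_induction with
  | base => exact le_rfl
  | succ i hi ih => exact ih.trans (X.last_lt_succ (he.trans hi)).le

theorem eventually_syncAt (hC : 0 < P.Cmin) {D : ℕ} (hT : D ≤ P.T) (hTp : D ≤ P.Tp)
    (hTe : D ≤ P.Te) (hD : P.Δ + 4 ≤ D) : ∃ e₁, P.n < e₁ ∧ ∀ e ≥ e₁, X.SyncAt e := by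
  obtain ⟨e₀, h1, h2, h3⟩ := X.eventually_sync hC hT hTp hTe hD
  refine ⟨e₀ + P.n + 1, by omega, fun e he => ⟨?_, h2.trans (X.last_mono h1 ?_),
    fun u hu => h3 _ ?_ u hu⟩⟩ <;> omega

/-- The number of committed requests grows with the epoch number. -/
theorem mul_le_ncard_committed (hg : P.n ≤ P.g) (hn : P.n < e₁)
    (hQ : ∀ e ≥ e₁, S.prim e ∉ S.byz → Q ≤ (X.committedIn e (X.last e)).ncard)
    (hu : u ∉ S.byz) (t : ℕ) :
    ((X.st u t).ep - e₁) / P.n * Q ≤ (X.committed t).ncard := by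
  -- Restricting to sequence numbers first assigned before the end of the q-th block of n epochs
  -- keeps the contributions of the blocks disjoint.
  have key : ∀ q, e₁ + q * P.n ≤ (X.st u t).ep →
      q * Q ≤ {sn ∈ X.committed t | sn.1 < e₁ + q * P.n}.ncard := by
    intro q
    induction q with
    | zero => intro _; simp
    | succ q ih =>
      intro hq
      have e1 : e₁ + (q + 1) * P.n = e₁ + q * P.n + P.n := by ring
      rw [e1] at hq ⊢
      obtain ⟨e, h1, h2, h3⟩ := S.rotation.exists_notMem S.byz_card hg
        (by omega : P.n < e₁ + q * P.n)
      have h4 := X.lt_of_last_lt (t := t) (by omega : 1 ≤ e) (by omega) hu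
      have h5 := (X.committedIn_subset (e := e)).trans (X.committed_mono (t := X.last e) h4.le)
      have h6 : {sn ∈ X.committed t | sn.1 < e₁ + q * P.n} ∪ X.committedIn e (X.last e) ⊆
          {sn ∈ X.committed t | sn.1 < e₁ + q * P.n + P.n} := by
        rintro sn (⟨h7, h8⟩ | h7)
        · exact ⟨h7, by omega⟩
        · exact ⟨h5 h7, by have := h7.1; omega⟩
      have h7 : Disjoint {sn ∈ X.committed t | sn.1 < e₁ + q * P.n}
          (X.committedIn e (X.last e)) := by
        rw [Set.disjoint_left]
        rintro sn ⟨-, h8⟩ h9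
        have := h9.1
        omega
      have h8 := Set.ncard_le_ncard h6 ((X.committed_finite t).subset fun _ => And.left)
      rw [Set.ncard_union_eq h7 ((X.committed_finite t).subset fun _ => And.left)
        ((X.committed_finite t).subset h5)] at h8
      rw [Nat.succ_mul]
      have := ih (by omega)
      have := hQ e (by omega) h3
      omega
  by_cases h : e₁ ≤ (X.st u t).ep
  · refine (key _ ?_).trans (Set.ncard_le_ncard (fun _ => And.left) (X.committed_finite t))
    have := Nat.div_mul_le_self ((X.st u t).ep - e₁) P.n
    omega
  · rw [Nat.sub_eq_zero_of_le (by omega)]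
    simp

/-- The amortized cost of committing a request after GST is linear. -/
theorem amortized (hf : 0 < P.f) (hg : P.n ≤ P.g) (hn : P.n < e₁)
    (hQ : ∀ e ≥ e₁, S.prim e ∉ S.byz → Q ≤ (X.committedIn e (X.last e)).ncard) {α : ℝ}
    (hα : 0 < α) (hαQ : α * (P.n : ℝ) ^ 3 ≤ Q) :
    ∃ t₀ ≥ X.gst, ∀ t ≥ t₀,
      0 < (X.committed t \ X.committed X.gst).ncard ∧
      1 / 6 * P.n * ((X.committed t \ X.committed X.gst).ncard : ℝ)
        ≤ X.cost (fun _ => True) X.gst t ∧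
      (X.cost (fun _ => True) X.gst t : ℝ)
        ≤ (2 * (14 + (15 + 64 * P.k) / α) + 1) * P.n *
          ((X.committed t \ X.committed X.gst).ncard : ℝ) := by
  have hn1 : (1 : ℝ) ≤ P.n := by
    have : 1 ≤ P.n := by simp [Params.n]
    exact_mod_cast this
  have hQ1 : 1 ≤ Q := by
    have h1 : (0 : ℝ) < Q := lt_of_lt_of_le (by positivity) hαQ
    exact_mod_cast h1
  -- `G` and `W` are the requests and the cost before GST, `Z` is the cost of the epochs outside
  -- full blocks. The multiples in `Y` ensure `R ≥ G + Z + 6 * W + 1` for the number `R` of requests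
  -- after GST.
  set G := (X.committed X.gst).ncard with hG
  set W := X.cost (fun _ => True) 0 X.gst with hW
  set Z := P.n ^ 3 * (15 + 64 * P.k) * (P.n + e₁) with hZ
  set Y := 2 * G + Z + 6 * W + 1 with hY
  obtain ⟨u₀, hu₀⟩ := exists_correct S
  obtain ⟨t₁, ht₁⟩ := X.exists_ep_ge (e₁ + Y * P.n)
  refine ⟨max X.gst t₁, le_max_left _ _, fun t ht => ?_⟩
  have htg : X.gst ≤ t := (le_max_left _ _).trans ht
  have hCY : Y ≤ (X.committed t).ncard := by
    have h1 := X.mul_le_ncard_committed hg hn hQ hu₀ t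
    have h2 : e₁ + Y * P.n ≤ (X.st u₀ t).ep :=
      (ht₁ u₀ hu₀).trans (X.ep_mono hu₀ ((le_max_right _ _).trans ht))
    have h3 : Y ≤ ((X.st u₀ t).ep - e₁) / P.n :=
      (Nat.le_div_iff_mul_le (by simp [Params.n])).2 (by omega)
    exact (Nat.le_mul_of_pos_right _ hQ1).trans ((Nat.mul_le_mul_right _ h3).trans h1)
  have hR : (X.committed t \ X.committed X.gst).ncard + G = (X.committed t).ncard :=
    Set.ncard_sdiff_add_ncard_of_subset (X.committed_mono htg) (X.committed_finite t)
  have hsplit := X.cost_split (fun _ => True) htg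
  rw [← hW] at hsplit
  have hlow := X.committed_mul_le_cost t
  have hup : (X.cost (fun _ => True) 0 t : ℝ) ≤
      (14 + (15 + 64 * P.k) / α) * P.n * (X.committed t).ncard + Z := by
    obtain ⟨u, hu, hM⟩ := Finset.exists_mem_eq_sup
      (Finset.univ.filter fun u => u ∉ S.byz) ⟨u₀, Finset.mem_filter.2 ⟨Finset.mem_univ _, hu₀⟩⟩
      fun u => (X.st u t).ep
    have h1 := X.cost_le (t := t) (M := (X.st u t).ep) hf fun w hw => by
      rw [← hM]
      exact Finset.le_sup (f := fun u => (X.st u t).ep)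
        (Finset.mem_filter.2 ⟨Finset.mem_univ w, hw⟩)
    have h2 := X.mul_le_ncard_committed hg hn hQ (Finset.mem_filter.1 hu).2 t
    set q := ((X.st u t).ep - e₁) / P.n
    -- `q` counts the full blocks of n epochs since `e₁`. Each has committed at least `α * n ^ 3`
    -- requests, which pay for the epoch-dependent costs of the block.
    have h3 : (X.st u t).ep + 1 ≤ q * P.n + (P.n + e₁) := by
      have := Nat.lt_div_mul_add (a := (X.st u t).ep - e₁) (b := P.n) (by simp [Params.n])
      change _ < q * P.n + P.n at this
      omega
    have h4 : X.cost (fun _ => True) 0 t ≤ 14 * P.n * (X.committed t).ncard +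
        q * P.n * (P.n ^ 3 * (15 + 64 * P.k)) + Z := by
      refine h1.trans ?_
      have := Nat.mul_le_mul_right (P.n ^ 3 * (15 + 64 * P.k)) h3
      rw [hZ]
      linarith
    have h5 : (q : ℝ) * (P.n : ℝ) ^ 3 ≤ (X.committed t).ncard / α := by
      rw [le_div_iff₀ hα]
      have h6 : (q : ℝ) * Q ≤ (X.committed t).ncard := by exact_mod_cast h2
      have h7 := mul_le_mul_of_nonneg_left hαQ (Nat.cast_nonneg (α := ℝ) q)
      linarith
    have h8 : (X.cost (fun _ => True) 0 t : ℝ) ≤ 14 * P.n * (X.committed t).ncard +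
        q * P.n * (P.n ^ 3 * (15 + 64 * P.k)) + Z := by exact_mod_cast h4
    have h9 := mul_le_mul_of_nonneg_left h5
      (by positivity : (0 : ℝ) ≤ P.n * (15 + 64 * P.k))
    calc (X.cost (fun _ => True) 0 t : ℝ) ≤ _ := h8
      _ = 14 * P.n * (X.committed t).ncard + P.n * (15 + 64 * P.k) * (q * (P.n : ℝ) ^ 3) + Z := by
        ring
      _ ≤ 14 * P.n * (X.committed t).ncard +
          P.n * (15 + 64 * P.k) * ((X.committed t).ncard / α) + Z := by linarith
      _ = _ := by ring
  set R := (X.committed t \ X.committed X.gst).ncard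
  set C := (X.committed t).ncard
  set A := X.cost (fun _ => True) X.gst t
  have hR1 : G + Z + 6 * W + 1 ≤ R := by omega
  have hRreal : (G : ℝ) + Z + 6 * W + 1 ≤ R := by exact_mod_cast hR1
  have hCreal : (R : ℝ) + G = C := by exact_mod_cast hR
  have hAreal : (X.cost (fun _ => True) 0 t : ℝ) = W + A := by exact_mod_cast hsplit
  have hG0 : (0 : ℝ) ≤ G := Nat.cast_nonneg _
  have hZ0 : (0 : ℝ) ≤ Z := Nat.cast_nonneg _
  have hW0 : (0 : ℝ) ≤ W := Nat.cast_nonneg _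
  have hRn : (R : ℝ) ≤ P.n * R := le_mul_of_one_le_left (by linarith) hn1
  refine ⟨by omega, ?_, ?_⟩
  -- Lower bound: `R * n / 3` less the cost before GST, which is at most `R / 6`.
  · have h1 : (C : ℝ) * (P.f + 1) ≤ W + A := by
      rw [← hAreal]
      exact_mod_cast hlow
    have h2 : (P.n : ℝ) ≤ 3 * (P.f + 1) := by
      simp only [Params.n]
      push_cast
      linarith
    have h3 : (R : ℝ) * (P.n / 3) ≤ C * (P.f + 1) :=
      mul_le_mul (by linarith) (by linarith) (by positivity) (by positivity)
    linarith
  -- Upper bound: `G ≤ R` gives `C ≤ 2 * R`, and `Z ≤ R ≤ n * R` gives the last 1 of the constant.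
  · rw [hAreal] at hup
    have hβ : 0 ≤ (14 + (15 + 64 * (P.k : ℝ)) / α) * P.n := by positivity
    have h1 := mul_le_mul_of_nonneg_left (by linarith : (C : ℝ) ≤ 2 * R) hβ
    linarith

end Execution

end FnF

theorem mainTheorem3 :
    ∃ K : ℕ, ∀ (k : ℕ) (c : ℝ), 0 < k → 0 < c →
    ∃ (N : ℕ) (a b : ℝ), 0 < a ∧ 0 < b ∧
    ∀ (P : FnF.Params) (S : FnF.System P) (X : FnF.Execution S),
      P.k = k → N ≤ P.n → c * (P.n : ℝ) ^ 2 ≤ P.Cmin → P.n ≤ P.g → 1 ≤ P.Δ →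
      K * P.Δ ≤ P.Tp → K * P.Δ ≤ P.Te → K * P.Δ * P.Cmin ≤ P.T →
      -- committing one request in an epoch costs `Θ(n)`
      (∀ e v i t,
        (X.cost (FnF.ForRequest e v i) 0 t : ℝ) ≤ b * P.n ∧
        ((∃ x, X.CommittedAt e v i x t) → a * P.n ≤ X.cost (FnF.ForRequest e v i) 0 t)) ∧
      -- an epoch-change, successful or not, costs `Θ(n³)`
      (∀ e t, (X.cost (FnF.ForEpochChange e) 0 t : ℝ) ≤ b * (P.n : ℝ) ^ 3) ∧
      (∃ e₀, ∀ e ≥ e₀, ∃ t, a * (P.n : ℝ) ^ 3 ≤ X.cost (FnF.ForEpochChange e) 0 t) ∧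
      -- an epoch under a correct primary is entered by all and commits `Ω(n³)` requests
      (∃ e₀, ∀ e ≥ e₀, S.prim e ∉ S.byz →
        ∃ t, (∀ u, u ∉ S.byz → X.EntersBy u e t) ∧
          a * (P.n : ℝ) ^ 3 ≤ ((X.committedIn e t).ncard : ℝ)) ∧
      -- the amortized cost of committing a request after GST is `Θ(n)`
      (∃ t₀ ≥ X.gst, ∀ t ≥ t₀,
        0 < (X.committed t \ X.committed X.gst).ncard ∧
        a * P.n * ((X.committed t \ X.committed X.gst).ncard : ℝ)
          ≤ X.cost (fun _ => True) X.gst t ∧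
        (X.cost (fun _ => True) X.gst t : ℝ)
          ≤ b * P.n * ((X.committed t \ X.committed X.gst).ncard : ℝ)) := by
  -- `n ≥ 4` yields `f > 0`, and `n ≥ 4 * k / c` keeps the `2kn` numbers open to hanging items
  -- within half of `c * n ^ 2`. Then `f + 1 ≥ n / 3` leaders commit `c * n ^ 2 / 2` requests each,
  -- whence `c / 6`; the value `1 / 6` comes from the amortized lower bound. `b` is a sum dominating
  -- all upper bounds.
  refine ⟨100, fun k c hk hc => ⟨max 4 ⌈4 * k / c⌉₊, min (1 / 6) (c / 6),
    23 + 12 * k + (2 * (14 + (15 + 64 * k) / (c / 6)) + 1), by positivity, by positivity, ?_⟩⟩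
  rintro P S X rfl hN hCmin hg hΔ hTp hTe hT
  have hn4 : 4 ≤ P.n := (le_max_left _ _).trans hN
  have hf : 0 < P.f := by
    simp only [FnF.Params.n] at hn4
    omega
  have hn0 : (4 : ℝ) ≤ P.n := by exact_mod_cast hn4
  have hnf : (P.n : ℝ) = 3 * P.f + 1 := by simp [FnF.Params.n]
  have hC : 0 < P.Cmin := by
    have : (0 : ℝ) < P.Cmin := lt_of_lt_of_le (by positivity) hCmin
    exact_mod_cast this
  have hTp' : 10 * P.Δ + 18 ≤ P.Tp := by omega
  have hTe' : 10 * P.Δ + 18 ≤ P.Te := by omega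
  -- As `Δ ≥ 1` and `Cmin ≥ 1`, the left side is at most `45 * Δ * Cmin`.
  have hT' : 10 * P.Δ + 18 + P.Cmin * (7 * P.Δ + 10) ≤ P.T := by
    have h1 : P.Cmin ≤ P.Δ * P.Cmin := Nat.le_mul_of_pos_left _ hΔ
    have h2 : P.Δ ≤ P.Δ * P.Cmin := Nat.le_mul_of_pos_right _ hC
    nlinarith
  obtain ⟨e₁, he₁, hsync⟩ := X.eventually_syncAt hC
    (by omega : 10 * P.Δ + 18 ≤ P.T) hTp' hTe' (by omega)
  set Q := (P.f + 1) * (P.Cmin - P.n * (2 * P.k)) with hQ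
  have hQα : c / 6 * (P.n : ℝ) ^ 3 ≤ Q := by
    have h1 : 4 * P.k / c ≤ P.n := (Nat.le_ceil _).trans (by exact_mod_cast (le_max_right _ _).trans hN)
    rw [div_le_iff₀ hc] at h1
    have h2 : (P.Cmin : ℝ) ≤ (P.Cmin - P.n * (2 * P.k) : ℕ) + P.n * (2 * P.k) := by
      exact_mod_cast (by omega : P.Cmin ≤ (P.Cmin - P.n * (2 * P.k)) + P.n * (2 * P.k))
    have h3 : c / 2 * (P.n : ℝ) ^ 2 ≤ (P.Cmin - P.n * (2 * P.k) : ℕ) := by nlinarith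
    have h4 : (P.n : ℝ) / 3 ≤ P.f + 1 := by linarith
    have h5 := mul_le_mul h4 h3 (by positivity) (by positivity)
    have h6 : (Q : ℝ) = (P.f + 1) * (P.Cmin - P.n * (2 * P.k) : ℕ) := by
      rw [hQ, Nat.cast_mul]
      push_cast
      rfl
    rw [h6]
    linarith
  have hcommit : ∀ e ≥ e₁, S.prim e ∉ S.byz → Q ≤ (X.committedIn e (X.last e)).ncard :=
    fun e he hp => (hsync e he).le_ncard_committedIn hp hf hk hC hTp' hTe' hT'
  have ha1 : min (1 / 6) (c / 6) ≤ 1 / 6 := min_le_left _ _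
  have ha2 : min (1 / 6) (c / 6) ≤ c / 6 := min_le_right _ _
  have hb : 0 ≤ 2 * (14 + (15 + 64 * (P.k : ℝ)) / (c / 6)) + 1 := by positivity
  have hk0 : (0 : ℝ) ≤ P.k := Nat.cast_nonneg _
  refine ⟨fun e v i t => ⟨?_, fun ⟨x, hx⟩ => ?_⟩, fun e t => ?_, ⟨e₁, fun e he => ⟨X.last e, ?_⟩⟩,
    ⟨e₁, fun e he hp => ⟨X.last e, fun u hu => ⟨_, le_rfl, ?_⟩, ?_⟩⟩, ?_⟩
  · have h1 : (X.cost (FnF.ForRequest e v i) 0 t : ℝ) ≤ 10 * P.n := by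
      exact_mod_cast X.cost_forRequest_le hf e v i t
    exact h1.trans (mul_le_mul_of_nonneg_right (by linarith) (by positivity))
  · have h1 : ((P.f + 1 : ℕ) : ℝ) ≤ X.cost (FnF.ForRequest e v i) 0 t := by
      exact_mod_cast X.le_cost_forRequest hx
    have h2 := mul_le_mul_of_nonneg_right ha1 (by positivity : (0 : ℝ) ≤ P.n)
    push_cast at h1
    linarith
  · have h1 : (X.cost (FnF.ForEpochChange e) 0 t : ℝ) ≤ (P.n : ℝ) ^ 3 * (13 + 12 * P.k) := by
      exact_mod_cast X.cost_forEpochChange_le e t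
    rw [mul_comm] at h1
    exact h1.trans (mul_le_mul_of_nonneg_right (by linarith) (by positivity))
  · have h1 : ((2 * P.f + 1) * (2 * P.f * (P.n + 1)) : ℝ) ≤
        X.cost (FnF.ForEpochChange e) 0 (X.last e) := by
      exact_mod_cast X.le_cost_forEpochChange (hsync e he) hC
        (by omega : 10 * P.Δ + 18 ≤ P.T) hTp' hTe' (by omega)
    have h2 := mul_le_mul_of_nonneg_right ha1 (by positivity : (0 : ℝ) ≤ (P.n : ℝ) ^ 3)
    -- Both `2 * f + 1` and, since `f ≥ 1`, also `2 * f` are at least `n / 2`; together this gives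
    -- `n ^ 3 / 4`.
    have h3 : (P.n : ℝ) / 2 * (P.n : ℝ) ≤ 2 * P.f * (P.n + 1) :=
      mul_le_mul (by linarith) (by linarith) (by positivity) (by positivity)
    have h4 : (P.n : ℝ) / 2 * ((P.n : ℝ) / 2 * (P.n : ℝ)) ≤
        (2 * P.f + 1) * (2 * P.f * (P.n + 1)) :=
      mul_le_mul (by linarith) h3 (by positivity) (by positivity)
    nlinarith [pow_pos (by linarith : (0 : ℝ) < P.n) 3]
  · exact ((hsync e he).exists_committed hp hf hk hC hTp' hTe' hT').1 u hu
  · refine (mul_le_mul_of_nonneg_right ha2 (by positivity)).trans (hQα.trans ?_)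
    exact_mod_cast hcommit e he hp
  · obtain ⟨t₀, h0, h1⟩ := X.amortized hf hg he₁ hcommit (by positivity : 0 < c / 6) hQα
    refine ⟨t₀, h0, fun t ht => ?_⟩
    obtain ⟨h2, h3, h4⟩ := h1 t ht
    refine ⟨h2, le_trans ?_ h3, h4.trans ?_⟩
    · gcongr
    · exact mul_le_mul_of_nonneg_right (mul_le_mul_of_nonneg_right (by linarith) (by positivity))
        (by positivity)
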